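/- Let $p>2$ be a prime. Let $\mathrm{GT}(\mathbb{Q}_p)$ be the Grothendieck–Teichmüller group: the set of pairs $(\lambda,f)$ with $\lambda\in\mathbb{Q}_p^*$ and $f\in\mathbb{Q}_p\langle\langle x,y\rangle\rangle$ group-like (for $\Delta x=x\otimes 1+1\otimes x$, $\Delta y=y\otimes 1+1\otimes y$) such that $f(x,y)f(y,x)=1$; $f(z,x)e^{mz}f(y,z)e^{my}f(x,y)e^{mx}=1$, where $e^xe^ye^z=1$ and $m=(\lambda-1)/2$; and $$f(x_{12},\mathrm{ch}(x_{23},x_{24}))\,f(\mathrm{ch}(x_{13},x_{23}),x_{34})=f(x_{23},x_{34})\,f(\mathrm{ch}(x_{12},x_{13}),\mathrm{ch}(x_{24},x_{34}))\,f(x_{12},x_{23})$$ in the $\mathbb{Q}_p$-prounipotent completion of the pure braid group $\mathrm{PB}_4$, where $x_{ij}=\ln X_{ij}$ for the standard generators $X_{ij}=\sigma_{j-1}\cdots\sigma_{i+1}\sigma_i^2\sigma_{i+1}^{-1}\cdots\sigma_{j-1}^{-1}$ and $\mathrm{ch}(u,v)=\ln(e^ue^v)$. The group law is $(\lambda_1,f_1)(\lambda_2,f_2)=(\lambda_1\lambda_2,\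 f_1(\lambda_2f_2xf_2^{-1},\lambda_2y)f_2)$. Let $\mathfrak{gt}(\mathbb{Q}_p)$ be its Lie algebra: the set of pairs $(s,\psi)$ with $s\in\mathbb{Q}_p$ and $\psi$ in the degree completion of the free Lie algebra on $x,y$ such that $\psi(x,y)=-\psi(y,x)$; $\psi(x,y)+\psi(y,z)+\psi(z,x)+\tfrac{s}{2}(x+y+z)=0$ for $e^xe^ye^z=1$; and $$\psi(x_{12},\mathrm{ch}(x_{23},x_{24}))+\psi(\mathrm{ch}(x_{13},x_{23}),x_{34})=\psi(x_{23},x_{34})+\psi(\mathrm{ch}(x_{12},x_{13}),\mathrm{ch}(x_{24},x_{34}))+\psi(x_{12},x_{23}).$$ Put $\hat x=e^x-1$, $\hat y=e^y-1$, and let $\mathbb{Z}_p\langle\langle\hat x,\hat y\rangle\rangle^{\geq k}\subset\mathbb{Q}_p\langle\langle x,y\rangle\rangle$ be the set of non-commutative power series in $\hat x,\hat y$ with coefficients in $\mathbb{Z}_p$ and no terms of degree less than $k$ in $\hat x,\hat y$ (the superscript is omitted if $k=0$). Let $\mathrm{GT}_p\subset\mathrm{GT}(\mathbb{Q}_p)$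 be the subgroup of pairs $(\lambda,f)$ with $\lambda\in\mathbb{Z}_p^*$ and $f$ in the pro-$p$ completion of the free group on $e^x,e^y$, i.e. $f\in\mathbb{Z}_p\langle\langle\hat x,\hat y\rangle\rangle$. **Proposition.** Let $(\lambda',f')\in\mathrm{GT}_p$ be such that $\lambda'\in 1+p\mathbb{Z}_p^*$ and $$f'\in 1+p\,\mathbb{Z}_p\langle\langle\hat x,\hat y\rangle\rangle^{\geq 1}+\mathbb{Z}_p\langle\langle\hat x,\hat y\rangle\rangle^{\geq p-1}.$$ Then $\ln\lambda'\neq 0$, the logarithm $\ln(\lambda',f')=\lim_{n\to\infty}p^{-n}\big((\lambda',f')^{p^n}-(1,1)\big)$ exists (coefficientwise $p$-adic limit) and is of the form $\ln\lambda'\cdot(1,\psi)$, and the element $(1,\psi)=\ln(\lambda',f')/\ln\lambda'$ lies in $\mathfrak{gt}(\mathbb{Q}_p)$ and satisfies $$\psi\in\mathbb{Z}_p\langle\langle\hat x,\hat y\rangle\rangle+\sum_{s=0}^\infty p^{-(s+1)}\,\mathbb{Z}_p\langle\langle\hat x,\hat y\rangle\rangle^{\geq p^s(p-1)}.$$ Here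 elements of the infinite sum are the series $\sum_{s\ge0}p^{-(s+1)}b_s$ with $b_s\in\mathbb{Z}_p\langle\langle\hat x,\hat y\rangle\rangle^{\geq p^s(p-1)}$. -/

import Mathlib

open Filter Topology

/-! ### Non-commutative formal power series in two variables -/

/-- Non-commutative formal power series `R⟨⟨x, y⟩⟩`: families of coefficients indexed by the words
in the letters `0` (for `x`) and `1` (for `y`). -/
def NCSeries (R : Type*) : Type _ := List (Fin 2) → R

namespace NCSeries

section Ring

variable {R : Type*} [CommRing R]

instance : AddCommGroup (NCSeries R) := inferInstanceAs (AddCommGroup (List (Fin 2) → R))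

instance : Module R (NCSeries R) := inferInstanceAs (Module R (List (Fin 2) → R))

/-- The unit series. -/
instance : One (NCSeries R) := ⟨fun w => if w = [] then 1 else 0⟩

/-- The concatenation product: sum over all ways of cutting a word into two pieces. -/
instance : Mul (NCSeries R) :=
  ⟨fun f g w => ∑ i ∈ Finset.range (w.length + 1), f (w.take i) * g (w.drop i)⟩

theorem add_apply (f g : NCSeries R) (w : List (Fin 2)) : (f + g) w = f w + g w := rfl

theorem zero_apply (w : List (Fin 2)) : (0 : NCSeries R) w = 0 := rfl

theorem smul_apply (c : R) (f : NCSeries R) (w : List (Fin 2)) : (c • f) w = c * f w := rfl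

theorem one_apply (w : List (Fin 2)) : (1 : NCSeries R) w = if w = [] then 1 else 0 := rfl

theorem mul_apply (f g : NCSeries R) (w : List (Fin 2)) :
    (f * g) w = ∑ i ∈ Finset.range (w.length + 1), f (w.take i) * g (w.drop i) := rfl

protected theorem mul_assoc' (f g h : NCSeries R) : f * g * h = f * (g * h) := by
  funext w
  simp only [mul_apply, Finset.sum_mul, Finset.mul_sum]
  rw [Finset.sum_sigma', Finset.sum_sigma']
  refine Finset.sum_nbij' (fun a => ⟨a.2, a.1 - a.2⟩) (fun b => ⟨b.1 + b.2, b.1⟩) ?_ ?_ ?_ ?_ ?_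
  · rintro ⟨i, j⟩ h
    simp only [Finset.mem_sigma, Finset.mem_range, List.length_take, List.length_drop] at h ⊢
    omega
  · rintro ⟨i, j⟩ h
    simp only [Finset.mem_sigma, Finset.mem_range, List.length_take, List.length_drop] at h ⊢
    omega
  · rintro ⟨i, j⟩ h
    simp only [Finset.mem_sigma, Finset.mem_range, List.length_take] at h
    have : j + (i - j) = i := by omega
    simp [this]
  · rintro ⟨i, j⟩ h
    simp
  · rintro ⟨i, j⟩ h
    simp only [Finset.mem_sigma, Finset.mem_range, List.length_take] at h
    have h1 : min j i = j := by omega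
    have h2 : j + (i - j) = i := by omega
    simp only [List.take_take, List.drop_drop, List.drop_take, h1, h2]
    ring

protected theorem one_mul' (f : NCSeries R) : 1 * f = f := by
  funext w
  rw [mul_apply, Finset.sum_eq_single 0]
  · simp [one_apply]
  · intro i hi h0
    have : w.take i ≠ [] := by
      intro h
      have := congrArg List.length h
      simp only [List.length_take, List.length_nil, Finset.mem_range] at this hi
      omega
    simp [one_apply, this]
  · simp

protected theorem mul_one' (f : NCSeries R) : f * 1 = f := by
  funext w
  rw [mul_apply, Finset.sum_eq_single w.length]
  · simp [one_apply]
  · intro i hi h0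
    have : w.drop i ≠ [] := by
      intro h
      have := congrArg List.length h
      simp only [List.length_drop, List.length_nil, Finset.mem_range] at this hi
      omega
    simp [one_apply, this]
  · simp

instance : Ring (NCSeries R) :=
  { (inferInstance : AddCommGroup (NCSeries R)), (inferInstance : Mul (NCSeries R)),
    (inferInstance : One (NCSeries R)) with
    left_distrib := fun f g h => by
      funext w; simp only [mul_apply, add_apply, mul_add, Finset.sum_add_distrib]
    right_distrib := fun f g h => by
      funext w; simp only [mul_apply, add_apply, add_mul, Finset.sum_add_distrib]
    zero_mul := fun f => by funext w; simp [mul_apply, zero_apply]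
    mul_zero := fun f => by funext w; simp [mul_apply, zero_apply]
    mul_assoc := NCSeries.mul_assoc'
    one_mul := NCSeries.one_mul'
    mul_one := NCSeries.mul_one' }

instance : Algebra R (NCSeries R) :=
  Algebra.ofModule
    (fun r f g => by
      funext w; simp only [mul_apply, smul_apply, Finset.mul_sum, mul_assoc])
    (fun r f g => by
      funext w; simp only [mul_apply, smul_apply, Finset.mul_sum, mul_left_comm])

/-- The commutator bracket. -/
instance : LieRing (NCSeries R) := LieRing.ofAssociativeRing

instance : LieAlgebra R (NCSeries R) := LieAlgebra.ofAssociativeAlgebra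

/-- The variable `x`. -/
def X : NCSeries R := fun w => if w = [0] then 1 else 0

/-- The variable `y`. -/
def Y : NCSeries R := fun w => if w = [1] then 1 else 0

/-- The homogeneous component of degree `n`. -/
def homog (n : ℕ) (f : NCSeries R) : NCSeries R := fun w => if w.length = n then f w else 0

/-- The value `f(a, b)` computed with the words of length at most `n` only, in any `R`-algebra. -/
def evalTrunc {A : Type*} [Ring A] [Algebra R A] (n : ℕ) (f : NCSeries R) (a b : A) : A :=
  ∑ k ∈ Finset.range (n + 1), ∑ v : Fin k → Fin 2,
    f (List.ofFn v) • (List.ofFn fun i => if v i = 0 then a else b).prod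

/-- The substitution `f(a, b)` of two series `a`, `b` without constant term into a series `f`:
words longer than `w` do not contribute to the coefficient of `w`. -/
def subst (f a b : NCSeries R) : NCSeries R := fun w => evalTrunc w.length f a b w

/-- The multiset (as a list) of all shuffles of two words. -/
def shuffles : List (Fin 2) → List (Fin 2) → List (List (Fin 2))
  | [], v => [v]
  | a :: u, [] => [a :: u]
  | a :: u, b :: v =>
    (shuffles u (b :: v)).map (fun w => a :: w) ++ (shuffles (a :: u) v).map (fun w => b :: w)
  termination_by u v => u.length + v.length

/-- The coefficient of `u ⊗ v` in `Δ f`, where `Δ` is the continuous algebra morphism with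
`Δ x = x ⊗ 1 + 1 ⊗ x` and `Δ y = y ⊗ 1 + 1 ⊗ y`: the coefficient of `u ⊗ v` in `Δ w`, for a word
`w`, is the number of times that `w` occurs among the shuffles of `u` and `v`. -/
def coproduct (f : NCSeries R) (u v : List (Fin 2)) : R := ((shuffles u v).map f).sum

/-- Group-like series: `Δ f = f ⊗ f` and `f` has constant term `1`. -/
def IsGroupLike (f : NCSeries R) : Prop := f [] = 1 ∧ ∀ u v, coproduct f u v = f u * f v

/-- The degree completion of the free Lie algebra on `x` and `y`: series all of whose homogeneous
components lie in the Lie subalgebra generated by `x` and `y` (for the commutator bracket). -/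
def IsLieSeries (f : NCSeries R) : Prop :=
  ∀ n, homog n f ∈ LieSubalgebra.lieSpan R (NCSeries R) {X, Y}

end Ring

section Field

variable {K : Type*} [Field K]

/-- The exponential of a series without constant term. -/
def exp (a : NCSeries K) : NCSeries K := fun w =>
  ∑ k ∈ Finset.range (w.length + 1), ((k.factorial : K)⁻¹ • a ^ k) w

variable (K) in
/-- The logarithm `∑ (-1) ^ (k + 1) / k * (g - 1) ^ k` cut after `k = n`, in any `K`-algebra. -/
def logTrunc {A : Type*} [Ring A] [Algebra K A] (n : ℕ) (g : A) : A :=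
  ∑ k ∈ Finset.range n, ((-1) ^ k / ((k : K) + 1)) • (g - 1) ^ (k + 1)

/-- The logarithm of a series with constant term `1`. -/
def log (g : NCSeries K) : NCSeries K := fun w => logTrunc K w.length g w

/-- The series `z = - ch(x, y) = - ln (e ^ x * e ^ y)`, so that `e ^ x * e ^ y * e ^ z = 1`. -/
def Z : NCSeries K := -log (exp X * exp Y)

end Field

end NCSeries

/-! ### The pure braid group on four strands -/

/-- Artin's relations for the braid group on four strands. -/
def braidRels4 : Set (FreeGroup (Fin 3)) :=
  {FreeGroup.of 0 * FreeGroup.of 1 * FreeGroup.of 0 *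
      (FreeGroup.of 1 * FreeGroup.of 0 * FreeGroup.of 1)⁻¹,
    FreeGroup.of 1 * FreeGroup.of 2 * FreeGroup.of 1 *
      (FreeGroup.of 2 * FreeGroup.of 1 * FreeGroup.of 2)⁻¹,
    FreeGroup.of 0 * FreeGroup.of 2 * (FreeGroup.of 2 * FreeGroup.of 0)⁻¹}

/-- The braid group on four strands. -/
abbrev Braid4 : Type := PresentedGroup braidRels4

namespace Braid4

/-- The three standard generators (numbered from `0`). -/
def σ (i : Fin 3) : Braid4 := PresentedGroup.of i

/-- The permutation of the four strands underlying a braid. -/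
def toPerm : Braid4 →* Equiv.Perm (Fin 4) :=
  PresentedGroup.toGroup (f := fun i : Fin 3 => Equiv.swap i.castSucc i.succ) (by
    rintro r (rfl | rfl | rfl) <;> simp only [map_mul, map_inv, FreeGroup.lift_apply_of] <;> decide)

theorem toPerm_σ (i : Fin 3) : toPerm (σ i) = Equiv.swap i.castSucc i.succ :=
  PresentedGroup.toGroup.of _

end Braid4

/-- The pure braid group on four strands. -/
abbrev PureBraid4 : Type := Braid4.toPerm.ker

namespace PureBraid4

open Braid4

/-! The standard generators
`X_{i,j} = σ_{j-1} ⋯ σ_{i+1} σ_i² σ_{i+1}⁻¹ ⋯ σ_{j-1}⁻¹` (strands numbered from `1`). -/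

/-- The pure braid generator of strands 1 and 2. -/
def X12 : PureBraid4 := ⟨σ 0 ^ 2, by simp [MonoidHom.mem_ker, toPerm_σ, pow_two]⟩

/-- The pure braid generator of strands 2 and 3. -/
def X23 : PureBraid4 := ⟨σ 1 ^ 2, by simp [MonoidHom.mem_ker, toPerm_σ, pow_two]⟩

/-- The pure braid generator of strands 3 and 4. -/
def X34 : PureBraid4 := ⟨σ 2 ^ 2, by simp [MonoidHom.mem_ker, toPerm_σ, pow_two]⟩

/-- The pure braid generator of strands 1 and 3. -/
def X13 : PureBraid4 := ⟨σ 1 * σ 0 ^ 2 * (σ 1)⁻¹, by simp [MonoidHom.mem_ker, toPerm_σ, pow_two]⟩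

/-- The pure braid generator of strands 2 and 4. -/
def X24 : PureBraid4 := ⟨σ 2 * σ 1 ^ 2 * (σ 2)⁻¹, by simp [MonoidHom.mem_ker, toPerm_σ, pow_two]⟩

variable (K : Type*) [Field K]

/-- The augmentation ideal of the group algebra of the pure braid group. -/
noncomputable def augIdeal : Submodule K (MonoidAlgebra K PureBraid4) :=
  LinearMap.ker (MonoidAlgebra.lift K K PureBraid4 (1 : PureBraid4 →* K)).toLinearMap

variable {K} in
/-- `f(ln g, ln h)`, for pure braids `g` and `h`, modulo the `(n + 1)`-st power of the augmentation
ideal (in which all omitted terms lie). With `x_{i,j} = ln X_{i,j}`, one has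
`ch(x_{i,j}, x_{k,l}) = ln (X_{i,j} * X_{k,l})`. -/
noncomputable def evalLog (n : ℕ) (f : NCSeries K) (g h : PureBraid4) :
    MonoidAlgebra K PureBraid4 :=
  NCSeries.evalTrunc n f
    (NCSeries.logTrunc K n (MonoidAlgebra.of K PureBraid4 g))
    (NCSeries.logTrunc K n (MonoidAlgebra.of K PureBraid4 h))

variable {K} in
/-- Equality in the completion `lim K[PB₄] / Iⁿ` of the group algebra, which contains the prounipotent
completion of `PB₄` and its Lie algebra; elements are given by approximations modulo `I ^ (n + 1)`
for all `n`. -/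
def CompletedEq (a b : ℕ → MonoidAlgebra K PureBraid4) : Prop :=
  ∀ n, a n - b n ∈ augIdeal K ^ (n + 1)

end PureBraid4

/-! ### The Grothendieck–Teichmüller group and its Lie algebra -/

/-- Pairs `(λ, f)` of a scalar and a series. -/
structure GTPair (K : Type*) where
  /-- The scalar `λ`. -/
  lam : K
  /-- The series `f`. -/
  ser : NCSeries K

namespace GTPair

open NCSeries PureBraid4

variable {K : Type*} [Field K]

/-- The group law: `(λ₁, f₁) (λ₂, f₂) = (λ₁ λ₂, f₁(λ₂ f₂ x f₂⁻¹, λ₂ y) f₂)`. -/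
noncomputable def mul (g₁ g₂ : GTPair K) : GTPair K where
  lam := g₁.lam * g₂.lam
  ser := subst g₁.ser (g₂.lam • (g₂.ser * X * Ring.inverse g₂.ser)) (g₂.lam • Y) * g₂.ser

/-- The powers of an element for the group law; the neutral element is `(1, 1)`. -/
noncomputable def pow (g : GTPair K) : ℕ → GTPair K
  | 0 => ⟨1, 1⟩
  | n + 1 => mul (pow g n) g

/-- Membership in the Grothendieck–Teichmüller group `GT(K)`: `λ ≠ 0`, `f` is group-like, and the
duality, hexagon and pentagon equations hold. -/
structure IsGT (g : GTPair K) : Prop where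
  lam_ne_zero : g.lam ≠ 0
  groupLike : IsGroupLike g.ser
  duality : g.ser * subst g.ser Y X = 1
  hexagon :
    subst g.ser Z X * exp (((g.lam - 1) / 2) • Z) * subst g.ser Y Z * exp (((g.lam - 1) / 2) • Y) *
      g.ser * exp (((g.lam - 1) / 2) • X) = 1
  pentagon : CompletedEq
    (fun n => evalLog n g.ser X12 (X23 * X24) * evalLog n g.ser (X13 * X23) X34)
    (fun n => evalLog n g.ser X23 X34 * evalLog n g.ser (X12 * X13) (X24 * X34) *
      evalLog n g.ser X12 X23)

/-- Membership in the Lie algebra `gt(K)` of `GT(K)`; its elements are pairs `(s, ψ)` of a scalar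
and a Lie series. -/
structure IsGTLie (s : K) (ψ : NCSeries K) : Prop where
  lie : IsLieSeries ψ
  duality : ψ = -subst ψ Y X
  hexagon : ψ + subst ψ Y Z + subst ψ Z X + (s / 2) • (X + Y + Z) = 0
  pentagon : CompletedEq
    (fun n => evalLog n ψ X12 (X23 * X24) + evalLog n ψ (X13 * X23) X34)
    (fun n => evalLog n ψ X23 X34 + evalLog n ψ (X12 * X13) (X24 * X34) + evalLog n ψ X12 X23)

end GTPair

/-! ### The `p`-adic situation -/

section Padic

variable (p : ℕ) [Fact p.Prime]

/-- `ℤ_p⟨⟨x̂, ŷ⟩⟩^{≥ k}` inside `ℚ_p⟨⟨x, y⟩⟩`: the series `F(x̂, ŷ)`, where `x̂ = e ^ x - 1` and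
`ŷ = e ^ y - 1`, and `F` has coefficients in `ℤ_p` and no terms of degree less than `k`. -/
def hatIntegral (k : ℕ) : Set (NCSeries ℚ_[p]) :=
  {f | ∃ F : NCSeries ℤ_[p], (∀ w : List (Fin 2), w.length < k → F w = 0) ∧
    f = NCSeries.subst (fun w => (F w : ℚ_[p]))
      (NCSeries.exp NCSeries.X - 1) (NCSeries.exp NCSeries.Y - 1)}

/-- The `p`-adic logarithm `ln a = ∑_{k ≥ 1} (-1) ^ (k + 1) / k * (a - 1) ^ k`, for `|a - 1| < 1`. -/
noncomputable def padicLog (a : ℚ_[p]) : ℚ_[p] :=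
  ∑' k : ℕ, (-1) ^ k / ((k : ℚ_[p]) + 1) * (a - 1) ^ (k + 1)

namespace GTPair

/-- Membership in `GT_p`: elements `(λ, f)` of `GT(ℚ_p)` such that `λ` is a `p`-adic unit and `f`
lies in the pro-`p` completion of the free group, that is, the (group-like) series `f` lies in
`ℤ_p⟨⟨x̂, ŷ⟩⟩`. -/
structure IsGTp (g : GTPair ℚ_[p]) : Prop where
  isGT : IsGT g
  unit : ∃ u : ℤ_[p]ˣ, g.lam = ((u : ℤ_[p]) : ℚ_[p])
  integral : g.ser ∈ hatIntegral p 0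

/-- `ln g = (s, φ)`, for the logarithm of a `p`-adic Lie group: `(s, φ)` is the tangent vector at
`t = 0` of the one-parameter subgroup `t ↦ g ^ t` (`t ∈ ℤ_p`), that is, the limit of the difference
quotients `(g ^ t - 1) / t` along `t = p ^ n → 0`, taken coefficientwise. -/
def IsLog (g : GTPair ℚ_[p]) (s : ℚ_[p]) (φ : NCSeries ℚ_[p]) : Prop :=
  Tendsto (fun n : ℕ => ((pow g (p ^ n)).lam - 1) / (p : ℚ_[p]) ^ n) atTop (𝓝 s) ∧
  ∀ w : List (Fin 2),
    Tendsto (fun n : ℕ => ((pow g (p ^ n)).ser w - (1 : NCSeries ℚ_[p]) w) / (p : ℚ_[p]) ^ n)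
      atTop (𝓝 (φ w))

end GTPair

/-- Membership in `ℤ_p⟨⟨x̂, ŷ⟩⟩ + ∑_{s ≥ 0} p ^ (-(s + 1)) ℤ_p⟨⟨x̂, ŷ⟩⟩^{≥ p ^ s (p - 1)}`: sums
`a + ∑_s p ^ (-(s + 1)) b_s`, where the coefficient of each word is a sum with finitely many non-zero
terms, `b_s` having no terms of degree less than `p ^ s (p - 1)`. -/
def HasLogDenominators (ψ : NCSeries ℚ_[p]) : Prop :=
  ∃ a ∈ hatIntegral p 0, ∃ b : ℕ → NCSeries ℚ_[p],
    (∀ s, b s ∈ hatIntegral p (p ^ s * (p - 1))) ∧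
    ∀ w : List (Fin 2),
      HasSum (fun s : ℕ => ((p : ℚ_[p]) ^ (s + 1))⁻¹ * b s w) (ψ w - a w)

end Padic

/-! Analytic half. Write the second component of `g` as `F(x̂, ŷ)` with `F` integral, and that of
another element as `H(x̂, ŷ)`. Right multiplication by `g` acts on `H` by a substitution followed by
multiplication by `F`; this is a linear operator `T` in `H` (`hatTranslation`), so the series of `g
^ m` is `T ^ m` applied to `1`. The logarithm of `g` is therefore `log T` applied to `1`, that is `∑
(-1) ^ (k + 1) / k * (T - 1) ^ k 1`, provided that this converges.

Choose `0 < r < 1` with `r ^ (p - 1) = 1 / p` and use the Gauss norm `sup ‖F w‖ r ^ |w|`. The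
assumption on `f'` gives `F - 1` norm at most `1 / p`, and the assumption on `λ'` makes `e ^ (λ x) -
1` differ from `x̂` by norm at most `r / p`. Hence `T - 1` shrinks the Gauss norm by `1 / p`
(`gaussBound_hatTranslation_sub`), and it also preserves integrality. So the coefficient of `(T - 1)
^ k 1` at a word `w` is bounded both by `1` and by `r ^ (-|w|) p ^ (-k)`. Since the binomial
coefficients satisfy `C(p ^ n, k) / p ^ n → (-1) ^ (k + 1) / k`, dominated convergence yields the
limit (`tendsto_logSum`). Balancing the two bounds against the denominator `k` bounds the
coefficients in degree less than `p ^ j (p - 1)` by `p ^ (j - 1)` (`norm_translationLog_le`). As `ln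
λ'` has norm exactly `1 / p`, those of `ψ` are bounded by `p ^ j`, and cutting `ψ` at the degrees `p
^ s (p - 1)` gives the required sum.

Algebraic half. If all `g ^ (p ^ n)` lie in GT, then dividing the defining equations by `p ^ n ln
λ'` and letting `n` grow linearises them: products become sums, and group-like series become
primitive ones, which are Lie series by Friedrichs' theorem (`isGTLie_of_tangent`). It remains to
see that GT is closed under products (`IsGT.mul`). Identities are tested in algebras with a
nilpotent subspace, where series take values at logarithms of unipotent units. Duality and hexagon
then reduce to computations in a group. For the pentagon, following Drinfeld, `g` deforms a
representation of the braid group: the hexagon supplies the three-strand relations, and the pentagon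
makes them fit together on four strands (`deformed_braid_relations`). The pentagon of `f` in the
representation deformed by `g` becomes the pentagon of the product in the original one. The
representation used is a quotient of the group algebra of the braid group, on which pure braids act
unipotently and which sees everything modulo a given power of the augmentation ideal. -/

set_option linter.unusedSectionVars false

namespace NCSeries

/-! ### Evaluation of series by recursion on the first letter -/

section Eval

variable {K : Type*} [CommRing K] {R : Type*} [Ring R] [Algebra K R]

/-- The left derivative of a series: the words beginning with `c`, with this letter removed. -/
def tl (c : Fin 2) (f : NCSeries K) : NCSeries K := fun w => f (c :: w)

theorem tl_apply (c : Fin 2) (f : NCSeries K) (w : List (Fin 2)) : tl c f w = f (c :: w) := rfl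

theorem tl_one (c : Fin 2) : tl c (1 : NCSeries K) = 0 := by
  funext w; simp [tl_apply, one_apply, zero_apply]

theorem mul_nil (f g : NCSeries K) : (f * g) [] = f [] * g [] := by
  simp [mul_apply]

theorem tl_mul (c : Fin 2) (f g : NCSeries K) : tl c (f * g) = tl c f * g + f [] • tl c g := by
  funext w
  rw [tl_apply, mul_apply, List.length_cons, Finset.sum_range_succ']
  simp [add_apply, smul_apply, mul_apply, tl_apply]

/-- The two arguments of `evalTrunc`, indexed by the letters. -/
def letter (a b : R) (c : Fin 2) : R := if c = 0 then a else b

theorem evalTrunc_zero (f : NCSeries K) (a b : R) : evalTrunc 0 f a b = algebraMap K R (f []) := by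
  simp [evalTrunc, Algebra.algebraMap_eq_smul_one]

/-- Words are sorted by their first letter; this recursion drives nearly all inductions on the
truncation degree. -/
theorem evalTrunc_succ (n : ℕ) (f : NCSeries K) (a b : R) :
    evalTrunc (n + 1) f a b = algebraMap K R (f []) +
      (a * evalTrunc n (tl 0 f) a b + b * evalTrunc n (tl 1 f) a b) := by
  have key : ∀ k : ℕ, (∑ v : Fin (k + 1) → Fin 2,
      f (List.ofFn v) • (List.ofFn fun i => if v i = 0 then a else b).prod) =
      a * (∑ v : Fin k → Fin 2,
        tl 0 f (List.ofFn v) • (List.ofFn fun i => if v i = 0 then a else b).prod) +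
      b * (∑ v : Fin k → Fin 2,
        tl 1 f (List.ofFn v) • (List.ofFn fun i => if v i = 0 then a else b).prod) := by
    intro k
    rw [← (Fin.consEquiv (fun _ : Fin (k + 1) => Fin 2)).sum_comp, Fintype.sum_prod_type,
      Fin.sum_univ_two]
    simp [Fin.consEquiv, List.ofFn_succ, Finset.mul_sum, tl_apply]
  rw [evalTrunc, Finset.sum_range_succ']
  simp only [key, Finset.sum_add_distrib, ← Finset.mul_sum]
  rw [add_comm]
  simp [evalTrunc, Algebra.algebraMap_eq_smul_one]

theorem evalTrunc_add (n : ℕ) (f g : NCSeries K) (a b : R) :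
    evalTrunc n (f + g) a b = evalTrunc n f a b + evalTrunc n g a b := by
  simp [evalTrunc, add_apply, add_smul, Finset.sum_add_distrib]

theorem evalTrunc_smul (n : ℕ) (r : K) (f : NCSeries K) (a b : R) :
    evalTrunc n (r • f) a b = r • evalTrunc n f a b := by
  simp [evalTrunc, smul_apply, mul_smul, Finset.smul_sum]

/-- `evalTrunc` as a linear map. -/
def evalTruncₗ (n : ℕ) (a b : R) : NCSeries K →ₗ[K] R where
  toFun f := evalTrunc n f a b
  map_add' f g := evalTrunc_add n f g a b
  map_smul' r f := evalTrunc_smul n r f a b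

theorem evalTrunc_sub (n : ℕ) (f g : NCSeries K) (a b : R) :
    evalTrunc n (f - g) a b = evalTrunc n f a b - evalTrunc n g a b :=
  (evalTruncₗ n a b).map_sub f g

theorem evalTrunc_neg (n : ℕ) (f : NCSeries K) (a b : R) :
    evalTrunc n (-f) a b = -evalTrunc n f a b :=
  (evalTruncₗ n a b).map_neg f

theorem evalTrunc_zero_series (n : ℕ) (a b : R) :
    evalTrunc n (0 : NCSeries K) a b = 0 :=
  (evalTruncₗ n a b).map_zero

theorem evalTrunc_one (n : ℕ) (a b : R) : evalTrunc n (1 : NCSeries K) a b = 1 := by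
  cases n with
  | zero => simp [evalTrunc_zero, one_apply]
  | succ n => simp [evalTrunc_succ, one_apply, tl_one, evalTrunc_zero_series]

theorem evalTrunc_congr (n : ℕ) {f g : NCSeries K} (a b : R)
    (h : ∀ w : List (Fin 2), w.length ≤ n → f w = g w) : evalTrunc n f a b = evalTrunc n g a b := by
  refine Finset.sum_congr rfl fun k hk => Finset.sum_congr rfl fun v _ => ?_
  rw [h _ (by simp at hk ⊢; omega)]

theorem map_evalTrunc {S : Type*} [Ring S] [Algebra K S] (φ : R →ₐ[K] S) (n : ℕ) (f : NCSeries K)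
    (a b : R) : φ (evalTrunc n f a b) = evalTrunc n f (φ a) (φ b) := by
  induction n generalizing f with
  | zero => simp [evalTrunc_zero]
  | succ n ih => simp [evalTrunc_succ, ih]

theorem SemiconjBy.evalTrunc {u a b a' b' : R} (ha : SemiconjBy u a a') (hb : SemiconjBy u b b')
    (n : ℕ) (f : NCSeries K) : SemiconjBy u (evalTrunc n f a b) (evalTrunc n f a' b') := by
  induction n generalizing f with
  | zero => rw [evalTrunc_zero, evalTrunc_zero]; exact Algebra.commute_algebraMap_right _ u
  | succ n ih =>
    simp only [evalTrunc_succ]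
    exact SemiconjBy.add_right (Algebra.commute_algebraMap_right _ u)
      ((ha.mul_right (ih _)).add_right (hb.mul_right (ih _)))

/-- Words in the letters `a`, `b`. -/
def wordProd (a b : R) (w : List (Fin 2)) : R := (w.map (letter a b)).prod

theorem wordProd_nil (a b : R) : wordProd a b [] = 1 := rfl

theorem wordProd_cons (a b : R) (c : Fin 2) (w : List (Fin 2)) :
    wordProd a b (c :: w) = letter a b c * wordProd a b w := by simp [wordProd]

/-- The words of length at most `n`. -/
def wordsLE (n : ℕ) : Finset (List (Fin 2)) :=
  (Finset.range (n + 1)).biUnion fun k => Finset.univ.image fun v : Fin k → Fin 2 => List.ofFn v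

theorem mem_wordsLE {n : ℕ} {w : List (Fin 2)} : w ∈ wordsLE n ↔ w.length ≤ n := by
  simp only [wordsLE, Finset.mem_biUnion, Finset.mem_range, Finset.mem_image, Finset.mem_univ,
    true_and]
  constructor
  · rintro ⟨k, hk, v, rfl⟩; simp; omega
  · intro h
    exact ⟨w.length, by omega, w.get, by simp⟩

theorem evalTrunc_eq_sum (n : ℕ) (f : NCSeries K) (a b : R) :
    evalTrunc n f a b = ∑ w ∈ wordsLE n, f w • wordProd a b w := by
  rw [wordsLE, Finset.sum_biUnion]
  · refine Finset.sum_congr rfl fun k _ => ?_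
    rw [Finset.sum_image (fun v _ v' _ h => List.ofFn_injective h)]
    refine Finset.sum_congr rfl fun v _ => ?_
    congr 2
    simp [List.map_ofFn, letter, Function.comp_def]
  · intro i _ j _ hij
    rw [Function.onFun, Finset.disjoint_left]
    rintro w hw hw'
    simp only [Finset.mem_image, Finset.mem_univ, true_and] at hw hw'
    obtain ⟨v, rfl⟩ := hw
    obtain ⟨v', hv'⟩ := hw'
    exact hij (by simpa using (congrArg List.length hv').symm)

end Eval

end NCSeries

/-! ### Nilpotent subspaces, where truncated evaluation is multiplicative -/

open NCSeries

/-- A multiplicatively closed subspace of an algebra whose `(n + 1)`-st power vanishes. -/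
structure NilSub (K R : Type*) [CommRing K] [Ring R] [Algebra K R] (n : ℕ) where
  /-- The underlying subspace. -/
  J : Submodule K R
  mul_le : J * J ≤ J
  pow_eq : J ^ (n + 1) = ⊥

namespace NilSub

variable {K : Type*} [CommRing K] {R : Type*} [Ring R] [Algebra K R] {n : ℕ} (N : NilSub K R n)

theorem mul_mem {a b : R} (ha : a ∈ N.J) (hb : b ∈ N.J) : a * b ∈ N.J :=
  N.mul_le (Submodule.mul_mem_mul ha hb)

theorem pow_succ_le (k : ℕ) : N.J ^ (k + 2) ≤ N.J ^ (k + 1) := by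
  rw [show k + 2 = 2 + k by ring, pow_add, show k + 1 = 1 + k by ring, pow_add, pow_two, pow_one]
  exact mul_le_mul' N.mul_le le_rfl

theorem J_mul_pow (k : ℕ) {a b : R} (ha : a ∈ N.J) (hb : b ∈ N.J ^ k) : a * b ∈ N.J ^ (k + 1) := by
  rw [pow_succ']; exact Submodule.mul_mem_mul ha hb

theorem unital_mul_pow (k : ℕ) {r : K} {a b : R} (ha : a - algebraMap K R r ∈ N.J)
    (hb : b ∈ N.J ^ (k + 1)) : a * b ∈ N.J ^ (k + 1) := by
  have : a * b = (a - algebraMap K R r) * b + r • b := by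
    rw [sub_mul, Algebra.smul_def]; abel
  rw [this]
  exact add_mem (N.pow_succ_le k (N.J_mul_pow _ ha hb)) (Submodule.smul_mem _ _ hb)

theorem evalTrunc_sub_mem (k : ℕ) (f : NCSeries K) {a b : R} (ha : a ∈ N.J) (hb : b ∈ N.J) :
    evalTrunc k f a b - algebraMap K R (f []) ∈ N.J := by
  induction k generalizing f with
  | zero => simp [evalTrunc_zero]
  | succ k ih =>
    rw [evalTrunc_succ, add_sub_cancel_left]
    have key : ∀ c ∈ N.J, ∀ g : NCSeries K, c * evalTrunc k g a b ∈ N.J := fun c hc g => by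
      have : c * evalTrunc k g a b =
          c * (evalTrunc k g a b - algebraMap K R (g [])) + g [] • c := by
        rw [mul_sub, Algebra.smul_def, Algebra.commutes]; abel
      rw [this]
      exact add_mem (N.mul_mem hc (ih g)) (Submodule.smul_mem _ _ hc)
    exact add_mem (key a ha _) (key b hb _)

theorem evalTrunc_succ_sub_mem (k : ℕ) (f : NCSeries K) {a b : R} (ha : a ∈ N.J) (hb : b ∈ N.J) :
    evalTrunc (k + 1) f a b - evalTrunc k f a b ∈ N.J ^ (k + 1) := by
  induction k generalizing f with
  | zero =>
    rw [evalTrunc_zero f, pow_one]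
    exact N.evalTrunc_sub_mem 1 f ha hb
  | succ k ih =>
    rw [evalTrunc_succ (k + 1) f, evalTrunc_succ k f, add_sub_add_left_eq_sub, add_sub_add_comm,
      ← mul_sub, ← mul_sub]
    exact add_mem (N.J_mul_pow _ ha (ih _)) (N.J_mul_pow _ hb (ih _))

/-- Induction through the Leibniz-type rule `tl_mul`: each first letter lies in `J` and improves the
error by one power of `J`. With `k = n` the error vanishes, so evaluation is an algebra morphism. -/
theorem evalTrunc_mul_sub_mem (k : ℕ) (f g : NCSeries K) {a b : R} (ha : a ∈ N.J) (hb : b ∈ N.J) :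
    evalTrunc k (f * g) a b - evalTrunc k f a b * evalTrunc k g a b ∈ N.J ^ (k + 1) := by
  induction k generalizing f g with
  | zero => simp [evalTrunc_zero, mul_nil]
  | succ k ih =>
    -- The second factor must be truncated one degree higher than the induction hypothesis provides;
    -- the difference already lies in `J ^ (k + 1)`.
    have key : ∀ h : NCSeries K,
        evalTrunc k (h * g) a b - evalTrunc k h a b * evalTrunc (k + 1) g a b ∈ N.J ^ (k + 1) := by
      intro h
      have := sub_mem (ih h g) (N.unital_mul_pow k (N.evalTrunc_sub_mem k h ha hb)
        (N.evalTrunc_succ_sub_mem k g ha hb))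
      rw [mul_sub] at this
      convert this using 1
      abel
    have h0 := N.J_mul_pow _ ha (key (tl 0 f))
    have h1 := N.J_mul_pow _ hb (key (tl 1 f))
    convert add_mem h0 h1 using 1
    have hg := evalTrunc_succ k g a b
    rw [evalTrunc_succ k f, evalTrunc_succ k (f * g), tl_mul, tl_mul, mul_nil, evalTrunc_add,
      evalTrunc_add, evalTrunc_smul, evalTrunc_smul, mul_sub, mul_sub, add_mul, add_mul]
    nth_rewrite 1 [hg]
    simp only [map_mul, mul_add, mul_assoc, Algebra.smul_def]
    rw [Algebra.left_comm a, Algebra.left_comm b]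
    abel

theorem eq_zero_of_mem_pow {k : ℕ} (hk : n + 1 ≤ k) {a : R} (ha : a ∈ N.J ^ k) : a = 0 := by
  obtain ⟨m, rfl⟩ := Nat.exists_eq_add_of_le hk
  rw [pow_add, N.pow_eq, Submodule.bot_mul] at ha
  simpa using ha

theorem pow_eq_zero {a : R} (ha : a ∈ N.J) {k : ℕ} (hk : n + 1 ≤ k) : a ^ k = 0 :=
  N.eq_zero_of_mem_pow hk (Submodule.pow_mem_pow _ ha k)

theorem evalTrunc_eq_of_le {k : ℕ} (hk : n ≤ k) (f : NCSeries K) {a b : R} (ha : a ∈ N.J)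
    (hb : b ∈ N.J) : evalTrunc k f a b = evalTrunc n f a b := by
  induction k, hk using Nat.le_induction with
  | base => rfl
  | succ k hk ih =>
    rw [← ih, ← sub_eq_zero]
    exact N.eq_zero_of_mem_pow (by omega) (N.evalTrunc_succ_sub_mem k f ha hb)

/-- The value of a series at two elements of a nilpotent subspace, as an algebra morphism. -/
def evalHom {a b : R} (ha : a ∈ N.J) (hb : b ∈ N.J) : NCSeries K →ₐ[K] R :=
  AlgHom.ofLinearMap (evalTruncₗ n a b) (evalTrunc_one n a b) fun f g => by
    have := N.eq_zero_of_mem_pow le_rfl (N.evalTrunc_mul_sub_mem n f g ha hb)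
    exact sub_eq_zero.1 this

theorem evalHom_apply {a b : R} (ha : a ∈ N.J) (hb : b ∈ N.J) (f : NCSeries K) :
    N.evalHom ha hb f = evalTrunc n f a b := rfl

theorem evalTrunc_mul {a b : R} (ha : a ∈ N.J) (hb : b ∈ N.J) (f g : NCSeries K) :
    evalTrunc n (f * g) a b = evalTrunc n f a b * evalTrunc n g a b :=
  map_mul (N.evalHom ha hb) f g

theorem evalTrunc_X {a b : R} (ha : a ∈ N.J) : evalTrunc n (NCSeries.X : NCSeries K) a b = a := by
  have h0 : tl 0 (NCSeries.X : NCSeries K) = 1 := by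
    funext w; simp [tl_apply, NCSeries.X, one_apply]
  have h1 : tl 1 (NCSeries.X : NCSeries K) = 0 := by
    funext w; simp [tl_apply, NCSeries.X, NCSeries.zero_apply]
  have hX : (NCSeries.X : NCSeries K) [] = 0 := by simp [NCSeries.X]
  cases n with
  | zero => rw [evalTrunc_zero, hX, map_zero]
            simpa using (N.pow_eq_zero ha le_rfl).symm
  | succ n => simp [evalTrunc_succ, h0, h1, hX, evalTrunc_one, evalTrunc_zero_series]

theorem evalTrunc_Y {a b : R} (hb : b ∈ N.J) : evalTrunc n (NCSeries.Y : NCSeries K) a b = b := by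
  have h0 : tl 0 (NCSeries.Y : NCSeries K) = 0 := by
    funext w; simp [tl_apply, NCSeries.Y, NCSeries.zero_apply]
  have h1 : tl 1 (NCSeries.Y : NCSeries K) = 1 := by
    funext w; simp [tl_apply, NCSeries.Y, one_apply]
  have hX : (NCSeries.Y : NCSeries K) [] = 0 := by simp [NCSeries.Y]
  cases n with
  | zero => rw [evalTrunc_zero, hX, map_zero]
            simpa using (N.pow_eq_zero hb le_rfl).symm
  | succ n => simp [evalTrunc_succ, h0, h1, hX, evalTrunc_one, evalTrunc_zero_series]

theorem evalTrunc_mem {a b : R} (ha : a ∈ N.J) (hb : b ∈ N.J) {f : NCSeries K} (hf : f [] = 0)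
    (k : ℕ) : evalTrunc k f a b ∈ N.J := by
  simpa [hf] using N.evalTrunc_sub_mem k f ha hb

end NilSub

namespace NCSeries

/-! ### The shuffle coproduct and evaluation at sums of commuting pairs -/

section Shuffle

variable {K : Type*} [CommRing K]

theorem coproduct_nil_left (f : NCSeries K) (v : List (Fin 2)) : coproduct f [] v = f v := by
  rw [coproduct, shuffles]
  exact add_zero _

theorem coproduct_nil_right (f : NCSeries K) (u : List (Fin 2)) : coproduct f u [] = f u := by
  cases u <;> rw [coproduct, shuffles] <;> exact add_zero _

theorem coproduct_cons_cons (f : NCSeries K) (a b : Fin 2) (u v : List (Fin 2)) :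
    coproduct f (a :: u) (b :: v) =
      coproduct (tl a f) u (b :: v) + coproduct (tl b f) (a :: u) v := by
  have key : ∀ F : List (Fin 2) → K, ((shuffles (a :: u) (b :: v)).map F).sum =
      ((shuffles u (b :: v)).map fun w => F (a :: w)).sum +
        ((shuffles (a :: u) v).map fun w => F (b :: w)).sum := fun F => by
    simp [shuffles, Function.comp_def]
  exact key f

/-- The terms of a coproduct coefficient in which the first letter comes from the left word. -/
def coproductLeft (f : NCSeries K) : List (Fin 2) → List (Fin 2) → K
  | [], _ => 0
  | c :: u, v => coproduct (tl c f) u v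

/-- The terms of a coproduct coefficient in which the first letter comes from the right word. -/
def coproductRight (f : NCSeries K) : List (Fin 2) → List (Fin 2) → K
  | _, [] => 0
  | u, c :: v => coproduct (tl c f) u v

theorem coproduct_eq (f : NCSeries K) (u v : List (Fin 2)) :
    coproduct f u v = (if u = [] ∧ v = [] then f [] else 0) +
      (coproductLeft f u v + coproductRight f u v) := by
  cases u <;> cases v <;>
    simp [coproductLeft, coproductRight, coproduct_nil_left, coproduct_nil_right,
      coproduct_cons_cons, tl]

/-- The pairs of words of total length at most `n`. -/
def pairsLE (n : ℕ) : Finset (List (Fin 2) × List (Fin 2)) :=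
  (wordsLE n ×ˢ wordsLE n).filter fun q => q.1.length + q.2.length ≤ n

theorem mem_pairsLE {n : ℕ} {q : List (Fin 2) × List (Fin 2)} :
    q ∈ pairsLE n ↔ q.1.length + q.2.length ≤ n := by
  simp only [pairsLE, Finset.mem_filter, Finset.mem_product, mem_wordsLE]
  omega

theorem sum_pairsLE_left {M : Type*} [AddCommMonoid M] (n : ℕ)
    (G : List (Fin 2) → List (Fin 2) → M) (hG : ∀ v, G [] v = 0) :
    ∑ q ∈ pairsLE (n + 1), G q.1 q.2 = ∑ c, ∑ q ∈ pairsLE n, G (c :: q.1) q.2 := by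
  rw [← Finset.sum_product']
  symm
  refine Finset.sum_of_injOn (fun x => (x.1 :: x.2.1, x.2.2)) ?_ ?_ ?_ ?_
  · rintro ⟨c, u, v⟩ _ ⟨c', u', v'⟩ _ h
    simp_all
  · rintro ⟨c, u, v⟩ h
    simp [mem_pairsLE] at h ⊢
    omega
  · rintro ⟨u, v⟩ h h'
    cases u with
    | nil => exact hG v
    | cons c u =>
      exfalso
      apply h'
      refine ⟨(c, u, v), ?_, rfl⟩
      simp [mem_pairsLE] at h ⊢
      omega
  · intro _ _; rfl

theorem sum_pairsLE_right {M : Type*} [AddCommMonoid M] (n : ℕ)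
    (G : List (Fin 2) → List (Fin 2) → M) (hG : ∀ u, G u [] = 0) :
    ∑ q ∈ pairsLE (n + 1), G q.1 q.2 = ∑ c, ∑ q ∈ pairsLE n, G q.1 (c :: q.2) := by
  rw [← Finset.sum_product']
  symm
  refine Finset.sum_of_injOn (fun x => (x.2.1, x.1 :: x.2.2)) ?_ ?_ ?_ ?_
  · rintro ⟨c, u, v⟩ _ ⟨c', u', v'⟩ _ h
    simp_all
  · rintro ⟨c, u, v⟩ h
    simp [mem_pairsLE] at h ⊢
    omega
  · rintro ⟨u, v⟩ h h'
    cases v with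
    | nil => exact hG u
    | cons c v =>
      exfalso
      apply h'
      refine ⟨(c, u, v), ?_, rfl⟩
      simp [mem_pairsLE] at h ⊢
      omega
  · intro _ _; rfl

theorem sum_wordsLE_succ {M : Type*} [AddCommMonoid M] (n : ℕ) (G : List (Fin 2) → M) :
    ∑ w ∈ wordsLE (n + 1), G w = G [] + ∑ c, ∑ w ∈ wordsLE n, G (c :: w) := by
  classical
  rw [← Finset.add_sum_erase (wordsLE (n + 1)) G (mem_wordsLE.2 (Nat.zero_le _) : [] ∈ _),
    ← Finset.sum_product']
  congr 1
  symm
  refine Finset.sum_of_injOn (fun x => x.1 :: x.2) ?_ ?_ ?_ ?_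
  · rintro ⟨c, u⟩ _ ⟨c', u'⟩ _ h
    simp_all
  · rintro ⟨c, u⟩ h
    simp [mem_wordsLE] at h ⊢
    omega
  · intro u h h'
    cases u with
    | nil => simp at h
    | cons c u =>
      exfalso
      apply h'
      refine ⟨(c, u), ?_, rfl⟩
      simp [mem_wordsLE] at h ⊢
      omega
  · intro _ _; rfl

/-- The first letter of a shuffle comes either from the left word or from the right word: this is
the coproduct analogue of `evalTrunc_succ`. -/
theorem sum_coproduct_succ {M : Type*} [AddCommGroup M] [Module K M] (n : ℕ) (f : NCSeries K)
    (Φ : List (Fin 2) → List (Fin 2) → M) :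
    ∑ q ∈ pairsLE (n + 1), coproduct f q.1 q.2 • Φ q.1 q.2 = f [] • Φ [] [] +
      ∑ c, ∑ q ∈ pairsLE n,
        coproduct (tl c f) q.1 q.2 • (Φ (c :: q.1) q.2 + Φ q.1 (c :: q.2)) := by
  simp only [coproduct_eq f, add_smul, Finset.sum_add_distrib, smul_add]
  congr 1
  · rw [Finset.sum_eq_single ([], [])]
    · simp
    · rintro ⟨u, v⟩ _ h
      rw [if_neg (by simpa using h), zero_smul]
    · intro h
      exact absurd (mem_pairsLE.2 (Nat.zero_le _)) h
  · congr 1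
    · rw [sum_pairsLE_left n (fun u v => coproductLeft f u v • Φ u v)
        (fun v => by simp [coproductLeft])]
      rfl
    · rw [sum_pairsLE_right n (fun u v => coproductRight f u v • Φ u v)
        (fun u => by cases u <;> simp [coproductRight])]
      refine Finset.sum_congr rfl fun c _ => Finset.sum_congr rfl fun q _ => ?_
      cases q.1 <;> rfl

theorem pairsLE_zero : pairsLE 0 = {([], [])} := by
  ext ⟨u, v⟩
  simp [mem_pairsLE]

theorem wordsLE_zero : wordsLE 0 = {[]} := by
  ext u
  simp [mem_wordsLE]

variable {R : Type*} [Ring R] [Algebra K R]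

/-- In the expansion of a word in `a + b`, `a' + b'`, commutation moves all of `b`, `b'` to the
right; the number of ways to reach a given pair of words counts shuffles. -/
theorem evalTrunc_add_args (n : ℕ) (f : NCSeries K) {a a' b b' : R} (h₁ : Commute a b)
    (h₂ : Commute a b') (h₃ : Commute a' b) (h₄ : Commute a' b') :
    evalTrunc n f (a + b) (a' + b') =
      ∑ q ∈ pairsLE n, coproduct f q.1 q.2 • (wordProd a a' q.1 * wordProd b b' q.2) := by
  have comm : ∀ (c : Fin 2) (u : List (Fin 2)), Commute (letter b b' c) (wordProd a a' u) := by
    intro c u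
    induction u with
    | nil => simp [wordProd_nil]
    | cons d u ih =>
      rw [wordProd_cons]
      refine Commute.mul_right ?_ ih
      fin_cases c <;> fin_cases d <;> simp [letter, h₁.symm, h₂.symm, h₃.symm, h₄.symm]
  induction n generalizing f with
  | zero => simp [evalTrunc_zero, pairsLE_zero, wordProd_nil, coproduct_nil_left,
      Algebra.algebraMap_eq_smul_one]
  | succ n ih =>
    rw [evalTrunc_succ,
      sum_coproduct_succ n f (fun u v => wordProd a a' u * wordProd b b' v), ih, ih,
      Fin.sum_univ_two]
    congr 1
    · simp [wordProd_nil, Algebra.algebraMap_eq_smul_one]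
    · simp only [Finset.mul_sum]
      congr 1 <;>
      · refine Finset.sum_congr rfl fun q _ => ?_
        rw [wordProd_cons, wordProd_cons, ← mul_assoc (wordProd a a' q.1), ← (comm _ q.1).eq,
          mul_smul_comm]
        simp [letter, add_mul, mul_assoc]

end Shuffle

/-! ### Friedrichs' theorem by right-normed bracketing -/

section Words

variable {K : Type*} [CommRing K]

theorem letter_mul_nil (c : Fin 2) (g : NCSeries K) : (letter X Y c * g : NCSeries K) [] = 0 := by
  fin_cases c <;> simp [letter, mul_nil, X, Y]

theorem letter_mul_cons (c d : Fin 2) (g : NCSeries K) (w : List (Fin 2)) :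
    (letter X Y c * g : NCSeries K) (d :: w) = if c = d then g w else 0 := by
  change tl d (letter X Y c * g) w = _
  rw [tl_mul]
  have h0 : (letter X Y c : NCSeries K) [] = 0 := by fin_cases c <;> simp [letter, X, Y]
  have h1 : tl d (letter X Y c : NCSeries K) = if c = d then 1 else 0 := by
    funext w
    fin_cases c <;> fin_cases d <;>
      simp [letter, X, Y, tl_apply, one_apply, NCSeries.zero_apply]
  rw [h0, h1, zero_smul, add_zero]
  split_ifs <;> simp [NCSeries.zero_apply]

theorem wordProd_X_Y (w w' : List (Fin 2)) :
    (wordProd X Y w : NCSeries K) w' = if w = w' then 1 else 0 := by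
  induction w generalizing w' with
  | nil => simp [wordProd_nil, one_apply, eq_comm]
  | cons c w ih =>
    rw [wordProd_cons]
    cases w' with
    | nil => simp [letter_mul_nil]
    | cons d w' =>
      rw [letter_mul_cons, ih]
      simp only [List.cons.injEq]
      split_ifs <;> simp_all

theorem sum_apply {ι : Type*} (s : Finset ι) (F : ι → NCSeries K) (w : List (Fin 2)) :
    (∑ i ∈ s, F i) w = ∑ i ∈ s, F i w :=
  Finset.sum_apply w s F

theorem sum_smul_wordProd (s : Finset (List (Fin 2))) (f : NCSeries K) (w : List (Fin 2)) :
    (∑ u ∈ s, f u • wordProd X Y u : NCSeries K) w = if w ∈ s then f w else 0 := by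
  simp only [sum_apply, smul_apply, wordProd_X_Y, mul_ite, mul_one, mul_zero]
  exact Finset.sum_ite_eq' s w (fun u => f u)

/-- Right-normed brackets of letters. -/
def rightBracket : List (Fin 2) → NCSeries K
  | [] => 0
  | [c] => letter X Y c
  | c :: d :: u => ⁅(letter X Y c : NCSeries K), rightBracket (d :: u)⁆

theorem rightBracket_mem (u : List (Fin 2)) :
    (rightBracket u : NCSeries K) ∈ LieSubalgebra.lieSpan K (NCSeries K) {X, Y} := by
  have hl : ∀ c, (letter X Y c : NCSeries K) ∈ LieSubalgebra.lieSpan K (NCSeries K) {X, Y} := by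
    intro c
    apply LieSubalgebra.subset_lieSpan
    fin_cases c <;> simp [letter]
  induction u with
  | nil => exact zero_mem _
  | cons c u ih =>
    cases u with
    | nil => exact hl c
    | cons d u => exact LieSubalgebra.lie_mem _ (hl c) ih

theorem rightBracket_cons (c : Fin 2) (u : List (Fin 2)) :
    (rightBracket (c :: u) : NCSeries K) = letter X Y c * rightBracket u -
      rightBracket u * letter X Y c + if u = [] then letter X Y c else 0 := by
  cases u with
  | nil => simp [rightBracket]
  | cons d u => simp [rightBracket, LieRing.of_associative_ring_bracket]

/-- The convolution of right-normed bracketing with the identity multiplies each word by its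
length. -/
theorem sum_coproduct_rightBracket (n : ℕ) (f : NCSeries K) :
    ∑ q ∈ pairsLE n, coproduct f q.1 q.2 • (rightBracket q.1 * wordProd X Y q.2) =
      ∑ w ∈ wordsLE n, ((w.length : K) * f w) • (wordProd X Y w : NCSeries K) := by
  induction n generalizing f with
  | zero => simp [pairsLE_zero, wordsLE_zero, rightBracket]
  | succ n ih =>
    rw [sum_coproduct_succ n f (fun u v => rightBracket u * wordProd X Y v), sum_wordsLE_succ]
    simp only [rightBracket, zero_mul, smul_zero, List.length_nil, Nat.cast_zero, zero_smul,
      zero_add]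
    refine Finset.sum_congr rfl fun c _ => ?_
    -- The right half of the commutator cancels the term in which the letter goes to the right word.
    -- What remains is left multiplication by the letter, with a boundary term when the left word is
    -- empty; that term raises the factor from the length of `w` to that of `c :: w`.
    have h1 : ∀ q : List (Fin 2) × List (Fin 2),
        rightBracket (c :: q.1) * wordProd X Y q.2 + rightBracket q.1 * wordProd X Y (c :: q.2) =
        letter X Y c * (rightBracket q.1 * wordProd X Y q.2 : NCSeries K) +
          if q.1 = [] then letter X Y c * wordProd X Y q.2 else 0 := by
      intro q
      rw [rightBracket_cons, wordProd_cons]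
      split_ifs <;> simp only [add_mul, sub_mul, mul_assoc, add_zero] <;> abel
    have h2 : ∑ q ∈ pairsLE n, coproduct (tl c f) q.1 q.2 •
        (if q.1 = [] then letter X Y c * wordProd X Y q.2 else 0 : NCSeries K) =
        ∑ w ∈ wordsLE n, f (c :: w) • (letter X Y c * wordProd X Y w) := by
      symm
      refine Finset.sum_of_injOn (fun w => ([], w)) ?_ ?_ ?_ ?_
      · intro w _ w' _ h
        simpa using h
      · intro w h
        simpa [mem_pairsLE, mem_wordsLE] using h
      · rintro ⟨u, v⟩ h h'
        rw [if_neg, smul_zero]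
        rintro rfl
        exact h' ⟨v, by simpa [mem_pairsLE, mem_wordsLE] using h, rfl⟩
      · intro w _
        simp [coproduct_nil_left, tl]
    simp only [h1, smul_add, Finset.sum_add_distrib, h2]
    have h3 : ∑ q ∈ pairsLE n, coproduct (tl c f) q.1 q.2 •
        (letter X Y c * (rightBracket q.1 * wordProd X Y q.2) : NCSeries K) =
        letter X Y c * ∑ q ∈ pairsLE n, coproduct (tl c f) q.1 q.2 •
          (rightBracket q.1 * wordProd X Y q.2 : NCSeries K) := by
      simp only [← mul_smul_comm, ← Finset.mul_sum]
    rw [h3, ih, Finset.mul_sum, ← Finset.sum_add_distrib]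
    refine Finset.sum_congr rfl fun w _ => ?_
    rw [mul_smul_comm, ← add_smul, wordProd_cons, List.length_cons, Nat.cast_succ, add_mul, one_mul,
      tl_apply]

end Words

/-- Friedrichs' theorem: primitive series are Lie series. -/
theorem isLieSeries_of_primitive {K : Type*} [Field K] [CharZero K] (f : NCSeries K)
    (h0 : f [] = 0) (hf : ∀ u v, u ≠ [] → v ≠ [] → coproduct f u v = 0) : IsLieSeries f := by
  have key : ∀ n, ∑ u ∈ wordsLE n, f u • (rightBracket u : NCSeries K) =
      ∑ w ∈ wordsLE n, ((w.length : K) * f w) • (wordProd X Y w : NCSeries K) := by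
    intro n
    rw [← sum_coproduct_rightBracket]
    refine Finset.sum_of_injOn (fun w => (w, [])) ?_ ?_ ?_ ?_
    · intro w _ w' _ h
      simpa using h
    · intro w h
      simpa [mem_pairsLE, mem_wordsLE] using h
    · rintro ⟨u, v⟩ h h'
      by_cases hu : u = []
      · simp [hu, rightBracket]
      · rw [hf u v hu, zero_smul]
        rintro rfl
        exact h' ⟨u, by simpa [mem_pairsLE, mem_wordsLE] using h, rfl⟩
    · intro w _
      simp [coproduct_nil_right, wordProd_nil]
  intro n
  cases n with
  | zero =>
    suffices homog 0 f = 0 by rw [this]; exact zero_mem _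
    funext w
    simp only [homog, List.length_eq_zero_iff]
    split_ifs with h
    · rw [h, h0]; rfl
    · rfl
  | succ n =>
    have hsub : wordsLE n ⊆ wordsLE (n + 1) := fun w hw => by
      rw [mem_wordsLE] at hw ⊢; omega
    have h1 := Finset.sum_sdiff (f := fun u => f u • (rightBracket u : NCSeries K)) hsub
    have h2 := Finset.sum_sdiff
      (f := fun w => ((w.length : K) * f w) • (wordProd X Y w : NCSeries K)) hsub
    rw [key, key] at h1
    rw [← h2, add_left_inj] at h1
    -- Characteristic zero enters here: all words in this degree have the same length `n + 1`, which
    -- can be divided out.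
    have h3 : homog (n + 1) f = ((n + 1 : ℕ) : K)⁻¹ •
        ∑ u ∈ wordsLE (n + 1) \ wordsLE n, f u • (rightBracket u : NCSeries K) := by
      rw [h1, Finset.smul_sum]
      funext w
      have hm : w ∈ wordsLE (n + 1) \ wordsLE n ↔ w.length = n + 1 := by
        rw [Finset.mem_sdiff, mem_wordsLE, mem_wordsLE]; omega
      have := sum_smul_wordProd (wordsLE (n + 1) \ wordsLE n)
        (fun w => ((n + 1 : ℕ) : K)⁻¹ * ((w.length : K) * f w) : NCSeries K) w
      simp only [mul_smul] at this ⊢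
      rw [this, homog]
      simp only [hm]
      split_ifs with h
      · rw [h, ← mul_assoc, inv_mul_cancel₀ (Nat.cast_ne_zero.2 n.succ_ne_zero), one_mul]
      · rfl
    rw [h3]
    exact SMulMemClass.smul_mem _ (sum_mem fun u _ => SMulMemClass.smul_mem _ (rightBracket_mem u))

end NCSeries

open NCSeries

namespace NilSub

variable {K : Type*} [CommRing K] {R : Type*} [Ring R] [Algebra K R] {n : ℕ} (N : NilSub K R n)

theorem prod_eq_zero {l : List R} (hl : ∀ a ∈ l, a ∈ N.J) (hn : n < l.length) : l.prod = 0 := by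
  have : ∀ l : List R, (∀ a ∈ l, a ∈ N.J) → l.prod ∈ N.J ^ l.length := by
    intro l hl
    induction l with
    | nil => simpa using ⟨1, map_one _⟩
    | cons a l ih =>
      rw [List.prod_cons, List.length_cons]
      exact N.J_mul_pow _ (hl a (by simp)) (ih fun b hb => hl b (by simp [hb]))
  exact N.eq_zero_of_mem_pow hn (this l hl)

theorem wordProd_mul_wordProd_eq_zero {a b c d : R} (ha : a ∈ N.J) (hb : b ∈ N.J) (hc : c ∈ N.J)
    (hd : d ∈ N.J) {u v : List (Fin 2)} (h : n < u.length + v.length) :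
    wordProd a b u * wordProd c d v = 0 := by
  rw [wordProd, wordProd, ← List.prod_append]
  refine N.prod_eq_zero (fun x hx => ?_) (by simpa using h)
  rcases List.mem_append.1 hx with hx | hx <;> obtain ⟨i, _, rfl⟩ := List.mem_map.1 hx <;>
    fin_cases i <;> simpa [letter]

/-- For group-like `f` the shuffle coefficients factor. The product of the two truncations has extra
pairs of total length beyond `n`, but these vanish by nilpotency. -/
theorem evalTrunc_add_of_isGroupLike {f : NCSeries K} (hf : IsGroupLike f) {a a' b b' : R}
    (ha : a ∈ N.J) (ha' : a' ∈ N.J) (hb : b ∈ N.J) (hb' : b' ∈ N.J) (h₁ : Commute a b)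
    (h₂ : Commute a b') (h₃ : Commute a' b) (h₄ : Commute a' b') :
    evalTrunc n f (a + b) (a' + b') = evalTrunc n f a a' * evalTrunc n f b b' := by
  rw [evalTrunc_add_args n f h₁ h₂ h₃ h₄, evalTrunc_eq_sum, evalTrunc_eq_sum, Finset.sum_mul_sum,
    ← Finset.sum_product']
  refine (Finset.sum_subset (s₁ := pairsLE n) (s₂ := wordsLE n ×ˢ wordsLE n)
    (Finset.filter_subset _ _) ?_).trans ?_
  · rintro ⟨u, v⟩ _ h
    rw [mem_pairsLE, not_le] at h
    rw [N.wordProd_mul_wordProd_eq_zero ha ha' hb hb' h, smul_zero]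
  · refine Finset.sum_congr rfl fun q _ => ?_
    rw [hf.2, smul_mul_smul_comm]

end NilSub

/-! ### Shift operators: a faithful nilpotent model with two commuting pairs -/

section Model

variable {K : Type*} [CommRing K]

variable (K) in
/-- Removal of a last letter of the left word, cut off at total degree `n`. -/
def shiftLeft (n : ℕ) (c : Fin 2) : Module.End K (List (Fin 2) → List (Fin 2) → K) where
  toFun F u v := if u.length + v.length < n then F (u ++ [c]) v else 0
  map_add' F G := by funext u v; dsimp only [Pi.add_apply]; split_ifs <;> simp
  map_smul' r F := by
    funext u v; dsimp only [Pi.smul_apply, RingHom.id_apply]; split_ifs <;> simp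

variable (K) in
/-- Removal of a last letter of the right word, cut off at total degree `n`. -/
def shiftRight (n : ℕ) (c : Fin 2) : Module.End K (List (Fin 2) → List (Fin 2) → K) where
  toFun F u v := if u.length + v.length < n then F u (v ++ [c]) else 0
  map_add' F G := by funext u v; dsimp only [Pi.add_apply]; split_ifs <;> simp
  map_smul' r F := by
    funext u v; dsimp only [Pi.smul_apply, RingHom.id_apply]; split_ifs <;> simp

theorem shiftLeft_apply (n : ℕ) (c : Fin 2) (F : List (Fin 2) → List (Fin 2) → K)
    (u v : List (Fin 2)) :
    shiftLeft K n c F u v = if u.length + v.length < n then F (u ++ [c]) v else 0 := rfl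

theorem shiftRight_apply (n : ℕ) (c : Fin 2) (F : List (Fin 2) → List (Fin 2) → K)
    (u v : List (Fin 2)) :
    shiftRight K n c F u v = if u.length + v.length < n then F u (v ++ [c]) else 0 := rfl

theorem shiftLeft_commute_shiftRight (n : ℕ) (c d : Fin 2) :
    Commute (shiftLeft K n c) (shiftRight K n d) := by
  refine LinearMap.ext fun F => ?_
  funext u v
  simp only [Module.End.mul_apply, shiftLeft_apply, shiftRight_apply, List.length_append,
    List.length_singleton]
  have : u.length + 1 + v.length = u.length + (v.length + 1) := by omega
  rw [this]

/-- The functions vanishing at the pairs of words of total length greater than `n - k`; all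
functions for `k = 0`. -/
def lowDegree (n k : ℕ) (F : List (Fin 2) → List (Fin 2) → K) : Prop :=
  1 ≤ k → ∀ u v, n < u.length + v.length + k → F u v = 0

variable (K) in
/-- The operators that lower the degree by `k`. -/
def lowering (n k : ℕ) : Submodule K (Module.End K (List (Fin 2) → List (Fin 2) → K)) where
  carrier := {φ | ∀ j F, lowDegree n j F → lowDegree n (j + k) (φ F)}
  add_mem' hφ hψ j F hF h u v huv := by
    simp [hφ j F hF h u v huv, hψ j F hF h u v huv]
  zero_mem' j F hF h u v huv := rfl
  smul_mem' r φ hφ j F hF h u v huv := by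
    simp [hφ j F hF h u v huv]

theorem lowering_mul_le (n k l : ℕ) : lowering K n k * lowering K n l ≤ lowering K n (k + l) := by
  refine Submodule.mul_le.2 fun φ hφ ψ hψ j F hF => ?_
  have := hφ _ _ (hψ j F hF)
  rwa [add_assoc, add_comm l k] at this

theorem lowering_pow_le (n k : ℕ) : lowering K n 1 ^ (k + 1) ≤ lowering K n (k + 1) := by
  induction k with
  | zero => simp
  | succ k ih =>
    rw [pow_succ]
    exact (mul_le_mul' ih le_rfl).trans (lowering_mul_le n (k + 1) 1)

variable (K) in
/-- The algebra of operators generated by the shifts, a universal nilpotent algebra with two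
commuting pairs of elements. -/
def shiftNil (n : ℕ) : NilSub K (Module.End K (List (Fin 2) → List (Fin 2) → K)) n where
  J := lowering K n 1
  mul_le := (lowering_mul_le n 1 1).trans fun φ hφ j F hF h u v huv =>
    hφ j F hF (by omega) u v (by omega)
  pow_eq := by
    rw [eq_bot_iff]
    refine (lowering_pow_le n n).trans fun φ hφ => ?_
    rw [Submodule.mem_bot]
    refine LinearMap.ext fun F => ?_
    funext u v
    exact hφ 0 F (fun h => absurd h (by norm_num)) (by omega) u v (by omega)

theorem shiftLeft_mem (n : ℕ) (c : Fin 2) : shiftLeft K n c ∈ (shiftNil K n).J := by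
  intro j F hF h u v huv
  rw [shiftLeft_apply]
  split_ifs with h'
  · exact hF (by omega) _ _ (by simp; omega)
  · rfl

theorem shiftRight_mem (n : ℕ) (c : Fin 2) : shiftRight K n c ∈ (shiftNil K n).J := by
  intro j F hF h u v huv
  rw [shiftRight_apply]
  split_ifs with h'
  · exact hF (by omega) _ _ (by simp; omega)
  · rfl

theorem wordProd_shiftLeft (n : ℕ) (w u v : List (Fin 2))
    (F : List (Fin 2) → List (Fin 2) → K) (h : u.length + w.length + v.length ≤ n) :
    wordProd (shiftLeft K n 0) (shiftLeft K n 1) w F u v = F (u ++ w) v := by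
  induction w generalizing u with
  | nil => simp [wordProd_nil]
  | cons c w ih =>
    have hc : letter (shiftLeft K n 0) (shiftLeft K n 1) c = shiftLeft K n c := by
      fin_cases c <;> rfl
    rw [List.length_cons] at h
    rw [wordProd_cons, hc, Module.End.mul_apply, shiftLeft_apply, if_pos (by omega),
      ih _ (by simp; omega), List.append_assoc, List.singleton_append]

theorem wordProd_shiftRight (n : ℕ) (w u v : List (Fin 2))
    (F : List (Fin 2) → List (Fin 2) → K) (h : u.length + w.length + v.length ≤ n) :
    wordProd (shiftRight K n 0) (shiftRight K n 1) w F u v = F u (v ++ w) := by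
  induction w generalizing v with
  | nil => simp [wordProd_nil]
  | cons c w ih =>
    have hc : letter (shiftRight K n 0) (shiftRight K n 1) c = shiftRight K n c := by
      fin_cases c <;> rfl
    rw [List.length_cons] at h
    rw [wordProd_cons, hc, Module.End.mul_apply, shiftRight_apply, if_pos (by omega),
      ih _ (by simp; omega), List.append_assoc, List.singleton_append]

variable (K) in
/-- The morphism from series to the model algebra. -/
def toShift (n : ℕ) : NCSeries K →ₐ[K] Module.End K (List (Fin 2) → List (Fin 2) → K) :=
  (shiftNil K n).evalHom (shiftLeft_mem n 0) (shiftLeft_mem n 1)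

theorem toShift_apply (n : ℕ) (f : NCSeries K) :
    toShift K n f = evalTrunc n f (shiftLeft K n 0) (shiftLeft K n 1) := rfl

theorem toShift_apply_single (n : ℕ) (f : NCSeries K) {w : List (Fin 2)} (hw : w.length ≤ n) :
    toShift K n f (fun u _ => if u = w then 1 else 0) [] [] = f w := by
  rw [toShift, NilSub.evalHom_apply, evalTrunc_eq_sum, LinearMap.sum_apply, Finset.sum_apply,
    Finset.sum_apply, Finset.sum_eq_single w]
  · simp [wordProd_shiftLeft n w [] [] _ (by simpa using hw)]
  · intro u hu huw
    rw [mem_wordsLE] at hu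
    simp [wordProd_shiftLeft n u [] [] _ (by simpa using hu), huw]
  · intro h
    exact absurd (mem_wordsLE.2 hw) h

/-- The model loses nothing up to degree `n`: the operator applied to the indicator function of a
word returns the coefficient of that word. Identities of series can thus be checked in nilpotent
algebras. -/
theorem toShift_eq_iff (n : ℕ) (f g : NCSeries K) :
    toShift K n f = toShift K n g ↔ ∀ w : List (Fin 2), w.length ≤ n → f w = g w := by
  constructor
  · intro h w hw
    rw [← toShift_apply_single n f hw, h, toShift_apply_single n g hw]
  · intro h
    exact evalTrunc_congr n _ _ h

theorem NCSeries.ext_toShift {f g : NCSeries K} (h : ∀ n, toShift K n f = toShift K n g) :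
    f = g := by
  funext w
  exact (toShift_eq_iff w.length f g).1 (h _) w le_rfl

/-- A converse of `evalTrunc_add_of_isGroupLike`: left and right shifts are independent enough to
separate pairs of words, as testing on the indicator function of one pair shows. -/
theorem isGroupLike_of_shift (f : NCSeries K) (h0 : f [] = 1)
    (h : ∀ n, evalTrunc n f (shiftLeft K n 0 + shiftRight K n 0)
      (shiftLeft K n 1 + shiftRight K n 1) =
      evalTrunc n f (shiftLeft K n 0) (shiftLeft K n 1) *
        evalTrunc n f (shiftRight K n 0) (shiftRight K n 1)) : IsGroupLike f := by
  refine ⟨h0, fun u v => ?_⟩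
  set n := u.length + v.length with hn
  have e := h n
  rw [evalTrunc_add_args n f (shiftLeft_commute_shiftRight n 0 0)
    (shiftLeft_commute_shiftRight n 0 1) (shiftLeft_commute_shiftRight n 1 0)
    (shiftLeft_commute_shiftRight n 1 1), evalTrunc_eq_sum, evalTrunc_eq_sum,
    Finset.sum_mul_sum, ← Finset.sum_product'] at e
  let F : List (Fin 2) → List (Fin 2) → K := fun u' v' => if u' = u ∧ v' = v then 1 else 0
  have hval : ∀ u' v' : List (Fin 2), u'.length + v'.length ≤ n →
      (wordProd (shiftLeft K n 0) (shiftLeft K n 1) u' *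
        wordProd (shiftRight K n 0) (shiftRight K n 1) v') F [] [] =
        if u' = u ∧ v' = v then 1 else 0 := by
    intro u' v' h'
    rw [Module.End.mul_apply, wordProd_shiftLeft n u' [] [] _ (by simp; omega),
      wordProd_shiftRight n v' _ [] _ (by simp; omega)]
    rfl
  have e' := congrFun (congrFun (LinearMap.congr_fun e F) []) []
  simp only [LinearMap.sum_apply, Finset.sum_apply] at e'
  rw [Finset.sum_eq_single (u, v), Finset.sum_eq_single (u, v)] at e'
  · rw [smul_mul_smul_comm, LinearMap.smul_apply, LinearMap.smul_apply, Pi.smul_apply,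
      Pi.smul_apply, Pi.smul_apply, Pi.smul_apply, hval u v le_rfl] at e'
    simpa using e'
  · rintro ⟨u', v'⟩ _ hne
    by_cases h' : u'.length + v'.length ≤ n
    · rw [smul_mul_smul_comm, LinearMap.smul_apply, Pi.smul_apply, Pi.smul_apply, hval u' v' h',
        if_neg (by simpa using hne), smul_zero]
    · rw [smul_mul_smul_comm]
      have : wordProd (shiftLeft K n 0) (shiftLeft K n 1) u' *
        wordProd (shiftRight K n 0) (shiftRight K n 1) v' = 0 :=
        (shiftNil K n).wordProd_mul_wordProd_eq_zero (shiftLeft_mem n 0) (shiftLeft_mem n 1)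
          (shiftRight_mem n 0) (shiftRight_mem n 1) (by omega)
      rw [this]
      simp
  · intro h'
    simp [mem_wordsLE] at h'
    omega
  · rintro ⟨u', v'⟩ h' hne
    rw [mem_pairsLE] at h'
    rw [LinearMap.smul_apply, Pi.smul_apply, Pi.smul_apply, hval u' v' h',
        if_neg (by simpa using hne), smul_zero]
  · intro h'
    exact absurd (mem_pairsLE.2 hn.ge) h'

end Model

/-! ### Substitution as an algebra morphism -/

section Subst

variable {K : Type*} [CommRing K]

theorem toShift_mem {f : NCSeries K} (hf : f [] = 0) (n : ℕ) :
    toShift K n f ∈ (shiftNil K n).J := by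
  rw [toShift_apply]
  exact (shiftNil K n).evalTrunc_mem (shiftLeft_mem n 0) (shiftLeft_mem n 1) hf n

theorem subst_apply_eq {f p q : NCSeries K} (hp : p [] = 0) (hq : q [] = 0) {n : ℕ}
    {w : List (Fin 2)} (hw : w.length ≤ n) : subst f p q w = evalTrunc n f p q w := by
  change evalTrunc w.length f p q w = _
  refine (toShift_eq_iff w.length _ _).1 ?_ w le_rfl
  rw [map_evalTrunc, map_evalTrunc]
  exact ((shiftNil K w.length).evalTrunc_eq_of_le hw f (toShift_mem hp _) (toShift_mem hq _)).symm

theorem NilSub.evalTrunc_subst {R : Type*} [Ring R] [Algebra K R] {n : ℕ} (N : NilSub K R n)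
    {a b : R} (ha : a ∈ N.J) (hb : b ∈ N.J) (f : NCSeries K) {p q : NCSeries K} (hp : p [] = 0)
    (hq : q [] = 0) :
    evalTrunc n (subst f p q) a b = evalTrunc n f (evalTrunc n p a b) (evalTrunc n q a b) := by
  rw [evalTrunc_congr n a b fun w hw => subst_apply_eq (f := f) hp hq hw]
  exact map_evalTrunc (N.evalHom ha hb) n f p q

theorem toShift_subst (n : ℕ) (f : NCSeries K) {p q : NCSeries K} (hp : p [] = 0)
    (hq : q [] = 0) :
    toShift K n (subst f p q) = evalTrunc n f (toShift K n p) (toShift K n q) :=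
  (shiftNil K n).evalTrunc_subst (shiftLeft_mem n 0) (shiftLeft_mem n 1) f hp hq

theorem subst_nil (f p q : NCSeries K) : subst f p q [] = f [] := by
  change evalTrunc 0 f p q [] = _
  rw [evalTrunc_zero, Algebra.algebraMap_eq_smul_one, NCSeries.smul_apply, one_apply, if_pos rfl,
    mul_one]

theorem subst_add (f g p q : NCSeries K) : subst (f + g) p q = subst f p q + subst g p q := by
  funext w
  simp [subst, evalTrunc_add, NCSeries.add_apply]

theorem subst_smul (r : K) (f p q : NCSeries K) : subst (r • f) p q = r • subst f p q := by
  funext w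
  simp [subst, evalTrunc_smul, NCSeries.smul_apply]

/-- Substitution as an algebra morphism. -/
def substHom {p q : NCSeries K} (hp : p [] = 0) (hq : q [] = 0) : NCSeries K →ₐ[K] NCSeries K :=
  AlgHom.ofLinearMap ⟨⟨fun f => subst f p q, fun f g => subst_add f g p q⟩,
      fun r f => subst_smul r f p q⟩
    (by funext w; simp [subst, evalTrunc_one]) fun f g => by
      refine NCSeries.ext_toShift fun n => ?_
      change toShift K n (subst (f * g) p q) = toShift K n (subst f p q * subst g p q)
      rw [map_mul, toShift_subst _ _ hp hq, toShift_subst _ _ hp hq, toShift_subst _ _ hp hq,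
        (shiftNil K n).evalTrunc_mul (toShift_mem hp n) (toShift_mem hq n)]

theorem subst_mul {p q : NCSeries K} (hp : p [] = 0) (hq : q [] = 0) (f g : NCSeries K) :
    subst (f * g) p q = subst f p q * subst g p q :=
  map_mul (substHom hp hq) f g

theorem subst_one (p q : NCSeries K) : subst 1 p q = 1 := by
  funext w; simp [subst, evalTrunc_one]

theorem subst_sub (f g p q : NCSeries K) : subst (f - g) p q = subst f p q - subst g p q := by
  rw [sub_eq_add_neg, ← neg_one_smul K g, subst_add, subst_smul, neg_one_smul, ← sub_eq_add_neg]

theorem subst_X {p q : NCSeries K} (hp : p [] = 0) (hq : q [] = 0) : subst X p q = p :=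
  NCSeries.ext_toShift fun n => by
    rw [toShift_subst _ _ hp hq, (shiftNil K n).evalTrunc_X (toShift_mem hp n)]

theorem subst_Y {p q : NCSeries K} (hp : p [] = 0) (hq : q [] = 0) : subst Y p q = q :=
  NCSeries.ext_toShift fun n => by
    rw [toShift_subst _ _ hp hq, (shiftNil K n).evalTrunc_Y (toShift_mem hq n)]

theorem subst_subst {p q p' q' : NCSeries K} (hp : p [] = 0) (hq : q [] = 0) (hp' : p' [] = 0)
    (hq' : q' [] = 0) (f : NCSeries K) :
    subst (subst f p q) p' q' = subst f (subst p p' q') (subst q p' q') :=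
  NCSeries.ext_toShift fun n => by
    rw [toShift_subst _ _ hp' hq', toShift_subst _ _ (by rw [subst_nil, hp])
      (by rw [subst_nil, hq]), (shiftNil K n).evalTrunc_subst (toShift_mem hp' n)
      (toShift_mem hq' n) f hp hq, toShift_subst _ _ hp' hq', toShift_subst _ _ hp' hq']

theorem subst_X_Y (f : NCSeries K) : subst f X Y = f :=
  NCSeries.ext_toShift fun n => by
    have hX : toShift K n X = shiftLeft K n 0 := (shiftNil K n).evalTrunc_X (shiftLeft_mem n 0)
    have hY : toShift K n Y = shiftLeft K n 1 := (shiftNil K n).evalTrunc_Y (shiftLeft_mem n 1)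
    rw [toShift_subst _ _ (by simp [X]) (by simp [Y]), hX, hY]
    rfl

theorem subst_congr {p q : NCSeries K} (hp : p [] = 0) (hq : q [] = 0) {f g : NCSeries K} {n : ℕ}
    (h : ∀ w : List (Fin 2), w.length ≤ n → f w = g w) {w : List (Fin 2)} (hw : w.length ≤ n) :
    subst f p q w = subst g p q w := by
  rw [subst_apply_eq hp hq hw, subst_apply_eq hp hq hw, evalTrunc_congr n p q h]

end Subst

/-! ### One-variable power series at nilpotent elements; exponential and logarithm -/

section PowerSeriesEval

variable {K : Type*} [CommRing K] {R : Type*} [Ring R] [Algebra K R]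

/-- The value of a power series at `a`, computed up to degree `n`. -/
noncomputable def powTrunc (n : ℕ) (c : PowerSeries K) (a : R) : R :=
  Polynomial.aeval a (PowerSeries.trunc (n + 1) c)

theorem powTrunc_eq_sum (n : ℕ) (c : PowerSeries K) (a : R) :
    powTrunc n c a = ∑ k ∈ Finset.range (n + 1), PowerSeries.coeff k c • a ^ k := by
  rw [powTrunc, PowerSeries.trunc_apply, map_sum, ← Nat.Ico_zero_eq_range]
  refine Finset.sum_congr rfl fun k _ => ?_
  rw [Polynomial.aeval_monomial, Algebra.smul_def]

theorem map_powTrunc {S : Type*} [Ring S] [Algebra K S] (φ : R →ₐ[K] S) (n : ℕ)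
    (c : PowerSeries K) (a : R) : φ (powTrunc n c a) = powTrunc n c (φ a) := by
  simp [powTrunc_eq_sum]

/-- Evaluation of power series at a nilpotent element. -/
noncomputable def powHom (n : ℕ) (a : R) (ha : a ^ (n + 1) = 0) : PowerSeries K →ₐ[K] R :=
  AlgHom.ofLinearMap ⟨⟨fun c => powTrunc n c a, fun c d => by
      simp [powTrunc_eq_sum, add_smul, Finset.sum_add_distrib]⟩, fun r c => by
      simp [powTrunc_eq_sum, mul_smul, Finset.smul_sum]⟩
    (by
      change powTrunc n 1 a = 1
      rw [powTrunc, PowerSeries.trunc_one, map_one])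
    fun c d => by
      change powTrunc n (c * d) a = powTrunc n c a * powTrunc n d a
      have : (Polynomial.X : Polynomial K) ^ (n + 1) ∣ PowerSeries.trunc (n + 1) (c * d) -
          PowerSeries.trunc (n + 1) c * PowerSeries.trunc (n + 1) d := by
        rw [Polynomial.X_pow_dvd_iff]
        intro k hk
        rw [Polynomial.coeff_sub, PowerSeries.coeff_trunc, if_pos hk, sub_eq_zero,
          Polynomial.coeff_mul, PowerSeries.coeff_mul]
        refine Finset.sum_congr rfl fun q hq => ?_
        have := Finset.HasAntidiagonal.mem_antidiagonal.1 hq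
        rw [PowerSeries.coeff_trunc, PowerSeries.coeff_trunc, if_pos (by omega), if_pos (by omega)]
      obtain ⟨r, hr⟩ := this
      rw [powTrunc, powTrunc, powTrunc, ← map_mul, ← sub_eq_zero, ← map_sub, hr, map_mul, map_pow,
        Polynomial.aeval_X, ha, zero_mul]

theorem powHom_apply (n : ℕ) (a : R) (ha : a ^ (n + 1) = 0) (c : PowerSeries K) :
    powHom n a ha c = powTrunc n c a := rfl

theorem powHom_X (n : ℕ) (a : R) (ha : a ^ (n + 1) = 0) :
    powHom n a ha (PowerSeries.X : PowerSeries K) = a := by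
  rw [powHom_apply, powTrunc_eq_sum]
  cases n with
  | zero => simpa using ha.symm
  | succ n =>
    rw [Finset.sum_eq_single 1]
    · simp
    · intro k _ hk; simp [PowerSeries.coeff_X, hk]
    · simp

/-- Truncating `c` leaves a multiple of `X ^ (n + 1)`, which substitution turns into a multiple of
`d ^ (n + 1)`. Since `X` divides `d`, this is killed at `a`. -/
theorem powTrunc_subst (n : ℕ) (c d : PowerSeries K) (hd : PowerSeries.constantCoeff d = 0)
    (a : R) (ha : a ^ (n + 1) = 0) :
    powTrunc n (PowerSeries.subst d c) a = powTrunc n c (powTrunc n d a) := by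
  have hs : PowerSeries.HasSubst d := PowerSeries.HasSubst.of_constantCoeff_zero' hd
  obtain ⟨r, hr⟩ : (PowerSeries.X : PowerSeries K) ^ (n + 1) ∣
      c - (PowerSeries.trunc (n + 1) c : Polynomial K) := by
    rw [PowerSeries.X_pow_dvd_iff]
    intro k hk
    rw [map_sub, Polynomial.coeff_coe, PowerSeries.coeff_trunc, if_pos hk, sub_self]
  obtain ⟨e, he⟩ := PowerSeries.X_dvd_iff.2 hd
  have h1 : powHom n a ha (d ^ (n + 1)) = 0 := by
    rw [he, mul_pow, map_mul, map_pow, powHom_X, ha, zero_mul]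
  have h2 : c = ((PowerSeries.trunc (n + 1) c : Polynomial K) : PowerSeries K) +
      PowerSeries.X ^ (n + 1) * r := by
    rw [← hr]; abel
  have h3 : PowerSeries.subst d c = Polynomial.aeval d (PowerSeries.trunc (n + 1) c) +
      d ^ (n + 1) * PowerSeries.subst d r := by
    refine (congrArg (PowerSeries.subst d) h2).trans ?_
    rw [PowerSeries.subst_add hs, PowerSeries.subst_mul hs, PowerSeries.subst_pow hs,
      PowerSeries.subst_X hs, PowerSeries.subst_coe hs]
  rw [← powHom_apply n a ha, h3, map_add, map_mul, h1, zero_mul, add_zero,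
    ← Polynomial.aeval_algHom_apply]
  rfl

end PowerSeriesEval

section ExpLog

variable {K : Type*} [Field K] [CharZero K]

/-- With `g = 1 / (1 + X)` the derivative of `log`, the composite `y` satisfies `y' = y g`, while
`g' = -g ^ 2`. Hence `y g` has derivative zero, and its constant term is `1`. -/
theorem PowerSeries.exp_subst_log :
    PowerSeries.subst (PowerSeries.log K) (PowerSeries.exp K) = 1 + PowerSeries.X := by
  have hs : PowerSeries.HasSubst (PowerSeries.log K) := PowerSeries.HasSubst.log
  set y := PowerSeries.subst (PowerSeries.log K) (PowerSeries.exp K) with hy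
  set g := PowerSeries.derivative K (PowerSeries.log K) with hg
  have hgX : (1 + PowerSeries.X) * g = 1 := by
    rw [hg, PowerSeries.deriv_log]
    ext k
    cases k with
    | zero => simp
    | succ k => simp [add_mul, PowerSeries.coeff_succ_X_mul, pow_succ, PowerSeries.coeff_one]
  have hy' : PowerSeries.derivative K y = y * g := by
    rw [hy, PowerSeries.derivative_subst hs, PowerSeries.derivative_exp]
  have hg' : PowerSeries.derivative K g = -(g * g) := by
    have := congrArg (PowerSeries.derivative K) hgX
    rw [Derivation.leibniz, map_add, Derivation.map_one_eq_zero, PowerSeries.derivative_X,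
      smul_eq_mul, smul_eq_mul, zero_add, mul_one] at this
    linear_combination g * this - PowerSeries.derivative K g * hgX
  have hz : y * g = 1 := by
    apply PowerSeries.derivative.ext
    · rw [Derivation.leibniz, hy', hg', Derivation.map_one_eq_zero, smul_eq_mul, smul_eq_mul]
      ring
    · rw [map_mul, map_one]
      have h1 := congrArg PowerSeries.constantCoeff hgX
      simp only [map_mul, map_add, map_one, PowerSeries.constantCoeff_X, add_zero, one_mul] at h1
      have h2 := PowerSeries.constantCoeff_subst_eq_zero (PowerSeries.constantCoeff_log (A := K))
        (PowerSeries.exp K - 1) (by simp)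
      rw [PowerSeries.subst_sub hs, ← PowerSeries.coe_substAlgHom hs, map_one, map_sub, map_one,
        sub_eq_zero, PowerSeries.coe_substAlgHom hs] at h2
      rw [h1, mul_one]
      exact h2
  linear_combination (1 + PowerSeries.X) * hz - y * hgX

/-- The exponential, computed up to degree `n`. -/
noncomputable def expTrunc {R : Type*} [Ring R] [Algebra K R] (n : ℕ) (a : R) : R :=
  powTrunc n (PowerSeries.exp K) a

variable {R : Type*} [Ring R] [Algebra K R]

theorem logTrunc_eq_powTrunc (n : ℕ) (g : R) :
    logTrunc K n g = powTrunc n (PowerSeries.log K) (g - 1) := by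
  rw [powTrunc_eq_sum, Finset.sum_range_succ', logTrunc]
  simp [pow_succ]

theorem map_logTrunc {S : Type*} [Ring S] [Algebra K S] (φ : R →ₐ[K] S) (n : ℕ)
    (g : R) : φ (logTrunc K n g) = logTrunc K n (φ g) := by
  simp [logTrunc]

theorem map_expTrunc {S : Type*} [Ring S] [Algebra K S] (φ : R →ₐ[K] S) (n : ℕ)
    (a : R) : φ (expTrunc (K := K) n a) = expTrunc (K := K) n (φ a) :=
  map_powTrunc φ n _ a

theorem expTrunc_logTrunc (n : ℕ) {g : R} (hg : (g - 1) ^ (n + 1) = 0) :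
    expTrunc (K := K) n (logTrunc K n g) = g := by
  rw [expTrunc, logTrunc_eq_powTrunc, ← powTrunc_subst n _ _ (by simp) _ hg,
    PowerSeries.exp_subst_log, ← powHom_apply n _ hg, map_add, map_one, powHom_X]
  abel

end ExpLog

section ExpLog

variable {K : Type*} [Field K] [CharZero K]

theorem PowerSeries.log_subst_exp_sub_one :
    PowerSeries.subst (PowerSeries.exp K - 1) (PowerSeries.log K) = PowerSeries.X := by
  have hs : PowerSeries.HasSubst (PowerSeries.exp K - 1) := PowerSeries.HasSubst.exp_sub_one
  set g := PowerSeries.derivative K (PowerSeries.log K) with hg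
  have hgX : (1 + PowerSeries.X) * g = 1 := by
    rw [hg, PowerSeries.deriv_log]
    ext k
    cases k with
    | zero => simp
    | succ k => simp [add_mul, PowerSeries.coeff_succ_X_mul, pow_succ, PowerSeries.coeff_one]
  have h1 := congrArg (PowerSeries.subst (PowerSeries.exp K - 1)) hgX
  rw [PowerSeries.subst_mul hs, PowerSeries.subst_add hs, PowerSeries.subst_X hs,
    ← PowerSeries.coe_substAlgHom hs, map_one, PowerSeries.coe_substAlgHom hs] at h1
  apply PowerSeries.derivative.ext
  · rw [PowerSeries.derivative_subst hs, map_sub, PowerSeries.derivative_exp,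
      Derivation.map_one_eq_zero, PowerSeries.derivative_X]
    linear_combination h1
  · rw [PowerSeries.constantCoeff_X]
    refine PowerSeries.constantCoeff_subst_eq_zero ?_ _ (by simp)
    change PowerSeries.constantCoeff (PowerSeries.exp K - 1) = 0
    simp

variable {R : Type*} [Ring R] [Algebra K R]

theorem logTrunc_expTrunc (n : ℕ) {a : R} (ha : a ^ (n + 1) = 0) :
    logTrunc K n (expTrunc (K := K) n a) = a := by
  have h : expTrunc (K := K) n a - 1 = powTrunc n (PowerSeries.exp K - 1) a := by
    rw [← powHom_apply n a ha, map_sub, map_one]; rfl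
  rw [logTrunc_eq_powTrunc, h, ← powTrunc_subst n _ _ (by simp) _ ha,
    PowerSeries.log_subst_exp_sub_one, ← powHom_apply n a ha, powHom_X]

theorem logTrunc_one (n : ℕ) : logTrunc K n (1 : R) = 0 := by simp [logTrunc]

theorem expTrunc_zero (n : ℕ) : expTrunc (K := K) n (0 : R) = 1 := by
  have := expTrunc_logTrunc (K := K) n (g := (1 : R)) (by simp)
  rwa [logTrunc_one] at this

theorem expTrunc_eq_sum (n : ℕ) (a : R) :
    expTrunc (K := K) n a = ∑ k ∈ Finset.range (n + 1), (k.factorial : K)⁻¹ • a ^ k := by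
  rw [expTrunc, powTrunc_eq_sum]
  simp [PowerSeries.coeff_exp]

theorem SemiconjBy.powTrunc {u a b : R} (h : SemiconjBy u a b) (n : ℕ) (c : PowerSeries K) :
    SemiconjBy u (powTrunc n c a) (powTrunc n c b) := by
  rw [SemiconjBy, powTrunc_eq_sum, powTrunc_eq_sum, Finset.mul_sum, Finset.sum_mul]
  refine Finset.sum_congr rfl fun k _ => ?_
  rw [mul_smul_comm, smul_mul_assoc, (h.pow_right k).eq]

theorem SemiconjBy.expTrunc {u a b : R} (h : SemiconjBy u a b) (n : ℕ) :
    SemiconjBy u (expTrunc (K := K) n a) (expTrunc (K := K) n b) :=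
  SemiconjBy.powTrunc h n _

theorem SemiconjBy.logTrunc {u a b : R} (h : SemiconjBy u a b) (n : ℕ) :
    SemiconjBy u (logTrunc K n a) (logTrunc K n b) := by
  rw [logTrunc_eq_powTrunc, logTrunc_eq_powTrunc]
  exact SemiconjBy.powTrunc (h.sub_right (SemiconjBy.one_right u)) n _

namespace NilSub

variable {n : ℕ} (N : NilSub K R n)

theorem pow_succ_mem {a : R} (ha : a ∈ N.J) (k : ℕ) : a ^ (k + 1) ∈ N.J := by
  induction k with
  | zero => simpa using ha
  | succ k ih => rw [pow_succ]; exact N.mul_mem ih ha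

theorem powTrunc_mem {a : R} (ha : a ∈ N.J) {c : PowerSeries K}
    (hc : PowerSeries.constantCoeff c = 0) (k : ℕ) : powTrunc k c a ∈ N.J := by
  rw [powTrunc_eq_sum, Finset.sum_range_succ']
  refine add_mem (sum_mem fun i _ => Submodule.smul_mem _ _ (N.pow_succ_mem ha i)) ?_
  simp [hc]

theorem logTrunc_mem {g : R} (hg : g - 1 ∈ N.J) : logTrunc K n g ∈ N.J := by
  rw [logTrunc_eq_powTrunc]
  exact N.powTrunc_mem hg (by simp) n

theorem expTrunc_sub_one_mem {a : R} (ha : a ∈ N.J) : expTrunc (K := K) n a - 1 ∈ N.J := by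
  have h : expTrunc (K := K) n a - 1 = powTrunc n (PowerSeries.exp K - 1) a := by
    rw [← powHom_apply n a (N.pow_eq_zero ha le_rfl), map_sub, map_one]; rfl
  rw [h]
  exact N.powTrunc_mem ha (by simp) n

theorem expTrunc_logTrunc {g : R} (hg : g - 1 ∈ N.J) :
    expTrunc (K := K) n (logTrunc K n g) = g :=
  _root_.expTrunc_logTrunc n (N.pow_eq_zero hg le_rfl)

theorem logTrunc_expTrunc {a : R} (ha : a ∈ N.J) :
    logTrunc K n (expTrunc (K := K) n a) = a :=
  _root_.logTrunc_expTrunc n (N.pow_eq_zero ha le_rfl)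

theorem expTrunc_add {a b : R} (ha : a ∈ N.J) (hb : b ∈ N.J) (hab : Commute a b) :
    expTrunc (K := K) n (a + b) = expTrunc (K := K) n a * expTrunc (K := K) n b := by
  -- `IsNilpotent.exp` is defined over `ℚ`; the scalar action is pulled back from `K` so that its
  -- addition formula applies.
  let _ : Module ℚ R := Module.compHom R (algebraMap ℚ K)
  have key : ∀ c ∈ N.J, expTrunc (K := K) n c = IsNilpotent.exp c := by
    intro c hc
    rw [IsNilpotent.exp_eq_sum (N.pow_eq_zero hc le_rfl), expTrunc_eq_sum]
    refine Finset.sum_congr rfl fun k _ => ?_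
    change _ = (algebraMap ℚ K _) • c ^ k
    simp
  rw [key _ ha, key _ hb, key _ (add_mem ha hb)]
  exact IsNilpotent.exp_add_of_commute hab ⟨_, N.pow_eq_zero ha le_rfl⟩
    ⟨_, N.pow_eq_zero hb le_rfl⟩

theorem expTrunc_mul_neg {a : R} (ha : a ∈ N.J) :
    expTrunc (K := K) n a * expTrunc (K := K) n (-a) = 1 := by
  rw [← N.expTrunc_add ha (neg_mem ha) (Commute.neg_right (Commute.refl a)), add_neg_cancel,
    expTrunc_zero]

theorem expTrunc_neg_mul {a : R} (ha : a ∈ N.J) :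
    expTrunc (K := K) n (-a) * expTrunc (K := K) n a = 1 := by
  simpa using N.expTrunc_mul_neg (neg_mem ha)

theorem isUnit {g : R} (hg : g - 1 ∈ N.J) : IsUnit g := by
  have ha := N.logTrunc_mem hg
  rw [← N.expTrunc_logTrunc hg]
  exact ⟨⟨_, _, N.expTrunc_mul_neg ha, N.expTrunc_neg_mul ha⟩, rfl⟩

/-- The group of unipotent units. -/
def U : Subgroup Rˣ where
  carrier := {u | (u : R) - 1 ∈ N.J}
  one_mem' := by simp
  mul_mem' {u v} hu hv := by
    have : ((u * v : Rˣ) : R) - 1 = ((u : R) - 1) * ((v : R) - 1) + (((u : R) - 1) + (v - 1)) := by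
      rw [Units.val_mul]; noncomm_ring
    rw [Set.mem_ofPred_eq, this]
    exact add_mem (N.mul_mem hu hv) (add_mem hu hv)
  inv_mem' {u} hu := by
    have ha := N.logTrunc_mem hu
    have : ((u⁻¹ : Rˣ) : R) = expTrunc (K := K) n (-logTrunc K n (u : R)) := by
      rw [Units.inv_eq_of_mul_eq_one_right]
      rw [← N.expTrunc_mul_neg ha, N.expTrunc_logTrunc hu]
    rw [Set.mem_ofPred_eq, this]
    exact N.expTrunc_sub_one_mem (neg_mem ha)

theorem mem_U {u : Rˣ} : u ∈ N.U ↔ (u : R) - 1 ∈ N.J := Iff.rfl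

theorem logTrunc_mul {u v : R} (hu : u - 1 ∈ N.J) (hv : v - 1 ∈ N.J) (h : Commute u v) :
    logTrunc K n (u * v) = logTrunc K n u + logTrunc K n v := by
  have hc : Commute (logTrunc K n u) (logTrunc K n v) :=
    SemiconjBy.logTrunc (SemiconjBy.logTrunc h.symm n).symm n
  conv_lhs => rw [← N.expTrunc_logTrunc hu, ← N.expTrunc_logTrunc hv,
    ← N.expTrunc_add (N.logTrunc_mem hu) (N.logTrunc_mem hv) hc]
  exact N.logTrunc_expTrunc (add_mem (N.logTrunc_mem hu) (N.logTrunc_mem hv))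

theorem logTrunc_inv {u : Rˣ} (hu : u ∈ N.U) :
    logTrunc K n ((u⁻¹ : Rˣ) : R) = -logTrunc K n (u : R) := by
  have h := N.logTrunc_mul hu (N.U.inv_mem hu) (by
    change (u : R) * (u⁻¹ : Rˣ) = (u⁻¹ : Rˣ) * u
    rw [Units.mul_inv, Units.inv_mul])
  rw [Units.mul_inv, logTrunc_one] at h
  exact (neg_eq_of_add_eq_zero_right h.symm).symm

end NilSub

/-! ### Powers and values of series in the group of unipotent units -/

open Classical in
/-- A unit of a ring as an element of the group of units; `1` for non-units. -/
noncomputable def unitOf (r : R) : Rˣ := if h : IsUnit r then h.unit else 1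

theorem coe_unitOf {R : Type*} [Ring R] {r : R} (h : IsUnit r) : (unitOf r : R) = r := by
  rw [unitOf, dif_pos h]; rfl

/-- Conjugation also preserves non-units, and the default value `1` is fixed by it. Equivariance of
`upow` and `uword` therefore needs no unipotence hypothesis. -/
theorem unitOf_conj {R : Type*} [Ring R] (u : Rˣ) {r s : R} (h : SemiconjBy (u : R) r s) :
    unitOf s = u * unitOf r * u⁻¹ := by
  have hs : s = u * r * (u⁻¹ : Rˣ) := by
    rw [h.eq, mul_assoc, Units.mul_inv, mul_one]
  by_cases hr : IsUnit r
  · have hs' : IsUnit s := by rw [hs]; exact (u.isUnit.mul hr).mul u⁻¹.isUnit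
    ext
    rw [coe_unitOf hs', Units.val_mul, Units.val_mul, coe_unitOf hr, hs]
  · have hs' : ¬ IsUnit s := by
      intro h'
      apply hr
      have : r = (u⁻¹ : Rˣ) * s * u := by rw [hs]; simp [mul_assoc]
      rw [this]
      exact (u⁻¹.isUnit.mul h').mul u.isUnit
    rw [unitOf, dif_neg hs', unitOf, dif_neg hr]
    simp

/-- The power `u ^ t = exp (t * log u)`, computed up to degree `n`. -/
noncomputable def upow (n : ℕ) (t : K) (u : Rˣ) : Rˣ :=
  unitOf (expTrunc (K := K) n (t • logTrunc K n (u : R)))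

/-- The value `f(log u, log v)` of a series as a unit, computed up to degree `n`. -/
noncomputable def uword (n : ℕ) (f : NCSeries K) (u v : Rˣ) : Rˣ :=
  unitOf (evalTrunc n f (logTrunc K n (u : R)) (logTrunc K n (v : R)))

theorem semiconjBy_conj (w u : Rˣ) : SemiconjBy (w : R) (u : R) ((w * u * w⁻¹ : Rˣ) : R) := by
  simp [SemiconjBy, mul_assoc]

theorem upow_conj (n : ℕ) (t : K) (w u : Rˣ) : upow n t (w * u * w⁻¹) = w * upow n t u * w⁻¹ :=
  unitOf_conj w (SemiconjBy.expTrunc ((SemiconjBy.logTrunc (semiconjBy_conj w u) n).smul_right t) n)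

theorem uword_conj (n : ℕ) (f : NCSeries K) (w u v : Rˣ) :
    uword n f (w * u * w⁻¹) (w * v * w⁻¹) = w * uword n f u v * w⁻¹ :=
  unitOf_conj w (NCSeries.SemiconjBy.evalTrunc (SemiconjBy.logTrunc (semiconjBy_conj w u) n)
    (SemiconjBy.logTrunc (semiconjBy_conj w v) n) n f)

theorem conj_eq_of_commute {G : Type*} [Group G] {w u : G} (h : Commute w u) :
    w * u * w⁻¹ = u := by
  rw [h.eq, mul_inv_cancel_right]

theorem commute_of_conj_eq {G : Type*} [Group G] {w u : G} (h : w * u * w⁻¹ = u) :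
    Commute w u :=
  eq_mul_of_mul_inv_eq h

theorem commute_upow {n : ℕ} {t : K} {w u : Rˣ} (h : Commute w u) : Commute w (upow n t u) :=
  commute_of_conj_eq (by rw [← upow_conj, conj_eq_of_commute h])

theorem commute_uword {n : ℕ} {f : NCSeries K} {w u v : Rˣ} (h : Commute w u) (h' : Commute w v) :
    Commute w (uword n f u v) :=
  commute_of_conj_eq (by rw [← uword_conj, conj_eq_of_commute h, conj_eq_of_commute h'])

namespace NilSub

variable {n : ℕ} (N : NilSub K R n)

theorem coe_upow {u : Rˣ} (hu : u ∈ N.U) (t : K) :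
    (upow n t u : R) = expTrunc (K := K) n (t • logTrunc K n (u : R)) :=
  coe_unitOf (N.isUnit (N.expTrunc_sub_one_mem (Submodule.smul_mem _ _ (N.logTrunc_mem hu))))

theorem upow_mem {u : Rˣ} (hu : u ∈ N.U) (t : K) : upow n t u ∈ N.U := by
  rw [mem_U, N.coe_upow hu]
  exact N.expTrunc_sub_one_mem (Submodule.smul_mem _ _ (N.logTrunc_mem hu))

theorem logTrunc_upow {u : Rˣ} (hu : u ∈ N.U) (t : K) :
    logTrunc K n (upow n t u : R) = t • logTrunc K n (u : R) := by
  rw [N.coe_upow hu, N.logTrunc_expTrunc (Submodule.smul_mem _ _ (N.logTrunc_mem hu))]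

theorem upow_one {u : Rˣ} (hu : u ∈ N.U) : upow n (1 : K) u = u := by
  ext
  rw [N.coe_upow hu, one_smul, N.expTrunc_logTrunc hu]

theorem upow_add {u : Rˣ} (hu : u ∈ N.U) (s t : K) :
    upow n (s + t) u = upow n s u * upow n t u := by
  ext
  have h := N.logTrunc_mem hu
  rw [Units.val_mul, N.coe_upow hu, N.coe_upow hu, N.coe_upow hu, add_smul,
    N.expTrunc_add (Submodule.smul_mem _ _ h) (Submodule.smul_mem _ _ h)
      (((Commute.refl _).smul_left s).smul_right t)]

theorem upow_upow {u : Rˣ} (hu : u ∈ N.U) (s t : K) :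
    upow n s (upow n t u) = upow n (s * t) u := by
  ext
  rw [N.coe_upow (N.upow_mem hu t), N.logTrunc_upow hu, N.coe_upow hu, mul_smul]

theorem upow_mul {u v : Rˣ} (hu : u ∈ N.U) (hv : v ∈ N.U) (h : Commute u v) (t : K) :
    upow n t (u * v) = upow n t u * upow n t v := by
  have h' : Commute (u : R) (v : R) := by
    have := congrArg Units.val h.eq
    rwa [Units.val_mul, Units.val_mul] at this
  have hc : Commute (logTrunc K n (u : R)) (logTrunc K n (v : R)) :=
    SemiconjBy.logTrunc (SemiconjBy.logTrunc h'.symm n).symm n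
  ext
  rw [Units.val_mul, N.coe_upow hu, N.coe_upow hv, N.coe_upow (N.U.mul_mem hu hv), Units.val_mul,
    N.logTrunc_mul hu hv h', smul_add, N.expTrunc_add (Submodule.smul_mem _ _ (N.logTrunc_mem hu))
      (Submodule.smul_mem _ _ (N.logTrunc_mem hv)) ((hc.smul_left t).smul_right t)]

theorem upow_inv {u : Rˣ} (hu : u ∈ N.U) (t : K) : upow n t u⁻¹ = (upow n t u)⁻¹ := by
  rw [eq_inv_iff_mul_eq_one, ← N.upow_mul (N.U.inv_mem hu) hu (Commute.inv_left (Commute.refl u)),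
    inv_mul_cancel]
  ext
  rw [N.coe_upow N.U.one_mem, Units.val_one, logTrunc_one,
    smul_zero, expTrunc_zero]

theorem coe_uword {f : NCSeries K} (hf : f [] = 1) {u v : Rˣ} (hu : u ∈ N.U) (hv : v ∈ N.U) :
    (uword n f u v : R) = evalTrunc n f (logTrunc K n (u : R)) (logTrunc K n (v : R)) := by
  refine coe_unitOf (N.isUnit ?_)
  simpa [hf] using N.evalTrunc_sub_mem n f (N.logTrunc_mem hu) (N.logTrunc_mem hv)

theorem uword_mem {f : NCSeries K} (hf : f [] = 1) {u v : Rˣ} (hu : u ∈ N.U) (hv : v ∈ N.U) :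
    uword n f u v ∈ N.U := by
  rw [mem_U, N.coe_uword hf hu hv]
  simpa [hf] using N.evalTrunc_sub_mem n f (N.logTrunc_mem hu) (N.logTrunc_mem hv)

end NilSub

end ExpLog

/-! ### Values of exponentials and logarithms of non-commutative series -/

section SeriesExpLog

variable {K : Type*} [Field K] [CharZero K]

theorem powTrunc_eq_of_le {R : Type*} [Ring R] [Algebra K R] {m n : ℕ} (h : m ≤ n)
    (c : PowerSeries K) {a : R} (ha : a ^ (m + 1) = 0) : powTrunc n c a = powTrunc m c a := by
  rw [powTrunc_eq_sum, powTrunc_eq_sum]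
  symm
  refine Finset.sum_subset (Finset.range_subset_range.2 (by omega)) fun k _ hk => ?_
  rw [Finset.mem_range, not_lt] at hk
  rw [pow_eq_zero_of_le hk ha, smul_zero]

theorem powTrunc_series_apply {p : NCSeries K} (hp : p [] = 0) (c : PowerSeries K) {n : ℕ}
    {w : List (Fin 2)} (hw : w.length ≤ n) :
    powTrunc w.length c p w = powTrunc n c p w := by
  refine (toShift_eq_iff w.length _ _).1 ?_ w le_rfl
  rw [map_powTrunc, map_powTrunc]
  exact (powTrunc_eq_of_le hw c ((shiftNil K _).pow_eq_zero (toShift_mem hp _) le_rfl)).symm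

theorem NCSeries.exp_apply (p : NCSeries K) (w : List (Fin 2)) :
    NCSeries.exp p w = expTrunc (K := K) w.length p w := by
  rw [expTrunc_eq_sum, NCSeries.sum_apply]; rfl

theorem NCSeries.exp_nil (p : NCSeries K) : NCSeries.exp p [] = 1 := by
  rw [NCSeries.exp_apply, expTrunc_eq_sum]
  simp [one_apply]

theorem NCSeries.log_nil (p : NCSeries K) : NCSeries.log p [] = 0 := by
  simp [NCSeries.log, logTrunc, NCSeries.zero_apply]

theorem NCSeries.Z_nil : (NCSeries.Z : NCSeries K) [] = 0 := by
  change -(NCSeries.log _ []) = 0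
  rw [NCSeries.log_nil, neg_zero]

theorem NCSeries.X_nil : (NCSeries.X : NCSeries K) [] = 0 := by simp [NCSeries.X]

theorem NCSeries.Y_nil : (NCSeries.Y : NCSeries K) [] = 0 := by simp [NCSeries.Y]

theorem NCSeries.smul_nil {p : NCSeries K} (hp : p [] = 0) (t : K) : (t • p) [] = 0 := by
  rw [NCSeries.smul_apply, hp, mul_zero]

variable {R : Type*} [Ring R] [Algebra K R] {n : ℕ} (N : NilSub K R n)

namespace NilSub

theorem evalTrunc_exp {a b : R} (ha : a ∈ N.J) (hb : b ∈ N.J) {p : NCSeries K} (hp : p [] = 0) :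
    evalTrunc n (NCSeries.exp p) a b = expTrunc (K := K) n (evalTrunc n p a b) := by
  rw [evalTrunc_congr n a b (g := expTrunc (K := K) n p) fun w hw => by
    rw [NCSeries.exp_apply, expTrunc, expTrunc, powTrunc_series_apply hp _ hw]]
  exact map_expTrunc (N.evalHom ha hb) n p

theorem evalTrunc_log {a b : R} (ha : a ∈ N.J) (hb : b ∈ N.J) {p : NCSeries K} (hp : p [] = 1) :
    evalTrunc n (NCSeries.log p) a b = logTrunc K n (evalTrunc n p a b) := by
  have hp' : (p - 1) [] = 0 := by
    change p [] - 1 = 0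
    rw [hp, sub_self]
  rw [evalTrunc_congr n a b (g := logTrunc K n p) fun w hw => by
    rw [NCSeries.log, logTrunc_eq_powTrunc, logTrunc_eq_powTrunc, powTrunc_series_apply hp' _ hw]]
  exact map_logTrunc (N.evalHom ha hb) n p

theorem evalTrunc_Z {u v : Rˣ} (hu : u ∈ N.U) (hv : v ∈ N.U) :
    evalTrunc n (NCSeries.Z : NCSeries K) (logTrunc K n (u : R)) (logTrunc K n (v : R)) =
      logTrunc K n (((u * v)⁻¹ : Rˣ) : R) := by
  have hu' := N.logTrunc_mem hu
  have hv' := N.logTrunc_mem hv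
  rw [N.logTrunc_inv (N.U.mul_mem hu hv), NCSeries.Z, evalTrunc_neg, N.evalTrunc_log hu' hv'
    (by rw [mul_nil, NCSeries.exp_nil, NCSeries.exp_nil, mul_one]), N.evalTrunc_mul hu' hv',
    N.evalTrunc_exp hu' hv' NCSeries.X_nil, N.evalTrunc_exp hu' hv' NCSeries.Y_nil,
    N.evalTrunc_X hu', N.evalTrunc_Y hv', N.expTrunc_logTrunc hu, N.expTrunc_logTrunc hv,
    Units.val_mul]

end NilSub

end SeriesExpLog

/-! ### Duality and hexagon for a product in the Grothendieck–Teichmüller group -/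

section Group

variable {Γ : Type*} [Group Γ]

theorem conj_mul_of_commute {G a u : Γ} (h : Commute a u) :
    G * u * G⁻¹ = (G * a) * u * (G * a)⁻¹ := by
  rw [mul_assoc G a u, h.eq]
  group

/-- Here `h1` and `h2` are the hexagons for `(u, v)` and for the swapped pair. With `a u a = u ^ λ`
and similarly for `v`, `w`, they show that a conjugate of `w ^ λ` completes the twisted pair `G u ^
λ G⁻¹`, `v ^ λ` to a triple of product one, so another hexagon can be applied to it. -/
theorem conj_of_hexagon {G Gzx Gyz a b c u v w : Γ} (h1 : Gzx * c * Gyz * b * G * a = 1)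
    (h2 : v * Gyz⁻¹ * v⁻¹ * (v * c * v⁻¹) * (u⁻¹ * Gzx⁻¹ * u⁻¹⁻¹) * a * G⁻¹ * b = 1)
    (hw : w = (u * v)⁻¹) (hcw : c * w = w * c) :
    G * a * Gzx = b⁻¹ * Gyz⁻¹ * c⁻¹ ∧
      (G * a * Gzx) * (c * w * c) * (G * a * Gzx)⁻¹ =
        (G * (a * u * a) * G⁻¹ * (b * v * b))⁻¹ := by
  have hP : G * a * Gzx = b⁻¹ * Gyz⁻¹ * c⁻¹ := by
    have : G * a * Gzx =
        (G * a) * (Gzx * c * Gyz * b * G * a) * (G * a)⁻¹ * (b⁻¹ * Gyz⁻¹ * c⁻¹) := by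
      group
    rw [this, h1]; group
  have h3 : Gyz⁻¹ * (w * c) * Gzx⁻¹ * u * a * G⁻¹ * b * v = 1 := by
    rw [← hcw]
    have : Gyz⁻¹ * (c * w) * Gzx⁻¹ * u * a * G⁻¹ * b * v = v⁻¹ *
        (v * Gyz⁻¹ * v⁻¹ * (v * c * v⁻¹) * (u⁻¹ * Gzx⁻¹ * u⁻¹⁻¹) * a * G⁻¹ * b) * v := by
      rw [hw]; group
    rw [this, h2]; group
  refine ⟨hP, ?_⟩
  rw [eq_inv_iff_mul_eq_one]
  have : G * a * Gzx * (c * w * c) * (G * a * Gzx)⁻¹ * (G * (a * u * a) * G⁻¹ * (b * v * b)) =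
      (G * a * Gzx) * c * Gyz * (Gyz⁻¹ * (w * c) * Gzx⁻¹ * u * a * G⁻¹ * b * v) * b := by
    group
  rw [this, h3, hP]; group

/-- After removal of the conjugations, the hexagon of `f` at the twisted triple and that of `g`
interleave to the hexagon of the product. -/
theorem hexagon_of_conj {G Gzx Gyz a b c H1 H2 H3 x y z : Γ}
    (hP : G * a * Gzx = b⁻¹ * Gyz⁻¹ * c⁻¹)
    (h : (G * a) * H1 * (G * a)⁻¹ * (G * a * Gzx * z * (G * a * Gzx)⁻¹) *
      ((G * a * Gzx * c) * H2 * (G * a * Gzx * c)⁻¹) * y * H3 * (G * x * G⁻¹) = 1) :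
    H1 * Gzx * (z * c) * (H2 * Gyz) * (b * y) * (H3 * G) * (x * a) = 1 := by
  have hc : G * a * Gzx * c * Gyz * b = 1 := by rw [hP]; group
  have : H1 * Gzx * (z * c) * (H2 * Gyz) * (b * y) * (H3 * G) * (x * a) =
      (G * a)⁻¹ * ((G * a) * H1 * (G * a)⁻¹ * (G * a * Gzx * z * (G * a * Gzx)⁻¹) *
        ((G * a * Gzx * c) * H2 * (G * a * Gzx * c)⁻¹) *
        (G * a * Gzx * c * Gyz * b) * y * H3 * (G * x * G⁻¹)) * (G * a) := by
    group
  rw [this, hc, mul_one, h]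
  group

end Group

namespace GTPair

variable {K : Type*} [Field K] [CharZero K] {R : Type*} [Ring R] [Algebra K R] {n : ℕ}
  (N : NilSub K R n)

/-- The left-hand side of the hexagon equation. -/
noncomputable def hexagonSeries (g : GTPair K) : NCSeries K :=
  subst g.ser Z X * NCSeries.exp (((g.lam - 1) / 2) • Z) * subst g.ser Y Z *
    NCSeries.exp (((g.lam - 1) / 2) • Y) * g.ser * NCSeries.exp (((g.lam - 1) / 2) • X)

theorem evalTrunc_hexagonSeries {g : GTPair K} (hg : g.ser [] = 1) {u v w : Rˣ} (hu : u ∈ N.U)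
    (hv : v ∈ N.U) (hw : w = (u * v)⁻¹) :
    evalTrunc n g.hexagonSeries (logTrunc K n (u : R)) (logTrunc K n (v : R)) =
      ((uword n g.ser w u * upow n ((g.lam - 1) / 2) w * uword n g.ser v w *
        upow n ((g.lam - 1) / 2) v * uword n g.ser u v * upow n ((g.lam - 1) / 2) u : Rˣ) : R) := by
  have hu' := N.logTrunc_mem hu
  have hv' := N.logTrunc_mem hv
  have hw' : w ∈ N.U := by rw [hw]; exact N.U.inv_mem (N.U.mul_mem hu hv)
  have hZ := N.evalTrunc_Z (K := K) hu hv
  rw [← hw] at hZ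
  simp only [Units.val_mul, N.coe_upow hu, N.coe_upow hv, N.coe_upow hw', N.coe_uword hg hu hv,
    N.coe_uword hg hv hw', N.coe_uword hg hw' hu, hexagonSeries, N.evalTrunc_mul hu' hv']
  rw [N.evalTrunc_subst hu' hv' _ Z_nil X_nil, N.evalTrunc_subst hu' hv' _ Y_nil Z_nil,
    N.evalTrunc_exp hu' hv' (NCSeries.smul_nil Z_nil _),
    N.evalTrunc_exp hu' hv' (NCSeries.smul_nil Y_nil _),
    N.evalTrunc_exp hu' hv' (NCSeries.smul_nil X_nil _), evalTrunc_smul, evalTrunc_smul,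
    evalTrunc_smul, hZ, N.evalTrunc_X hu', N.evalTrunc_Y hv']

theorem evalTrunc_duality {f : NCSeries K} (hf : f [] = 1) {u v : Rˣ} (hu : u ∈ N.U)
    (hv : v ∈ N.U) :
    evalTrunc n (f * subst f Y X) (logTrunc K n (u : R)) (logTrunc K n (v : R)) =
      ((uword n f u v * uword n f v u : Rˣ) : R) := by
  have hu' := N.logTrunc_mem hu
  have hv' := N.logTrunc_mem hv
  rw [Units.val_mul, N.coe_uword hf hu hv, N.coe_uword hf hv hu, N.evalTrunc_mul hu' hv',
    N.evalTrunc_subst hu' hv' _ Y_nil X_nil, N.evalTrunc_X hu', N.evalTrunc_Y hv']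

variable (K) in
/-- The exponentials of the left shifts. -/
noncomputable def shiftUnit (n : ℕ) (c : Fin 2) :
    (Module.End K (List (Fin 2) → List (Fin 2) → K))ˣ :=
  unitOf (expTrunc (K := K) n (shiftLeft K n c))

theorem coe_shiftUnit (n : ℕ) (c : Fin 2) :
    (shiftUnit K n c : Module.End K (List (Fin 2) → List (Fin 2) → K)) =
      expTrunc (K := K) n (shiftLeft K n c) :=
  coe_unitOf ((shiftNil K n).isUnit ((shiftNil K n).expTrunc_sub_one_mem (shiftLeft_mem n c)))

theorem shiftUnit_mem (n : ℕ) (c : Fin 2) : shiftUnit K n c ∈ (shiftNil K n).U := by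
  rw [NilSub.mem_U, coe_shiftUnit]
  exact (shiftNil K n).expTrunc_sub_one_mem (shiftLeft_mem n c)

theorem toShift_eq_evalTrunc_log (n : ℕ) (f : NCSeries K) :
    toShift K n f = evalTrunc n f
      (logTrunc K n (shiftUnit K n 0 : Module.End K (List (Fin 2) → List (Fin 2) → K)))
      (logTrunc K n (shiftUnit K n 1 : Module.End K (List (Fin 2) → List (Fin 2) → K))) := by
  rw [coe_shiftUnit, coe_shiftUnit, (shiftNil K n).logTrunc_expTrunc (shiftLeft_mem n 0),
    (shiftNil K n).logTrunc_expTrunc (shiftLeft_mem n 1)]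
  rfl

namespace IsGT

variable {g : GTPair K} (hg : IsGT g)
include hg

theorem uword_mul_uword {u v : Rˣ} (hu : u ∈ N.U) (hv : v ∈ N.U) :
    uword n g.ser u v * uword n g.ser v u = 1 := by
  ext
  rw [← evalTrunc_duality N hg.groupLike.1 hu hv, hg.duality, evalTrunc_one, Units.val_one]

theorem uword_inv {u v : Rˣ} (hu : u ∈ N.U) (hv : v ∈ N.U) :
    (uword n g.ser u v)⁻¹ = uword n g.ser v u :=
  inv_eq_of_mul_eq_one_right (hg.uword_mul_uword N hu hv)

theorem uword_hexagon {u v w : Rˣ} (hu : u ∈ N.U) (hv : v ∈ N.U) (hw : w = (u * v)⁻¹) :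
    uword n g.ser w u * upow n ((g.lam - 1) / 2) w * uword n g.ser v w *
      upow n ((g.lam - 1) / 2) v * uword n g.ser u v * upow n ((g.lam - 1) / 2) u = 1 := by
  ext
  rw [← evalTrunc_hexagonSeries N hg.groupLike.1 hu hv hw, hexagonSeries, hg.hexagon,
    evalTrunc_one, Units.val_one]

theorem subst_swap_mul : subst g.ser Y X * g.ser = 1 := by
  have h : subst (g.ser * subst g.ser Y X) Y X = subst 1 Y X := by rw [hg.duality]
  rwa [subst_mul Y_nil X_nil, subst_subst Y_nil X_nil Y_nil X_nil, subst_Y Y_nil X_nil,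
    subst_X Y_nil X_nil, subst_X_Y, subst_one] at h

theorem isUnit_ser : IsUnit g.ser :=
  ⟨⟨g.ser, subst g.ser Y X, hg.duality, hg.subst_swap_mul⟩, rfl⟩

theorem inverse_ser : Ring.inverse g.ser = subst g.ser Y X := by
  refine left_inv_eq_right_inv (Ring.inverse_mul_cancel _ hg.isUnit_ser) hg.duality

end IsGT

/-- The image of `X` under the substitution defining the group law. -/
noncomputable def twistX (g : GTPair K) : NCSeries K := g.lam • (g.ser * X * Ring.inverse g.ser)

theorem twistX_nil (g : GTPair K) : g.twistX [] = 0 := by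
  rw [twistX, NCSeries.smul_apply, mul_nil, mul_nil, X_nil, mul_zero, zero_mul, mul_zero]

theorem mul_ser (f g : GTPair K) :
    (mul f g).ser = subst f.ser g.twistX (g.lam • Y) * g.ser := rfl

theorem mul_ser_nil (f g : GTPair K) : (mul f g).ser [] = f.ser [] * g.ser [] := by
  rw [mul_ser, mul_nil, subst_nil]

variable {N}

theorem evalTrunc_twistX {g : GTPair K} (hg : IsGT g) {u v : Rˣ} (hu : u ∈ N.U) (hv : v ∈ N.U) :
    evalTrunc n g.twistX (logTrunc K n (u : R)) (logTrunc K n (v : R)) =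
      logTrunc K n
        ((uword n g.ser u v * upow n g.lam u * (uword n g.ser u v)⁻¹ : Rˣ) : R) := by
  have hu' := N.logTrunc_mem hu
  have hv' := N.logTrunc_mem hv
  have h1 := (SemiconjBy.logTrunc (K := K)
    (semiconjBy_conj (uword n g.ser u v) (upow n g.lam u)) n).eq
  have h2 : logTrunc K n
        ((uword n g.ser u v * upow n g.lam u * (uword n g.ser u v)⁻¹ : Rˣ) : R) =
      uword n g.ser u v * logTrunc K n (upow n g.lam u : R) * (uword n g.ser v u : Rˣ) := by
    rw [h1, ← hg.uword_inv N hu hv]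
    exact (Units.mul_inv_cancel_right _ _).symm
  rw [h2, N.logTrunc_upow hu, twistX, hg.inverse_ser, evalTrunc_smul, N.evalTrunc_mul hu' hv',
    N.evalTrunc_mul hu' hv', N.evalTrunc_subst hu' hv' _ Y_nil X_nil, N.evalTrunc_X hu',
    N.evalTrunc_Y hv', N.coe_uword hg.groupLike.1 hu hv, N.coe_uword hg.groupLike.1 hv hu,
    mul_smul_comm, smul_mul_assoc]

/-- The group law in multiplicative form: the product is `f` at the pair twisted by `g`, times `g`.
All closure properties start from this formula. -/
theorem uword_mul_ser {f g : GTPair K} (hf : f.ser [] = 1) (hg : IsGT g) {u v : Rˣ} (hu : u ∈ N.U)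
    (hv : v ∈ N.U) :
    uword n (mul f g).ser u v =
      uword n f.ser (uword n g.ser u v * upow n g.lam u * (uword n g.ser u v)⁻¹)
        (upow n g.lam v) * uword n g.ser u v := by
  have hu' := N.logTrunc_mem hu
  have hv' := N.logTrunc_mem hv
  have hG := N.uword_mem hg.groupLike.1 hu hv
  have hc : uword n g.ser u v * upow n g.lam u * (uword n g.ser u v)⁻¹ ∈ N.U :=
    N.U.mul_mem (N.U.mul_mem hG (N.upow_mem hu _)) (N.U.inv_mem hG)
  ext
  rw [Units.val_mul, N.coe_uword (by rw [mul_ser_nil, hf, hg.groupLike.1, mul_one]) hu hv,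
    N.coe_uword hf hc (N.upow_mem hv _), N.coe_uword hg.groupLike.1 hu hv, mul_ser,
    N.evalTrunc_mul hu' hv', N.evalTrunc_subst hu' hv' _ g.twistX_nil
      (NCSeries.smul_nil Y_nil _), evalTrunc_twistX hg hu hv, evalTrunc_smul, N.evalTrunc_Y hv',
    N.logTrunc_upow hv]

section Mul

variable {f g : GTPair K} (hf : IsGT f) (hg : IsGT g)
include hf hg

theorem mul_duality : (mul f g).ser * subst (mul f g).ser Y X = 1 := by
  refine NCSeries.ext_toShift fun n => ?_
  have hu := shiftUnit_mem (K := K) n 0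
  have hv := shiftUnit_mem (K := K) n 1
  have h1 : (mul f g).ser [] = 1 := by rw [mul_ser_nil, hf.groupLike.1, hg.groupLike.1, mul_one]
  rw [map_one, toShift_eq_evalTrunc_log, evalTrunc_duality (shiftNil K n) h1 hu hv,
    uword_mul_ser hf.groupLike.1 hg hu hv, uword_mul_ser hf.groupLike.1 hg hv hu,
    ← hg.uword_inv _ hu hv, Units.val_eq_one]
  set G := uword n g.ser (shiftUnit K n 0) (shiftUnit K n 1) with hG
  set a := upow n g.lam (shiftUnit K n 0)
  set b := upow n g.lam (shiftUnit K n 1)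
  have hGU : G ∈ (shiftNil K n).U := (shiftNil K n).uword_mem hg.groupLike.1 hu hv
  have ha : a ∈ (shiftNil K n).U := (shiftNil K n).upow_mem hu _
  have hb : b ∈ (shiftNil K n).U := (shiftNil K n).upow_mem hv _
  have hc : G * a * G⁻¹ ∈ (shiftNil K n).U :=
    Subgroup.mul_mem _ (Subgroup.mul_mem _ hGU ha) (Subgroup.inv_mem _ hGU)
  have e : a = G⁻¹ * (G * a * G⁻¹) * G⁻¹⁻¹ := by group
  conv_lhs => rw [e]
  rw [show G * (G⁻¹ * (G * a * G⁻¹) * G⁻¹⁻¹) * G⁻¹ = G * a * G⁻¹ by group, uword_conj,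
    ← hf.uword_inv _ hc hb]
  group

theorem mul_hexagon : hexagonSeries (mul f g) = 1 := by
  refine NCSeries.ext_toShift fun n => ?_
  have hu := shiftUnit_mem (K := K) n 0
  have hv := shiftUnit_mem (K := K) n 1
  have h1 : (mul f g).ser [] = 1 := by rw [mul_ser_nil, hf.groupLike.1, hg.groupLike.1, mul_one]
  rw [map_one, toShift_eq_evalTrunc_log, evalTrunc_hexagonSeries (shiftNil K n) h1 hu hv rfl,
    Units.val_eq_one]
  set N := shiftNil K n
  set u := shiftUnit K n 0
  set v := shiftUnit K n 1
  set w := (u * v)⁻¹ with hw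
  have hwU : w ∈ N.U := N.U.inv_mem (N.U.mul_mem hu hv)
  rw [uword_mul_ser hf.groupLike.1 hg hu hv, uword_mul_ser hf.groupLike.1 hg hv hwU,
    uword_mul_ser hf.groupLike.1 hg hwU hu]
  have h1 := hg.uword_hexagon N hu hv hw
  -- The third element for the swapped pair is `(v u)⁻¹`, which is both `v w v⁻¹` and `u⁻¹ w u`;
  -- each form serves one of the two series values.
  have h2 := hg.uword_hexagon N hv hu (w := v * w * v⁻¹) (by rw [hw]; group)
  rw [upow_conj, show uword n g.ser (v * w * v⁻¹) v = v * (uword n g.ser v w)⁻¹ * v⁻¹ by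
    rw [hg.uword_inv N hv hwU, ← uword_conj]; group, show uword n g.ser u (v * w * v⁻¹) =
    u⁻¹ * (uword n g.ser w u)⁻¹ * u⁻¹⁻¹ by
      rw [hg.uword_inv N hwU hu, ← uword_conj, hw]; group, ← hg.uword_inv N hu hv] at h2
  have hm : (mul f g).lam = f.lam * g.lam := rfl
  have hl : ∀ t ∈ N.U, upow n g.lam t =
      upow n ((g.lam - 1) / 2) t * t * upow n ((g.lam - 1) / 2) t := by
    intro t ht
    nth_rewrite 3 [← N.upow_one (K := K) ht]
    rw [← N.upow_add ht, ← N.upow_add ht]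
    congr 1
    ring
  -- For scalars `λ`, `μ` of `f`, `g`: `(λ μ - 1) / 2 = ((λ - 1) / 2) μ + (μ - 1) / 2`.
  have hm' : ∀ t ∈ N.U, upow n (((mul f g).lam - 1) / 2) t =
      upow n ((f.lam - 1) / 2) (upow n g.lam t) * upow n ((g.lam - 1) / 2) t := by
    intro t ht
    rw [N.upow_upow ht, ← N.upow_add ht, hm]
    congr 1
    ring
  have hm'' : ∀ t ∈ N.U, upow n (((mul f g).lam - 1) / 2) t =
      upow n ((g.lam - 1) / 2) t * upow n ((f.lam - 1) / 2) (upow n g.lam t) := by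
    intro t ht
    rw [N.upow_upow ht, ← N.upow_add ht, hm]
    congr 1
    ring
  rw [hm' w hwU, hm'' v hv, hm' u hu]
  have hcw : Commute (upow n ((g.lam - 1) / 2) w) w := (commute_upow (Commute.refl w)).symm
  have hbv : Commute (upow n ((g.lam - 1) / 2) v) (upow n g.lam v) :=
    commute_upow (commute_upow (Commute.refl v)).symm
  have hau : Commute (upow n ((g.lam - 1) / 2) u) (upow n g.lam u) :=
    commute_upow (commute_upow (Commute.refl u)).symm
  have hlu := hl u hu
  have hlv := hl v hv
  have hlw := hl w hwU
  set G := uword n g.ser u v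
  set Gzx := uword n g.ser w u
  set Gyz := uword n g.ser v w
  set a := upow n ((g.lam - 1) / 2) u
  set b := upow n ((g.lam - 1) / 2) v
  set c := upow n ((g.lam - 1) / 2) w
  set u' := upow n g.lam u with hu'
  set v' := upow n g.lam v with hv'
  set w' := upow n g.lam w with hw'
  have hGU : G ∈ N.U := N.uword_mem hg.groupLike.1 hu hv
  have hu'U : u' ∈ N.U := N.upow_mem hu _
  have hv'U : v' ∈ N.U := N.upow_mem hv _
  have hc : G * u' * G⁻¹ ∈ N.U :=
    Subgroup.mul_mem _ (Subgroup.mul_mem _ hGU hu'U) (Subgroup.inv_mem _ hGU)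
  obtain ⟨hP, hθ⟩ := conj_of_hexagon h1 h2 hw hcw.eq
  rw [← hlu, ← hlv, ← hlw] at hθ
  have h4 := hf.uword_hexagon N hc hv'U hθ
  have q1 : G * a * Gzx * w' * (G * a * Gzx)⁻¹ = (G * a) * (Gzx * w' * Gzx⁻¹) * (G * a)⁻¹ := by
    group
  have q2 : G * u' * G⁻¹ = (G * a) * u' * (G * a)⁻¹ := conj_mul_of_commute hau
  have q3 : G * a * Gzx * w' * (G * a * Gzx)⁻¹ =
      (G * a * Gzx * c) * w' * (G * a * Gzx * c)⁻¹ :=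
    conj_mul_of_commute (commute_upow hcw)
  have q4 : v' = (G * a * Gzx * c) * (Gyz * v' * Gyz⁻¹) * (G * a * Gzx * c)⁻¹ := by
    rw [hP, show b⁻¹ * Gyz⁻¹ * c⁻¹ * c * (Gyz * v' * Gyz⁻¹) * (b⁻¹ * Gyz⁻¹ * c⁻¹ * c)⁻¹ =
        b⁻¹ * (v' * b) by group, ← hbv.eq]
    group
  have e1 := uword_conj n f.ser (G * a) (Gzx * w' * Gzx⁻¹) u'
  rw [← q1, ← q2] at e1
  have e2 := uword_conj n f.ser (G * a * Gzx * c) (Gyz * v' * Gyz⁻¹) w'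
  rw [← q3, ← q4] at e2
  rw [e1, e2, upow_conj, upow_conj] at h4
  exact hexagon_of_conj hP h4

end Mul

end GTPair

namespace NCSeries

variable {K : Type*} [CommRing K]

theorem Commute.evalTrunc {R : Type*} [Ring R] [Algebra K R] {u a b : R} (ha : Commute u a)
    (hb : Commute u b) (n : ℕ) (f : NCSeries K) : Commute u (evalTrunc n f a b) :=
  SemiconjBy.evalTrunc ha hb n f

theorem coproduct_singleton_replicate (c : Fin 2) (k : ℕ) (f : NCSeries K) :
    coproduct f [c] (List.replicate k c) = (k + 1) * f (List.replicate (k + 1) c) := by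
  induction k generalizing f with
  | zero => simp [coproduct_nil_right]
  | succ k ih =>
    rw [List.replicate_succ, coproduct_cons_cons, coproduct_nil_left, ih, tl_apply, tl_apply,
      ← List.replicate_succ, ← List.replicate_succ]
    push_cast
    ring

/-- The coproduct coefficient at `c` and `c ^ k` is `k + 1` times the coefficient of `c ^ (k + 1)`;
group-likeness makes it a multiple of `f [c] = 0`. -/
theorem IsGroupLike.apply_replicate {K : Type*} [Field K] [CharZero K] {f : NCSeries K}
    (hf : IsGroupLike f) {c : Fin 2} (hc : f [c] = 0) (k : ℕ) :
    f (List.replicate (k + 1) c) = 0 := by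
  have h := hf.2 [c] (List.replicate k c)
  rw [coproduct_singleton_replicate, hc, zero_mul] at h
  have hk : (k : K) + 1 ≠ 0 := by exact_mod_cast k.succ_ne_zero
  exact (mul_eq_zero.1 h).resolve_left hk

variable {R : Type*} [Ring R] [Algebra K R]

theorem evalTrunc_left_zero (n : ℕ) (f : NCSeries K) (hf : ∀ k, f (List.replicate k 0) = 0)
    (a : R) : evalTrunc n f a 0 = 0 := by
  induction n generalizing f with
  | zero => simpa [evalTrunc_zero] using congrArg (algebraMap K R) (hf 0)
  | succ n ih =>
    have h0 : f [] = 0 := hf 0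
    rw [evalTrunc_succ, ih (tl 0 f) (fun k => hf (k + 1)), h0]
    simp

theorem evalTrunc_right_zero (n : ℕ) (f : NCSeries K) (hf : ∀ k, f (List.replicate k 1) = 0)
    (a : R) : evalTrunc n f 0 a = 0 := by
  induction n generalizing f with
  | zero => simpa [evalTrunc_zero] using congrArg (algebraMap K R) (hf 0)
  | succ n ih =>
    have h0 : f [] = 0 := hf 0
    rw [evalTrunc_succ, ih (tl 1 f) (fun k => hf (k + 1)), h0]
    simp

end NCSeries

/-! ### Insensitivity of group-like series to commuting factors -/

section CentralShift

variable {K : Type*} [Field K] [CharZero K] {R : Type*} [Ring R] [Algebra K R] {n : ℕ}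
  (N : NilSub K R n)

theorem commute_logTrunc {u v : Rˣ} (h : Commute u v) :
    Commute (logTrunc K n (u : R)) (logTrunc K n (v : R)) := by
  have h' : Commute (u : R) (v : R) := by
    have := congrArg Units.val h.eq
    rwa [Units.val_mul, Units.val_mul] at this
  exact SemiconjBy.logTrunc (SemiconjBy.logTrunc h'.symm n).symm n

/-- The logarithm of `u c` is a sum of commuting terms, so the value splits into that at `(log u,
log v)` times that at `(log c, 0)`. The latter is `1` because `f` contains no pure powers of `x`. -/
theorem NilSub.uword_mul_left {f : NCSeries K} (hf : IsGroupLike f) (h0 : f [0] = 0) {u v c : Rˣ}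
    (hu : u ∈ N.U) (hv : v ∈ N.U) (hc : c ∈ N.U) (hcu : Commute c u) (hcv : Commute c v) :
    uword n f (u * c) v = uword n f u v := by
  have h1 : evalTrunc n f (logTrunc K n (c : R)) (0 : R) = 1 := by
    rw [← sub_eq_zero, ← evalTrunc_one (K := K) n (logTrunc K n (c : R)) 0, ← evalTrunc_sub]
    refine evalTrunc_left_zero n _ (fun k => ?_) _
    change f _ - (1 : NCSeries K) _ = 0
    cases k with
    | zero => simp [one_apply, hf.1]
    | succ k => rw [hf.apply_replicate h0]; simp [one_apply, List.replicate_succ]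
  have h2 : Commute (u : R) (c : R) := by
    have := congrArg Units.val hcu.symm.eq
    rwa [Units.val_mul, Units.val_mul] at this
  ext
  rw [N.coe_uword hf.1 (N.U.mul_mem hu hc) hv, N.coe_uword hf.1 hu hv, Units.val_mul,
    N.logTrunc_mul hu hc h2]
  have := N.evalTrunc_add_of_isGroupLike hf (N.logTrunc_mem hu) (N.logTrunc_mem hv)
    (N.logTrunc_mem hc) N.J.zero_mem (commute_logTrunc hcu.symm) (Commute.zero_right _)
    (commute_logTrunc hcv.symm) (Commute.zero_right _)
  rw [add_zero, h1, mul_one] at this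
  exact this

theorem NilSub.uword_mul_right {f : NCSeries K} (hf : IsGroupLike f) (h0 : f [1] = 0) {u v c : Rˣ}
    (hu : u ∈ N.U) (hv : v ∈ N.U) (hc : c ∈ N.U) (hcu : Commute c u) (hcv : Commute c v) :
    uword n f u (v * c) = uword n f u v := by
  have h1 : evalTrunc n f (0 : R) (logTrunc K n (c : R)) = 1 := by
    rw [← sub_eq_zero, ← evalTrunc_one (K := K) n 0 (logTrunc K n (c : R)), ← evalTrunc_sub]
    refine evalTrunc_right_zero n _ (fun k => ?_) _
    change f _ - (1 : NCSeries K) _ = 0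
    cases k with
    | zero => simp [one_apply, hf.1]
    | succ k => rw [hf.apply_replicate h0]; simp [one_apply, List.replicate_succ]
  have h2 : Commute (v : R) (c : R) := by
    have := congrArg Units.val hcv.symm.eq
    rwa [Units.val_mul, Units.val_mul] at this
  ext
  rw [N.coe_uword hf.1 hu (N.U.mul_mem hv hc), N.coe_uword hf.1 hu hv, Units.val_mul,
    N.logTrunc_mul hv hc h2]
  have := N.evalTrunc_add_of_isGroupLike hf (N.logTrunc_mem hu) (N.logTrunc_mem hv)
    N.J.zero_mem (N.logTrunc_mem hc) (Commute.zero_right _) (commute_logTrunc hcu.symm)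
    (Commute.zero_right _) (commute_logTrunc hcv.symm)
  rw [add_zero, h1, mul_one] at this
  exact this

end CentralShift

/-! ### Group-likeness of a product -/

namespace GTPair

variable {K : Type*} [Field K] [CharZero K]

section GroupLike

variable {R : Type*} [Ring R] [Algebra K R] {n : ℕ} (N : NilSub K R n) {f g : GTPair K}

/-- A primitive element conjugated by a group-like one stays primitive: the factors from the other
commuting pair cancel against their inverses, which duality provides. -/
theorem evalTrunc_twistX_add (hg : IsGT g) {a a' b b' : R} (ha : a ∈ N.J) (ha' : a' ∈ N.J)
    (hb : b ∈ N.J) (hb' : b' ∈ N.J) (h₁ : Commute a b) (h₂ : Commute a b') (h₃ : Commute a' b)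
    (h₄ : Commute a' b') :
    evalTrunc n g.twistX (a + b) (a' + b') =
      evalTrunc n g.twistX a a' + evalTrunc n g.twistX b b' := by
  have key : ∀ {c c' : R}, c ∈ N.J → c' ∈ N.J → evalTrunc n g.twistX c c' =
      g.lam • (evalTrunc n g.ser c c' * c * evalTrunc n g.ser c' c) := by
    intro c c' hc hc'
    rw [twistX, hg.inverse_ser, evalTrunc_smul, N.evalTrunc_mul hc hc', N.evalTrunc_mul hc hc',
      N.evalTrunc_subst hc hc' _ Y_nil X_nil, N.evalTrunc_X hc, N.evalTrunc_Y hc']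
  have unit : ∀ {c c' : R}, c ∈ N.J → c' ∈ N.J →
      evalTrunc n g.ser c c' * evalTrunc n g.ser c' c = 1 := by
    intro c c' hc hc'
    have := congrArg (fun s => evalTrunc n s c c') hg.duality
    simpa only [N.evalTrunc_mul hc hc', N.evalTrunc_subst hc hc' _ Y_nil X_nil, N.evalTrunc_X hc,
      N.evalTrunc_Y hc', evalTrunc_one] using this
  rw [key ha ha', key hb hb', key (add_mem ha hb) (add_mem ha' hb'),
    N.evalTrunc_add_of_isGroupLike hg.groupLike ha ha' hb hb' h₁ h₂ h₃ h₄,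
    N.evalTrunc_add_of_isGroupLike hg.groupLike ha' ha hb' hb h₄ h₃ h₂ h₁]
  have hA := unit ha ha'
  have hB := unit hb hb'
  set A := evalTrunc n g.ser a a'
  set A' := evalTrunc n g.ser a' a
  set B := evalTrunc n g.ser b b' with hBd
  set B' := evalTrunc n g.ser b' b with hBd'
  have c1 : Commute a B := Commute.evalTrunc h₁ h₂ n _
  have c2 : Commute a' B := Commute.evalTrunc h₃ h₄ n _
  have c3 : Commute A' B := (Commute.evalTrunc c2.symm c1.symm n _).symm
  have c4 : Commute b A' := Commute.evalTrunc h₃.symm h₁.symm n _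
  have c5 : Commute b' A' := Commute.evalTrunc h₄.symm h₂.symm n _
  rw [← smul_add]
  congr 1
  have e1 : A * B * a * (A' * B') = A * a * A' := by
    calc A * B * a * (A' * B') = A * (B * a) * A' * B' := by noncomm_ring
      _ = A * a * (B * A') * B' := by rw [← c1.eq]; noncomm_ring
      _ = A * a * A' * (B * B') := by rw [← c3.eq]; noncomm_ring
      _ = _ := by rw [hB, mul_one]
  have e2 : A * B * b * (A' * B') = B * b * B' := by
    calc A * B * b * (A' * B') = A * B * (b * A') * B' := by noncomm_ring
      _ = A * (B * A') * b * B' := by rw [c4.eq]; noncomm_ring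
      _ = (A * A') * (B * b * B') := by rw [← c3.eq]; noncomm_ring
      _ = _ := by rw [hA, one_mul]
  rw [mul_add, add_mul, e1, e2]

theorem mul_isGroupLike (hf : IsGT f) (hg : IsGT g) : IsGroupLike (mul f g).ser := by
  refine isGroupLike_of_shift _ (by rw [mul_ser_nil, hf.groupLike.1, hg.groupLike.1, mul_one])
    fun n => ?_
  set N := shiftNil K n
  have ha : shiftLeft K n 0 ∈ N.J := shiftLeft_mem n 0
  have ha' : shiftLeft K n 1 ∈ N.J := shiftLeft_mem n 1
  have hb : shiftRight K n 0 ∈ N.J := shiftRight_mem n 0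
  have hb' : shiftRight K n 1 ∈ N.J := shiftRight_mem n 1
  have h₁ := shiftLeft_commute_shiftRight (K := K) n 0 0
  have h₂ := shiftLeft_commute_shiftRight (K := K) n 0 1
  have h₃ := shiftLeft_commute_shiftRight (K := K) n 1 0
  have h₄ := shiftLeft_commute_shiftRight (K := K) n 1 1
  set a := shiftLeft K n 0
  set a' := shiftLeft K n 1
  set b := shiftRight K n 0
  set b' := shiftRight K n 1
  have key : ∀ {c c' : Module.End K (List (Fin 2) → List (Fin 2) → K)}, c ∈ N.J → c' ∈ N.J →
      evalTrunc n (mul f g).ser c c' =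
        evalTrunc n f.ser (evalTrunc n g.twistX c c') (g.lam • c') * evalTrunc n g.ser c c' := by
    intro c c' hc hc'
    rw [mul_ser, N.evalTrunc_mul hc hc', N.evalTrunc_subst hc hc' _ g.twistX_nil
      (NCSeries.smul_nil Y_nil _), evalTrunc_smul, N.evalTrunc_Y hc']
  have ht : ∀ {c c' : Module.End K (List (Fin 2) → List (Fin 2) → K)}, c ∈ N.J → c' ∈ N.J →
      evalTrunc n g.twistX c c' ∈ N.J := fun hc hc' => N.evalTrunc_mem hc hc' g.twistX_nil n
  have hcomm : ∀ s t : NCSeries K, Commute (evalTrunc n s a a') (evalTrunc n t b b') :=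
    fun s t => Commute.evalTrunc (Commute.evalTrunc h₁.symm h₃.symm n s).symm
      (Commute.evalTrunc h₂.symm h₄.symm n s).symm n t
  have hca : Commute (evalTrunc n g.twistX a a') (g.lam • b') :=
    (Commute.evalTrunc h₂.symm h₄.symm n _).symm.smul_right _
  have hcb : Commute (g.lam • a') (evalTrunc n g.twistX b b') :=
    (Commute.evalTrunc h₃ h₄ n _).smul_left _
  have hcc : Commute (g.lam • a') (g.lam • b') := (h₄.smul_left _).smul_right _
  have hga : Commute (evalTrunc n g.ser a a') (evalTrunc n f.ser (evalTrunc n g.twistX b b')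
      (g.lam • b')) :=
    Commute.evalTrunc (hcomm _ _) ((Commute.evalTrunc h₂.symm h₄.symm n _).symm.smul_right _) n _
  rw [key (add_mem ha hb) (add_mem ha' hb'), key ha ha', key hb hb',
    evalTrunc_twistX_add N hg ha ha' hb hb' h₁ h₂ h₃ h₄, smul_add,
    N.evalTrunc_add_of_isGroupLike hf.groupLike (ht ha ha') (Submodule.smul_mem _ _ ha')
      (ht hb hb') (Submodule.smul_mem _ _ hb') (hcomm _ _) hca hcb hcc,
    N.evalTrunc_add_of_isGroupLike hg.groupLike ha ha' hb hb' h₁ h₂ h₃ h₄]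
  rw [mul_assoc, mul_assoc, ← mul_assoc (evalTrunc n g.ser a a'), hga.eq]
  noncomm_ring

end GroupLike

end GTPair

/-! ### Linking numbers of pure braids -/

section LinkingNumber

open PureBraid4 Braid4

/-- Twice the linking numbers of pairs of strands, together with the permutation. -/
def linkHom : Braid4 →*
    (Fin 4 × Fin 4 → Multiplicative ℤ) ⋊[mulAutArrow] Equiv.Perm (Fin 4) :=
  PresentedGroup.toGroup (f := fun i : Fin 3 => ⟨fun q =>
      Multiplicative.ofAdd (if q = (i.castSucc, i.succ) ∨ q = (i.succ, i.castSucc) then 1 else 0),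
      Equiv.swap i.castSucc i.succ⟩) (by
    rintro r (rfl | rfl | rfl) <;> simp only [map_mul, map_inv, FreeGroup.lift_apply_of] <;>
      rw [mul_inv_eq_one] <;> refine SemidirectProduct.ext ?_ ?_ <;> decide)

theorem linkHom_σ (i : Fin 3) : linkHom (σ i) = ⟨fun q =>
    Multiplicative.ofAdd (if q = (i.castSucc, i.succ) ∨ q = (i.succ, i.castSucc) then 1 else 0),
    Equiv.swap i.castSucc i.succ⟩ :=
  PresentedGroup.toGroup.of _

theorem linkHom_right (b : Braid4) : (linkHom b).right = toPerm b := by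
  have : SemidirectProduct.rightHom.comp linkHom = toPerm := by
    refine PresentedGroup.ext fun i => ?_
    rw [MonoidHom.comp_apply]
    exact (congrArg SemidirectProduct.right (linkHom_σ i)).trans (toPerm_σ i).symm
  exact DFunLike.congr_fun this b

/-- Twice the linking number of the first two strands. -/
def link12 : PureBraid4 →* Multiplicative ℤ where
  toFun b := (linkHom b).left (0, 1)
  map_one' := by simp
  map_mul' b c := by
    have h : (linkHom (b : Braid4)).right = 1 := (linkHom_right _).trans b.2
    rw [Subgroup.coe_mul, map_mul, SemidirectProduct.mul_left, h, map_one]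
    rfl

theorem link12_X12 : link12 X12 = Multiplicative.ofAdd 2 := by
  change (linkHom (σ 0 ^ 2)).left (0, 1) = _
  rw [map_pow, linkHom_σ]
  decide

theorem link12_X23 : link12 X23 = 1 := by
  change (linkHom (σ 1 ^ 2)).left (0, 1) = _
  rw [map_pow, linkHom_σ]
  decide

theorem link12_X34 : link12 X34 = 1 := by
  change (linkHom (σ 2 ^ 2)).left (0, 1) = _
  rw [map_pow, linkHom_σ]
  decide

theorem link12_X13 : link12 X13 = 1 := by
  change (linkHom (σ 1 * σ 0 ^ 2 * (σ 1)⁻¹)).left (0, 1) = _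
  rw [map_mul, map_mul, map_inv, map_pow, linkHom_σ, linkHom_σ]
  decide

theorem link12_X24 : link12 X24 = 1 := by
  change (linkHom (σ 2 * σ 1 ^ 2 * (σ 2)⁻¹)).left (0, 1) = _
  rw [map_mul, map_mul, map_inv, map_pow, linkHom_σ, linkHom_σ]
  decide

end LinkingNumber

/-! ### Three-strand braid relations and their deformation -/

section BraidThree

variable {Γ : Type*} [Group Γ] {a b : Γ}

theorem braid_conj_left (h : a * b * a = b * a * b) :
    (a * b * a) * a * (a * b * a)⁻¹ = b := by
  rw [mul_inv_eq_iff_eq_mul]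
  nth_rewrite 1 [h]
  group

theorem braid_conj_right (h : a * b * a = b * a * b) :
    (a * b * a) * b * (a * b * a)⁻¹ = a := by
  rw [mul_inv_eq_iff_eq_mul]
  nth_rewrite 2 [h]
  group

theorem commute_braid_sq_left (h : a * b * a = b * a * b) : Commute ((a * b * a) ^ 2) a := by
  refine commute_of_conj_eq ?_
  have : (a * b * a) * ((a * b * a) * a * (a * b * a)⁻¹) * (a * b * a)⁻¹ = a := by
    rw [braid_conj_left h, braid_conj_right h]
  refine Eq.trans ?_ this
  simp only [pow_two, mul_inv_rev, mul_assoc]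

theorem commute_braid_sq_right (h : a * b * a = b * a * b) : Commute ((a * b * a) ^ 2) b := by
  rw [h]
  exact commute_braid_sq_left h.symm

/-- This and the next identity express products of two pure generators through `(a b a) ^ 2`, which
commutes with `a` and `b`. They yield the commutations behind the four-strand deformation. -/
theorem braid_sq_mul_conj (h : a * b * a = b * a * b) :
    a ^ 2 * (b * a ^ 2 * b⁻¹) = (a * b * a) ^ 2 * (b ^ 2)⁻¹ := by
  rw [eq_mul_inv_iff_mul_eq]
  calc a ^ 2 * (b * a ^ 2 * b⁻¹) * b ^ 2 = a * (a * b * a) * a * b := by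
        simp only [pow_two]; group
    _ = (a * b * a) * (b * a * b) := by nth_rewrite 1 [h]; simp only [mul_assoc]
    _ = _ := by rw [← h, pow_two]

theorem braid_conj_mul_sq (h : a * b * a = b * a * b) :
    (b * a ^ 2 * b⁻¹) * b ^ 2 = (a * b * a) ^ 2 * (a ^ 2)⁻¹ := by
  rw [eq_mul_inv_iff_mul_eq]
  calc b * a ^ 2 * b⁻¹ * b ^ 2 * a ^ 2 = b * a * (a * b * a) * a := by
        simp only [pow_two]; group
    _ = (b * a * b) * (a * b * a) := by nth_rewrite 1 [h]; simp only [mul_assoc]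
    _ = _ := by rw [← h, pow_two]

/-- The element `M = Δ F` has the square of `Δ` and conjugation by it exchanges `A` and `D = F⁻¹ B
F`. The hexagon says `A D M⁻¹ D = Ω`, that is `A D A = Ω M`; conjugating by `M` gives `D A D = Ω M`,
and conjugation by `F` turns this into the braid relation. -/
theorem braid_of_hexagon {F A B D M Ω α β Δ : Γ} (hΔ : b * a * b = Δ)
    (hA' : A = α * a) (hB : B = b * β) (hB' : B = β * b) (hD : D = F⁻¹ * B * F) (hM : M = Δ * F)
    (hF : Δ * F = F⁻¹ * Δ) (hAB : Δ * A * Δ⁻¹ = B) (hΔ2 : Commute (Δ ^ 2) F)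
    (hΔA : Commute (Δ ^ 2) A) (hΩa : Commute Ω a) (hΩb : Commute Ω b)
    (hΩF : Commute Ω F) (hΩα : Commute Ω α) (hΩβ : Commute Ω β)
    (hex : a * F⁻¹ * a⁻¹ * (a * β * a⁻¹ * Ω⁻¹) * (b⁻¹ * F⁻¹ * b) * β * F * α = 1) :
    B * (F * A * F⁻¹) * B = F * A * F⁻¹ * B * (F * A * F⁻¹) ∧
      (B * (F * A * F⁻¹) * B) ^ 2 = Δ ^ 2 * Ω ^ 2 := by
  have h1 : A * D * M⁻¹ * D = Ω := by
    have e : a * F⁻¹ * a⁻¹ * (a * β * a⁻¹ * Ω⁻¹) * (b⁻¹ * F⁻¹ * b) * β * F * α =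
        a * F⁻¹ * β * a⁻¹ * b⁻¹ * F⁻¹ * b * β * F * α * Ω⁻¹ := by
      have hc : Commute Ω⁻¹ (b⁻¹ * F⁻¹ * b * β * F * α) :=
        ((((((hΩb.inv_right).mul_right hΩF.inv_right).mul_right hΩb).mul_right hΩβ).mul_right
          hΩF).mul_right hΩα).inv_left
      have := hc.eq
      simp only [mul_assoc] at this ⊢
      rw [this]; group
    rw [e, mul_inv_eq_one] at hex
    have e2 : A * D * M⁻¹ * D =
        α * (a * F⁻¹ * β * a⁻¹ * b⁻¹ * F⁻¹ * b * β * F * α) * α⁻¹ := by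
      rw [hD, hM, ← hΔ]
      nth_rewrite 1 [hB']
      rw [hB, hA']
      group
    rw [e2, hex, ← hΩα.eq]; group
  have hMA : M * A * M⁻¹ = D := by
    rw [hM, hD, ← hAB, hF]; group
  have hMM : M * M = Δ ^ 2 := by
    have : M * M = F⁻¹ * (Δ ^ 2 * F) := by
      rw [hM]
      nth_rewrite 1 [hF]
      simp only [pow_two, mul_assoc]
    rw [this, hΔ2.eq, inv_mul_cancel_left]
  have hΩΔ : Commute Ω Δ := by rw [← hΔ]; exact (hΩb.mul_right hΩa).mul_right hΩb
  have hΩM : Commute Ω M := by rw [hM]; exact hΩΔ.mul_right hΩF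
  have h2 : A * D * A = Ω * M := by
    rw [← h1, ← hMA]; group
  have hMD : M * D * M⁻¹ = A := by
    have : M * D * M⁻¹ = (M * M) * A * (M * M)⁻¹ := by rw [← hMA]; group
    rw [this, hMM, conj_eq_of_commute hΔA]
  have h3 : D * A * D = Ω * M := by
    have : D * A * D = M * (A * D * A) * M⁻¹ := by
      conv_lhs => rw [← hMA]
      conv_lhs => enter [1, 2]; rw [← hMD]
      group
    rw [this, h2, ← mul_assoc, ← hΩM.eq, mul_assoc, mul_assoc, mul_inv_cancel, mul_one]
  have hBF : B = F * D * F⁻¹ := by rw [hD]; group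
  have h4 : B * (F * A * F⁻¹) * B = F * (D * A * D) * F⁻¹ := by rw [hBF]; group
  have h5 : F * A * F⁻¹ * B * (F * A * F⁻¹) = F * (A * D * A) * F⁻¹ := by rw [hBF]; group
  refine ⟨by rw [h4, h5, h2, h3], ?_⟩
  have h6 : (Ω * M) ^ 2 = Δ ^ 2 * Ω ^ 2 := by
    rw [hΩM.mul_pow, pow_two M, hMM, ((hΩΔ.pow_right 2).pow_left 2).eq]
  rw [h4, h3, conj_pow, h6]
  exact conj_eq_of_commute (hΔ2.symm.mul_right (hΩF.symm.pow_right 2))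

end BraidThree

section BraidPower

variable {K : Type*} [Field K] [CharZero K] {R : Type*} [Ring R] [Algebra K R] {n : ℕ}
  (N : NilSub K R n)

/-- The power `a ^ t` of a unit with unipotent square. -/
noncomputable def braidPow (n : ℕ) (t : K) (a : Rˣ) : Rˣ := a * upow n ((t - 1) / 2) (a ^ 2)

theorem commute_braidPow {t : K} {a w : Rˣ} (h : Commute w a) : Commute w (braidPow n t a) :=
  h.mul_right (commute_upow (h.pow_right 2))

theorem braidPow_conj (t : K) (w a : Rˣ) :
    braidPow n t (w * a * w⁻¹) = w * braidPow n t a * w⁻¹ := by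
  rw [braidPow, braidPow, conj_pow, upow_conj]
  group

theorem NilSub.braidPow_sq {a : Rˣ} (ha : a ^ 2 ∈ N.U) (t : K) :
    braidPow n t a ^ 2 = upow n t (a ^ 2) := by
  have hc : Commute a (upow n ((t - 1) / 2) (a ^ 2)) := commute_upow (Commute.pow_right rfl 2)
  rw [braidPow, hc.mul_pow]
  nth_rewrite 1 [← N.upow_one (K := K) ha]
  rw [pow_two (upow n ((t - 1) / 2) (a ^ 2)), ← N.upow_add ha, ← N.upow_add ha]
  congr 1
  ring

/-- The hexagon is applied to `a ^ 2`, `b ^ 2` and `d ω⁻¹`, where `d` is conjugate to both squares.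
The factor `ω⁻¹` may be dropped inside the series, and the three series values become conjugates of
`F` or its inverse. -/
theorem GTPair.IsGT.braid_relation {g : GTPair K} (hg : GTPair.IsGT g) (h0 : g.ser [0] = 0)
    (h1 : g.ser [1] = 0) {a b : Rˣ} (h : a * b * a = b * a * b) (ha : a ^ 2 ∈ N.U)
    (hb : b ^ 2 ∈ N.U) (hd : b⁻¹ * a ^ 2 * b ∈ N.U) {A B C : Rˣ} (hA : A = braidPow n g.lam a)
    (hB : B = braidPow n g.lam b)
    (hC : C = uword n g.ser (a ^ 2) (b ^ 2) * A * (uword n g.ser (a ^ 2) (b ^ 2))⁻¹) :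
    B * C * B = C * B * C ∧ (B * C * B) ^ 2 = upow n g.lam ((a * b * a) ^ 2) := by
  set F := uword n g.ser (a ^ 2) (b ^ 2) with hF
  set m := (g.lam - 1) / 2
  set ω := (a * b * a) ^ 2 with hω
  have hωa : Commute ω a := commute_braid_sq_left h
  have hωb : Commute ω b := commute_braid_sq_right h
  have hda : b⁻¹ * a ^ 2 * b = a * b ^ 2 * a⁻¹ := by
    have : a * b ^ 2 = b⁻¹ * a ^ 2 * b * a := by
      rw [eq_comm, mul_assoc, mul_assoc, inv_mul_eq_iff_eq_mul]
      calc a ^ 2 * (b * a) = a * (a * b * a) := by simp only [pow_two, mul_assoc]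
        _ = (a * b * a) * b := by nth_rewrite 1 [h]; simp only [mul_assoc]
        _ = _ := by rw [h]; simp only [pow_two, mul_assoc]
    rw [this]; group
  set d := b⁻¹ * a ^ 2 * b with hd'
  have hωd : ω = a ^ 2 * b ^ 2 * d := by
    have h2 : a ^ 2 * (b ^ 2 * d) = a ^ 2 * (b * a ^ 2 * b⁻¹) * b ^ 2 := by
      rw [hd', pow_two b]; group
    rw [mul_assoc, h2, braid_sq_mul_conj h, inv_mul_cancel_right]
  have hωU : ω ∈ N.U := by
    rw [hωd]
    exact N.U.mul_mem (N.U.mul_mem ha hb) hd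
  have hw : d * ω⁻¹ = (a ^ 2 * b ^ 2)⁻¹ := by
    rw [hωd]; group
  have hωd' : Commute ω⁻¹ d :=
    ((hωb.inv_right.mul_right (hωa.pow_right 2)).mul_right hωb).inv_left
  have hinv := hg.uword_inv N ha hb
  -- Here `d` is read as `a b ^ 2 a⁻¹`, whereas in `e2` it is read as `b⁻¹ a ^ 2 b`.
  have e1 : uword n g.ser (d * ω⁻¹) (a ^ 2) = a * F⁻¹ * a⁻¹ := by
    rw [N.uword_mul_left hg.groupLike h0 hd ha (N.U.inv_mem hωU) hωd'
      (hωa.pow_right 2).inv_left, hinv, ← uword_conj, hda]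
    congr 1
    group
  have e2 : uword n g.ser (b ^ 2) (d * ω⁻¹) = b⁻¹ * F⁻¹ * b := by
    rw [N.uword_mul_right hg.groupLike h1 hb hd (N.U.inv_mem hωU)
      (hωb.pow_right 2).inv_left hωd', hinv]
    conv_rhs => enter [2]; rw [← inv_inv b]
    rw [← uword_conj, inv_inv]
    congr 1
    group
  have e3 : upow n m (d * ω⁻¹) = a * upow n m (b ^ 2) * a⁻¹ * (upow n m ω)⁻¹ := by
    rw [N.upow_mul hd (N.U.inv_mem hωU) hωd'.symm, N.upow_inv hωU, hda, upow_conj]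
  have hex := hg.uword_hexagon N ha hb hw
  rw [e1, e2, e3] at hex
  have hΔa := braid_conj_left h
  have hΔb := braid_conj_right h
  have hΔF : (a * b * a) * F * (a * b * a)⁻¹ = F⁻¹ := by
    rw [hF, ← uword_conj, ← conj_pow, ← conj_pow, hΔa, hΔb, hinv]
  have hω1 : ∀ u : Rˣ, Commute u ω → Commute (upow n m ω) u := fun u hu => (commute_upow hu).symm
  have hωF : Commute ω F := commute_uword (hωa.pow_right 2) (hωb.pow_right 2)
  have hΔ2 : (b * a * b) ^ 2 = ω := by rw [← h]
  obtain ⟨r1, r2⟩ := braid_of_hexagon (F := F) (A := A) (B := B) (Ω := upow n m ω) (a := a) (b := b)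
    (D := F⁻¹ * B * F) (α := upow n m (a ^ 2)) (β := upow n m (b ^ 2)) rfl
    (by rw [hA, braidPow, (commute_upow (Commute.pow_right rfl 2)).eq]) hB
    (by rw [hB, braidPow, (commute_upow (Commute.pow_right rfl 2)).eq]) rfl rfl
    (by rw [← h, ← hΔF]; group) (by rw [← h, hA, hB, ← braidPow_conj, hΔa])
    (by rw [hΔ2]; exact hωF) (by rw [hΔ2, hA]; exact commute_braidPow hωa)
    (hω1 _ hωa.symm) (hω1 _ hωb.symm) (hω1 _ hωF.symm)
    (hω1 _ (commute_upow (hωa.pow_right 2)).symm) (hω1 _ (commute_upow (hωb.pow_right 2)).symm) hex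
  rw [← hC] at r1 r2
  refine ⟨r1, ?_⟩
  rw [r2, hΔ2]
  nth_rewrite 1 [← N.upow_one (K := K) hωU]
  rw [pow_two (upow n m ω), ← N.upow_add hωU, ← N.upow_add hωU]
  congr 1
  simp only [m]
  ring

end BraidPower

/-! ### The pentagon equation in unipotent representations -/

section Pentagon

open PureBraid4 Braid4

variable {K : Type*} [Field K] {R : Type*} [Ring R] [Algebra K R]

/-- The algebra morphism defined on the group algebra by a morphism to the group of units. -/
noncomputable def groupAlgebraHom (χ : PureBraid4 →* Rˣ) : MonoidAlgebra K PureBraid4 →ₐ[K] R :=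
  MonoidAlgebra.lift K R PureBraid4 ((Units.coeHom R).comp χ)

theorem groupAlgebraHom_of (χ : PureBraid4 →* Rˣ) (β : PureBraid4) :
    groupAlgebraHom (K := K) χ (MonoidAlgebra.of K PureBraid4 β) = χ β :=
  MonoidAlgebra.lift_of _ _

theorem of_sub_one_mem_augIdeal (β : PureBraid4) :
    MonoidAlgebra.of K PureBraid4 β - 1 ∈ augIdeal K := by
  rw [augIdeal, LinearMap.mem_ker]
  change MonoidAlgebra.lift K K PureBraid4 (1 : PureBraid4 →* K) _ = 0
  rw [map_sub, MonoidAlgebra.lift_of, map_one]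
  simp

theorem map_augIdeal_pow_le {χ : PureBraid4 →* Rˣ} {J : Submodule K R}
    (hχ : ∀ β, (χ β : R) - 1 ∈ J) (k : ℕ) :
    (augIdeal K ^ k).map (groupAlgebraHom (K := K) χ).toLinearMap ≤ J ^ k := by
  have h1 : ∀ r : MonoidAlgebra K PureBraid4, groupAlgebraHom (K := K) χ r -
      algebraMap K R (MonoidAlgebra.lift K K PureBraid4 (1 : PureBraid4 →* K) r) ∈ J := by
    intro r
    induction r using MonoidAlgebra.induction_on with
    | of β =>
      rw [groupAlgebraHom_of, MonoidAlgebra.lift_of]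
      simpa using hχ β
    | add a b ha hb =>
      rw [map_add, map_add, map_add, add_sub_add_comm]
      exact add_mem ha hb
    | smul c a ha =>
      rw [map_smul, map_smul, smul_eq_mul, map_mul, ← Algebra.smul_def, ← smul_sub]
      exact J.smul_mem c ha
  rw [Submodule.map_pow]
  refine pow_le_pow_left' ?_ k
  rintro _ ⟨r, hr, rfl⟩
  have := h1 r
  rw [augIdeal, SetLike.mem_coe, LinearMap.mem_ker] at hr
  change MonoidAlgebra.lift K K PureBraid4 (1 : PureBraid4 →* K) r = 0 at hr
  rwa [hr, map_zero, sub_zero] at this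

variable [CharZero K] {n : ℕ} (N : NilSub K R n)

theorem groupAlgebraHom_eq_of_sub_mem {χ : PureBraid4 →* Rˣ} (hχ : ∀ β, χ β ∈ N.U)
    {a b : MonoidAlgebra K PureBraid4} (h : a - b ∈ augIdeal K ^ (n + 1)) :
    groupAlgebraHom (K := K) χ a = groupAlgebraHom χ b := by
  have := map_augIdeal_pow_le (K := K) (J := N.J) hχ (n + 1) ⟨_, h, rfl⟩
  rw [N.pow_eq, Submodule.mem_bot] at this
  rw [← sub_eq_zero, ← map_sub]
  exact this

theorem groupAlgebraHom_evalLog (χ : PureBraid4 →* Rˣ) (f : NCSeries K) (β γ : PureBraid4) :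
    groupAlgebraHom χ (evalLog n f β γ) =
      evalTrunc n f (logTrunc K n (χ β : R)) (logTrunc K n (χ γ : R)) := by
  rw [evalLog, map_evalTrunc, map_logTrunc, map_logTrunc, groupAlgebraHom_of, groupAlgebraHom_of]

theorem groupAlgebraHom_evalLog_uword {χ : PureBraid4 →* Rˣ} (hχ : ∀ β, χ β ∈ N.U) {f : NCSeries K}
    (hf : f [] = 1) (β γ : PureBraid4) :
    groupAlgebraHom χ (evalLog n f β γ) = uword n f (χ β) (χ γ) := by
  rw [groupAlgebraHom_evalLog, N.coe_uword hf (hχ β) (hχ γ)]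

/-- The pentagon equation in the group of units of an algebra, up to degree `n`. -/
def UnitPentagon (n : ℕ) (χ : PureBraid4 →* Rˣ) (f : NCSeries K) : Prop :=
  uword n f (χ X12) (χ (X23 * X24)) * uword n f (χ (X13 * X23)) (χ X34) =
    uword n f (χ X23) (χ X34) * uword n f (χ (X12 * X13)) (χ (X24 * X34)) *
      uword n f (χ X12) (χ X23)

theorem GTPair.IsGT.unitPentagon {g : GTPair K} (hg : GTPair.IsGT g) {χ : PureBraid4 →* Rˣ}
    (hχ : ∀ β, χ β ∈ N.U) : UnitPentagon n χ g.ser := by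
  have h := groupAlgebraHom_eq_of_sub_mem N hχ (hg.pentagon n)
  simp only [map_mul, groupAlgebraHom_evalLog_uword N hχ hg.groupLike.1] at h
  ext
  simpa only [Units.val_mul, map_mul] using h

/-- One unipotent representation per degree suffices, provided that its kernel on the group algebra
lies in the corresponding power of the augmentation ideal. -/
theorem completedEq_pentagon {f : NCSeries K} (hf : f [] = 1)
    (h : ∀ n : ℕ, ∃ (R : Type _) (_ : Ring R) (_ : Algebra K R) (N : NilSub K R n)
      (χ : PureBraid4 →* Rˣ), (∀ β, χ β ∈ N.U) ∧ UnitPentagon n χ f ∧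
      ∀ r, groupAlgebraHom (K := K) χ r = 0 → r ∈ augIdeal K ^ (n + 1)) :
    CompletedEq
    (fun n => evalLog n f X12 (X23 * X24) * evalLog n f (X13 * X23) X34)
    (fun n => evalLog n f X23 X34 * evalLog n f (X12 * X13) (X24 * X34) *
      evalLog n f X12 X23) := by
  intro n
  obtain ⟨R, _, _, N, χ, hχ, hp, hinj⟩ := h n
  refine hinj _ ?_
  have := congrArg Units.val hp
  simp only [map_sub, map_mul, groupAlgebraHom_evalLog_uword N hχ hf, sub_eq_zero]
  simpa only [Units.val_mul, map_mul] using this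

end Pentagon

/-! ### Vanishing of the linear coefficients -/

section LinearCoefficients

open PureBraid4 Braid4

variable {K : Type*} [Field K] [CharZero K]

/-- The augmentation ideal of the dual numbers. -/
noncomputable def dualNumberNil (K : Type*) [Field K] : NilSub K (DualNumber K) 1 where
  J := LinearMap.ker (TrivSqZeroExt.fstHom K K K).toLinearMap
  mul_le := by
    rw [Submodule.mul_le]
    intro a ha b hb
    simp_all
  pow_eq := by
    rw [eq_bot_iff, pow_two, Submodule.mul_le]
    intro a ha b hb
    have ha' : a.fst = 0 := ha
    have hb' : b.fst = 0 := hb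
    rw [Submodule.mem_bot]
    ext <;> simp [ha', hb']

/-- The unit `1 + ε` of the dual numbers. -/
noncomputable def oneAddEps (K : Type*) [Field K] : (DualNumber K)ˣ where
  val := 1 + DualNumber.eps
  inv := 1 - DualNumber.eps
  val_inv := by ext <;> simp
  inv_val := by ext <;> simp

theorem oneAddEps_mem : oneAddEps K ∈ (dualNumberNil K).U := by
  change (1 + DualNumber.eps - 1 : DualNumber K).fst = 0
  simp

theorem coe_uword_one {f : NCSeries K} (hf : f [] = 1) {u v : (DualNumber K)ˣ}
    (hu : u ∈ (dualNumberNil K).U) (hv : v ∈ (dualNumberNil K).U) :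
    (uword 1 f u v : DualNumber K) = 1 + (f [0] • ((u : DualNumber K) - 1) +
      f [1] • ((v : DualNumber K) - 1)) := by
  rw [(dualNumberNil K).coe_uword hf hu hv]
  simp [evalTrunc_succ, evalTrunc_zero, logTrunc, hf, tl, Algebra.smul_def]
  ring

/-- The linking number of the first two strands sends `X12` to `(1 + ε) ^ 2` and the other
generators occurring in the pentagon to `1`. The factor `f(X12, 1)` then appears once on the left
and twice on the right, so it is `1`. -/
theorem GTPair.IsGT.apply_singleton_zero {g : GTPair K} (hg : GTPair.IsGT g) : g.ser [0] = 0 := by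
  let χ : PureBraid4 →* (DualNumber K)ˣ := (zpowersHom _ (oneAddEps K)).comp link12
  have hχ : ∀ β, χ β ∈ (dualNumberNil K).U := fun β =>
    Subgroup.zpow_mem _ oneAddEps_mem _
  have h := hg.unitPentagon _ hχ
  have h12 : χ X12 = oneAddEps K ^ (2 : ℤ) := by
    change zpowersHom _ (oneAddEps K) (link12 X12) = _
    rw [link12_X12]; rfl
  have h23 : χ X23 = 1 := by
    change zpowersHom _ (oneAddEps K) (link12 X23) = _
    rw [link12_X23, map_one]
  have h34 : χ X34 = 1 := by
    change zpowersHom _ (oneAddEps K) (link12 X34) = _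
    rw [link12_X34, map_one]
  have h13 : χ X13 = 1 := by
    change zpowersHom _ (oneAddEps K) (link12 X13) = _
    rw [link12_X13, map_one]
  have h24 : χ X24 = 1 := by
    change zpowersHom _ (oneAddEps K) (link12 X24) = _
    rw [link12_X24, map_one]
  have h2 : oneAddEps K ^ (2 : ℤ) ∈ (dualNumberNil K).U := Subgroup.zpow_mem _ oneAddEps_mem _
  have h1 := (dualNumberNil K).U.one_mem
  have hv : ((oneAddEps K ^ (2 : ℤ) : (DualNumber K)ˣ) : DualNumber K) =
      1 + (2 : K) • DualNumber.eps := by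
    rw [zpow_ofNat, pow_two, Units.val_mul]
    change (1 + DualNumber.eps) * (1 + DualNumber.eps) = _
    ext <;> simp
    norm_num
  have e11 : uword 1 g.ser (1 : (DualNumber K)ˣ) 1 = 1 := by
    ext1
    rw [coe_uword_one hg.groupLike.1 h1 h1]; simp
  rw [UnitPentagon, map_mul, map_mul, map_mul, map_mul, h12, h23, h34, h13, h24] at h
  simp only [mul_one, e11, one_mul] at h
  have h' : uword 1 g.ser (oneAddEps K ^ (2 : ℤ)) 1 = 1 := by
    simpa using h
  have := congrArg (fun u : (DualNumber K)ˣ => (u : DualNumber K).snd) h'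
  simp only [coe_uword_one hg.groupLike.1 h2 h1, hv] at this
  simpa using this

/-- The coefficient of `x` in the duality equation is the sum of the two linear coefficients. -/
theorem GTPair.IsGT.apply_singleton_one {g : GTPair K} (hg : GTPair.IsGT g) : g.ser [1] = 0 := by
  have h := congrArg (fun s => s [0]) hg.duality
  have e : subst g.ser Y X [0] = g.ser [1] := by
    change evalTrunc 1 g.ser Y X [0] = _
    rw [evalTrunc_succ, evalTrunc_zero, evalTrunc_zero, NCSeries.add_apply, NCSeries.add_apply]
    simp [Algebra.algebraMap_eq_smul_one, NCSeries.smul_apply, one_apply, mul_apply, X, Y,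
      Finset.sum_range_succ, tl]
  simp only [mul_apply, List.length_singleton, Finset.sum_range_succ, Finset.sum_range_zero,
    List.take_zero, List.drop_zero, zero_add, one_apply] at h
  rw [e] at h
  simpa [hg.groupLike.1, hg.apply_singleton_zero] using h

end LinearCoefficients

/-! ### Deformation of a four-strand braid representation -/

section BraidAutomorphism

variable {K : Type*} [Field K] [CharZero K] {R : Type*} [Ring R] [Algebra K R] {n : ℕ}
  (N : NilSub K R n)

theorem NilSub.upow_mul_inv {u v : Rˣ} (hu : u ∈ N.U) (hv : v ∈ N.U) (h : Commute u v) (t : K) :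
    upow n t (u * v⁻¹) = upow n t u * (upow n t v)⁻¹ := by
  rw [N.upow_mul hu (N.U.inv_mem hv) h.inv_right, N.upow_inv hv]

/-- The relation between `t₁` and `t₂` is the three-strand one. Since `P` commutes with `a` and `Q`
with `b`, the pentagon `H P = G Q E` lets `t₀`, `t₁` be written as one common conjugate of the
three-strand pair for `a`, `b`; and `t₀`, `t₂` commute because `H` commutes with `c`. The remaining
formulas identify the images of the arguments of the pentagon. -/
theorem GTPair.IsGT.deformed_braid_relations {g : GTPair K} (hg : GTPair.IsGT g) {a b c : Rˣ}
    (hab : a * b * a = b * a * b) (hbc : b * c * b = c * b * c) (hac : a * c = c * a)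
    (ha : a ^ 2 ∈ N.U) (hb : b ^ 2 ∈ N.U) (hc : c ^ 2 ∈ N.U) (hba : b⁻¹ * a ^ 2 * b ∈ N.U)
    (hcb : c⁻¹ * b ^ 2 * c ∈ N.U) (hba' : b * a ^ 2 * b⁻¹ ∈ N.U) (hcb' : c * b ^ 2 * c⁻¹ ∈ N.U)
    {P Q E G H t₀ t₁ t₂ : Rˣ} (hP : P = uword n g.ser (b * a ^ 2 * b⁻¹ * b ^ 2) (c ^ 2))
    (hQ : Q = uword n g.ser (a ^ 2 * (b * a ^ 2 * b⁻¹)) (c * b ^ 2 * c⁻¹ * c ^ 2))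
    (hE : E = uword n g.ser (a ^ 2) (b ^ 2)) (hG : G = uword n g.ser (b ^ 2) (c ^ 2))
    (hH : H = uword n g.ser (a ^ 2) (b ^ 2 * (c * b ^ 2 * c⁻¹))) (hpent : H * P = G * Q * E)
    (ht₀ : t₀ = H * braidPow n g.lam a * H⁻¹) (ht₁ : t₁ = G * braidPow n g.lam b * G⁻¹)
    (ht₂ : t₂ = braidPow n g.lam c) :
    (t₀ * t₁ * t₀ = t₁ * t₀ * t₁ ∧ t₁ * t₂ * t₁ = t₂ * t₁ * t₂ ∧ t₀ * t₂ = t₂ * t₀) ∧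
    (t₀ ^ 2 = H * upow n g.lam (a ^ 2) * H⁻¹ ∧
      t₀ ^ 2 = (G * Q * E) * upow n g.lam (a ^ 2) * (G * Q * E)⁻¹) ∧
    (t₁ ^ 2 = G * upow n g.lam (b ^ 2) * G⁻¹ ∧
      t₁ ^ 2 = (G * Q) * upow n g.lam (b ^ 2) * (G * Q)⁻¹) ∧
    (t₂ ^ 2 = upow n g.lam (c ^ 2) ∧ t₂ ^ 2 = H * upow n g.lam (c ^ 2) * H⁻¹) ∧
    t₁ ^ 2 * (t₂ * t₁ ^ 2 * t₂⁻¹) = upow n g.lam (b ^ 2 * (c * b ^ 2 * c⁻¹)) ∧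
    (t₂ * t₁ ^ 2 * t₂⁻¹) * t₂ ^ 2 = G * upow n g.lam (c * b ^ 2 * c⁻¹ * c ^ 2) * G⁻¹ ∧
    t₀ ^ 2 * (t₁ * t₀ ^ 2 * t₁⁻¹) =
      (G * Q) * upow n g.lam (a ^ 2 * (b * a ^ 2 * b⁻¹)) * (G * Q)⁻¹ ∧
    (t₁ * t₀ ^ 2 * t₁⁻¹) * t₁ ^ 2 =
      (H * P) * upow n g.lam (b * a ^ 2 * b⁻¹ * b ^ 2) * (H * P)⁻¹ := by
  have hg0 := hg.apply_singleton_zero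
  have hg1 := hg.apply_singleton_one
  have hy := braid_sq_mul_conj hab
  have hz := braid_conj_mul_sq hab
  have hy' := braid_sq_mul_conj hbc
  have hz' := braid_conj_mul_sq hbc
  have hωa := commute_braid_sq_left hab
  have hωb := commute_braid_sq_right hab
  have hωb' := commute_braid_sq_left hbc
  have hωc' := commute_braid_sq_right hbc
  have hωU : (a * b * a) ^ 2 ∈ N.U := by
    rw [← eq_mul_inv_iff_mul_eq.1 hy]
    exact N.U.mul_mem (N.U.mul_mem ha hba') hb
  have hωU' : (b * c * b) ^ 2 ∈ N.U := by
    rw [← eq_mul_inv_iff_mul_eq.1 hy']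
    exact N.U.mul_mem (N.U.mul_mem hb hcb') hc
  set ω := (a * b * a) ^ 2
  set ω' := (b * c * b) ^ 2
  rw [hz] at hP
  rw [hy, hz'] at hQ
  rw [hy'] at hH
  rw [hy, hz, hy', hz']
  have cac : Commute a c := hac
  -- After the rewriting above, the first argument of `P` is `ω a ^ (-2)`, and `ω` commutes with
  -- `a`. The same mechanism serves `H` and `Q`.
  have cPa : Commute a P := by
    rw [hP]
    exact commute_uword (hωa.symm.mul_right (Commute.pow_right rfl 2).inv_right) (cac.pow_right 2)
  have cHc : Commute c H := by
    rw [hH]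
    exact commute_uword (cac.symm.pow_right 2)
      (hωc'.symm.mul_right (Commute.pow_right rfl 2).inv_right)
  have cQb : Commute b Q := by
    rw [hQ]
    exact commute_uword (hωb.symm.mul_right (Commute.pow_right rfl 2).inv_right)
      (hωb'.symm.mul_right (Commute.pow_right rfl 2).inv_right)
  have cωE : Commute ω E := by
    rw [hE]; exact commute_uword (hωa.pow_right 2) (hωb.pow_right 2)
  have cωG : Commute ω' G := by
    rw [hG]; exact commute_uword (hωb'.pow_right 2) (hωc'.pow_right 2)
  obtain ⟨r1, r2⟩ := hg.braid_relation N hg0 hg1 hab ha hb hba rfl rfl rfl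
  obtain ⟨r3, r4⟩ := hg.braid_relation N hg0 hg1 hbc hb hc hcb rfl rfl rfl
  rw [← hE] at r1 r2
  rw [← hG, ← ht₁, ← ht₂] at r3 r4
  have hA2 := N.braidPow_sq ha g.lam
  have hB2 := N.braidPow_sq hb g.lam
  have hC2 := N.braidPow_sq hc g.lam
  have cAP : Commute (braidPow n g.lam a) P := (commute_braidPow cPa.symm).symm
  have cBQ : Commute (braidPow n g.lam b) Q := (commute_braidPow cQb.symm).symm
  set A := braidPow n g.lam a
  set B := braidPow n g.lam b with hBdef
  have ht₀' : t₀ = (G * Q) * (E * A * E⁻¹) * (G * Q)⁻¹ := by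
    rw [ht₀, conj_mul_of_commute cAP.symm, hpent]; group
  have ht₁' : t₁ = (G * Q) * B * (G * Q)⁻¹ := by
    rw [ht₁, conj_mul_of_commute cBQ.symm]
  have e1 : t₁ * t₀ * t₁ = (G * Q) * (B * (E * A * E⁻¹) * B) * (G * Q)⁻¹ := by
    rw [ht₀', ht₁']; group
  have e2 : t₀ * t₁ * t₀ = (G * Q) * (E * A * E⁻¹ * B * (E * A * E⁻¹)) * (G * Q)⁻¹ := by
    rw [ht₀', ht₁']; group
  have b01 : t₀ * t₁ * t₀ = t₁ * t₀ * t₁ := by rw [e1, e2, r1]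
  have s01 : (t₀ * t₁ * t₀) ^ 2 = (G * Q) * upow n g.lam ω * (G * Q)⁻¹ := by
    rw [b01, e1, conj_pow, r2]
  have b12 : t₁ * t₂ * t₁ = t₂ * t₁ * t₂ := r3.symm
  have s12 : (t₁ * t₂ * t₁) ^ 2 = upow n g.lam ω' := by rw [b12, r4]
  have q0 : t₀ ^ 2 = H * upow n g.lam (a ^ 2) * H⁻¹ := by rw [ht₀, conj_pow, hA2]
  have q0' : t₀ ^ 2 = (G * Q * E) * upow n g.lam (a ^ 2) * (G * Q * E)⁻¹ := by
    rw [ht₀', conj_pow, conj_pow, hA2]; group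
  have q1 : t₁ ^ 2 = G * upow n g.lam (b ^ 2) * G⁻¹ := by rw [ht₁, conj_pow, hB2]
  have q1' : t₁ ^ 2 = (G * Q) * upow n g.lam (b ^ 2) * (G * Q)⁻¹ := by
    rw [ht₁', conj_pow, hB2]
  have q2 : t₂ ^ 2 = upow n g.lam (c ^ 2) := by rw [ht₂, hC2]
  have hcomm02 : t₀ * t₂ = t₂ * t₀ := by
    have cc : Commute t₂ A := by
      rw [ht₂]
      exact commute_braidPow (commute_braidPow cac).symm
    have ch : Commute t₂ H := by
      rw [ht₂]
      exact (commute_braidPow cHc.symm).symm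
    rw [ht₀]
    exact ((ch.mul_right cc).mul_right ch.inv_right).symm.eq
  refine ⟨⟨b01, b12, hcomm02⟩, ⟨q0, q0'⟩, ⟨q1, q1'⟩, ⟨q2, ?_⟩, ?_, ?_, ?_, ?_⟩
  · rw [q2, conj_eq_of_commute (commute_upow (cHc.symm.pow_right 2))]
  · rw [braid_sq_mul_conj b12, s12, q2, N.upow_mul_inv hωU' hc (hωc'.pow_right 2)]
  · rw [braid_conj_mul_sq b12, s12, q1, N.upow_mul_inv hωU' hb (hωb'.pow_right 2)]
    nth_rewrite 1 [← conj_eq_of_commute (commute_upow (t := g.lam) (n := n) cωG.symm)]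
    group
  · rw [braid_sq_mul_conj b01, s01, q1', N.upow_mul_inv hωU hb (hωb.pow_right 2)]
    group
  · rw [braid_conj_mul_sq b01, s01, q0', N.upow_mul_inv hωU ha (hωa.pow_right 2), hpent]
    nth_rewrite 1 [← conj_eq_of_commute (commute_upow (t := g.lam) (n := n) cωE.symm)]
    group

end BraidAutomorphism

/-! ### The pentagon for a product -/

section MulPentagon

open PureBraid4 Braid4

variable {K : Type*} [Field K] [CharZero K] {R : Type*} [Ring R] [Algebra K R] {n : ℕ}
  (N : NilSub K R n)

theorem σ_braid_zero_one : σ 0 * σ 1 * σ 0 = σ 1 * σ 0 * σ 1 :=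
  mul_inv_eq_one.1 (PresentedGroup.one_of_mem (rels := braidRels4) (Or.inl rfl))

theorem σ_braid_one_two : σ 1 * σ 2 * σ 1 = σ 2 * σ 1 * σ 2 :=
  mul_inv_eq_one.1 (PresentedGroup.one_of_mem (rels := braidRels4) (Or.inr (Or.inl rfl)))

theorem σ_commute_zero_two : σ 0 * σ 2 = σ 2 * σ 0 :=
  mul_inv_eq_one.1 (PresentedGroup.one_of_mem (rels := braidRels4) (Or.inr (Or.inr rfl)))

theorem mul_eq_of_cocycle {Γ : Type*} [Group Γ] {L₁ L₂ R₁ R₂ R₃ f₁ f₂ f₃ f₄ f₅ H P G Q E : Γ}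
    (h₁ : L₁ = f₁ * H) (h₂ : H * L₂ = f₂ * (H * P)) (h₃ : R₁ = f₃ * G)
    (h₄ : G * R₂ = f₄ * (G * Q)) (h₅ : G * Q * R₃ = f₅ * (G * Q * E)) (h : H * P = G * Q * E)
    (hf : f₁ * f₂ = f₃ * f₄ * f₅) : L₁ * L₂ = R₁ * R₂ * R₃ := by
  rw [h₁, mul_assoc, h₂, h₃, mul_assoc f₃, h₄, mul_assoc, mul_assoc, h₅, h, ← mul_assoc, hf]
  simp only [mul_assoc]

/-- The pentagon of `f` is applied in the representation `Θ` deformed by `g`. Each factor of the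
product is a value of `f` in `Θ` times a value of `g`, up to conjugation by the preceding values of
`g`, so these telescope by the pentagon of `g`. -/
theorem unitPentagon_mul {ρ : Braid4 →* Rˣ} (hρ : ∀ b, ∀ u ∈ N.U, ρ b * u * (ρ b)⁻¹ ∈ N.U)
    (hP : ∀ β : PureBraid4, ρ β ∈ N.U) {f g : GTPair K} (hf : GTPair.IsGT f)
    (hg : GTPair.IsGT g) :
    UnitPentagon n (ρ.comp toPerm.ker.subtype) (GTPair.mul f g).ser := by
  have hpent := hg.unitPentagon (χ := ρ.comp toPerm.ker.subtype) N hP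
  set a := ρ (σ 0) with ha_def
  set b := ρ (σ 1) with hb_def
  set c := ρ (σ 2) with hc_def
  have h12 : (ρ.comp toPerm.ker.subtype) X12 = a ^ 2 := map_pow ρ _ _
  have h23 : (ρ.comp toPerm.ker.subtype) X23 = b ^ 2 := map_pow ρ _ _
  have h34 : (ρ.comp toPerm.ker.subtype) X34 = c ^ 2 := map_pow ρ _ _
  have h13 : (ρ.comp toPerm.ker.subtype) X13 = b * a ^ 2 * b⁻¹ := by
    change ρ (σ 1 * σ 0 ^ 2 * (σ 1)⁻¹) = _
    rw [map_mul, map_mul, map_inv, map_pow]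
  have h24 : (ρ.comp toPerm.ker.subtype) X24 = c * b ^ 2 * c⁻¹ := by
    change ρ (σ 2 * σ 1 ^ 2 * (σ 2)⁻¹) = _
    rw [map_mul, map_mul, map_inv, map_pow]
  have hχ : ∀ β, (ρ.comp toPerm.ker.subtype) β ∈ N.U := hP
  have ha : a ^ 2 ∈ N.U := h12 ▸ hχ X12
  have hb : b ^ 2 ∈ N.U := h23 ▸ hχ X23
  have hc : c ^ 2 ∈ N.U := h34 ▸ hχ X34
  have hba' : b * a ^ 2 * b⁻¹ ∈ N.U := hρ (σ 1) _ ha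
  have hcb' : c * b ^ 2 * c⁻¹ ∈ N.U := hρ (σ 2) _ hb
  have hba : b⁻¹ * a ^ 2 * b ∈ N.U := by simpa only [map_inv, inv_inv] using hρ (σ 1)⁻¹ _ ha
  have hcb : c⁻¹ * b ^ 2 * c ∈ N.U := by simpa only [map_inv, inv_inv] using hρ (σ 2)⁻¹ _ hb
  rw [UnitPentagon, map_mul, map_mul, map_mul, map_mul, h12, h23, h34, h13, h24] at hpent ⊢
  set G := uword n g.ser (b ^ 2) (c ^ 2) with hG
  set H := uword n g.ser (a ^ 2) (b ^ 2 * (c * b ^ 2 * c⁻¹)) with hH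
  set P := uword n g.ser (b * a ^ 2 * b⁻¹ * b ^ 2) (c ^ 2) with hPdef
  set Q := uword n g.ser (a ^ 2 * (b * a ^ 2 * b⁻¹)) (c * b ^ 2 * c⁻¹ * c ^ 2) with hQ
  set E := uword n g.ser (a ^ 2) (b ^ 2) with hE
  have hab : a * b * a = b * a * b := by
    simpa only [map_mul] using congrArg ρ σ_braid_zero_one
  have hbc : b * c * b = c * b * c := by
    simpa only [map_mul] using congrArg ρ σ_braid_one_two
  have hac : a * c = c * a := by
    simpa only [map_mul] using congrArg ρ σ_commute_zero_two
  obtain ⟨t₀, ht₀⟩ : ∃ t₀, t₀ = H * braidPow n g.lam a * H⁻¹ := ⟨_, rfl⟩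
  obtain ⟨t₁, ht₁⟩ : ∃ t₁, t₁ = G * braidPow n g.lam b * G⁻¹ := ⟨_, rfl⟩
  obtain ⟨t₂, ht₂⟩ : ∃ t₂, t₂ = braidPow n g.lam c := ⟨_, rfl⟩
  obtain ⟨⟨b01, b12, b02⟩, ⟨q0, q0'⟩, ⟨q1, q1'⟩, ⟨q2, q2'⟩, p1, p2, p3, p4⟩ :=
    hg.deformed_braid_relations N hab hbc hac ha hb hc hba hcb hba' hcb' hPdef hQ hE hG hH hpent
      ht₀ ht₁ ht₂
  let Θ : Braid4 →* Rˣ := PresentedGroup.toGroup (f := ![t₀, t₁, t₂]) (by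
    rintro r (rfl | rfl | rfl) <;> simp only [map_mul, map_inv, FreeGroup.lift_apply_of] <;>
      rw [mul_inv_eq_one]
    · exact b01
    · exact b12
    · exact b02)
  have hΘσ : ∀ i, Θ (σ i) = ![t₀, t₁, t₂] i := fun i => PresentedGroup.toGroup.of _
  have hGU : G ∈ N.U := N.uword_mem hg.groupLike.1 hb hc
  have hHU : H ∈ N.U := N.uword_mem hg.groupLike.1 ha (N.U.mul_mem hb hcb')
  have hconj : ∀ (d : Braid4) (W : Rˣ), W ∈ N.U → ρ d ^ 2 ∈ N.U →
      W * braidPow n g.lam (ρ d) * W⁻¹ * (ρ d)⁻¹ ∈ N.U := by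
    intro d W hW hd
    have : W * braidPow n g.lam (ρ d) * W⁻¹ * (ρ d)⁻¹ =
        W * (ρ d * (upow n ((g.lam - 1) / 2) (ρ d ^ 2) * W⁻¹) * (ρ d)⁻¹) := by
      rw [braidPow]; group
    rw [this]
    exact N.U.mul_mem hW (hρ _ _ (N.U.mul_mem (N.upow_mem hd _) (N.U.inv_mem hW)))
  have hgen : ∀ i, Θ (σ i) * (ρ (σ i))⁻¹ ∈ N.U := by
    intro i
    rw [hΘσ]
    fin_cases i
    · change t₀ * a⁻¹ ∈ N.U
      rw [ht₀]
      exact hconj _ _ hHU ha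
    · change t₁ * b⁻¹ ∈ N.U
      rw [ht₁]
      exact hconj _ _ hGU hb
    · change t₂ * c⁻¹ ∈ N.U
      rw [ht₂]
      have := hconj (σ 2) 1 N.U.one_mem hc
      rwa [one_mul, inv_one, mul_one] at this
  -- The deformation differs from `ρ` by unipotent units on generators, hence everywhere, since `ρ`
  -- normalises these; so pure braids stay unipotent under `Θ`.
  have hall : ∀ d, Θ d * (ρ d)⁻¹ ∈ N.U := by
    intro d
    have hd : d ∈ Subgroup.closure (Set.range (PresentedGroup.of (rels := braidRels4))) := by
      rw [PresentedGroup.closure_range_of]; trivial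
    induction hd using Subgroup.closure_induction with
    | mem x hx =>
      obtain ⟨i, rfl⟩ := hx
      exact hgen i
    | one => simp
    | mul x y _ _ hx hy =>
      have : Θ (x * y) * (ρ (x * y))⁻¹ =
          Θ x * (ρ x)⁻¹ * (ρ x * (Θ y * (ρ y)⁻¹) * (ρ x)⁻¹) := by
        rw [map_mul, map_mul]; group
      rw [this]
      exact N.U.mul_mem hx (hρ _ _ hy)
    | inv x _ hx =>
      have : Θ x⁻¹ * (ρ x⁻¹)⁻¹ = ρ x⁻¹ * (Θ x * (ρ x)⁻¹)⁻¹ * (ρ x⁻¹)⁻¹ := by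
        rw [map_inv, map_inv]; group
      rw [this]
      exact hρ _ _ (N.U.inv_mem hx)
  have hΘP : ∀ β, (Θ.comp toPerm.ker.subtype) β ∈ N.U := by
    intro β
    have := N.U.mul_mem (hall β) (hP β)
    rwa [inv_mul_cancel_right] at this
  have hfp := hf.unitPentagon N hΘP
  have k12 : (Θ.comp toPerm.ker.subtype) X12 = t₀ ^ 2 := by
    change Θ (σ 0 ^ 2) = _
    rw [map_pow, hΘσ]; rfl
  have k23 : (Θ.comp toPerm.ker.subtype) X23 = t₁ ^ 2 := by
    change Θ (σ 1 ^ 2) = _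
    rw [map_pow, hΘσ]; rfl
  have k34 : (Θ.comp toPerm.ker.subtype) X34 = t₂ ^ 2 := by
    change Θ (σ 2 ^ 2) = _
    rw [map_pow, hΘσ]; rfl
  have k13 : (Θ.comp toPerm.ker.subtype) X13 = t₁ * t₀ ^ 2 * t₁⁻¹ := by
    change Θ (σ 1 * σ 0 ^ 2 * (σ 1)⁻¹) = _
    rw [map_mul, map_mul, map_inv, map_pow, hΘσ, hΘσ]; rfl
  have k24 : (Θ.comp toPerm.ker.subtype) X24 = t₂ * t₁ ^ 2 * t₂⁻¹ := by
    change Θ (σ 2 * σ 1 ^ 2 * (σ 2)⁻¹) = _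
    rw [map_mul, map_mul, map_inv, map_pow, hΘσ, hΘσ]; rfl
  rw [UnitPentagon, map_mul, map_mul, map_mul, map_mul, k12, k23, k34, k13, k24] at hfp
  -- `W` stands for the product of the values of `g` already passed on the left.
  have hmul : ∀ {u v : Rˣ}, u ∈ N.U → v ∈ N.U → ∀ W : Rˣ,
      W * uword n (GTPair.mul f g).ser u v =
      uword n f.ser (W * uword n g.ser u v * upow n g.lam u * (W * uword n g.ser u v)⁻¹)
        (W * upow n g.lam v * W⁻¹) * (W * uword n g.ser u v) := by
    intro u v hu hv W
    rw [show W * uword n g.ser u v * upow n g.lam u * (W * uword n g.ser u v)⁻¹ =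
      W * (uword n g.ser u v * upow n g.lam u * (uword n g.ser u v)⁻¹) * W⁻¹ by group, uword_conj,
      GTPair.uword_mul_ser hf.groupLike.1 hg hu hv]
    group
  have m1 := hmul ha (N.U.mul_mem hb hcb') 1
  simp only [one_mul, inv_one, mul_one] at m1
  have m2 := hmul (N.U.mul_mem hba' hb) hc H
  have m3 := hmul hb hc 1
  simp only [one_mul, inv_one, mul_one] at m3
  have m4 := hmul (N.U.mul_mem ha hba') (N.U.mul_mem hcb' hc) G
  have m5 := hmul ha hb (G * Q)
  rw [← hH, ← q0, ← p1] at m1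
  rw [← hPdef, ← p4, ← q2'] at m2
  rw [← hG, ← q1, ← q2] at m3
  rw [← hQ, ← p2, ← p3] at m4
  rw [← hE, ← q0', ← q1'] at m5
  exact mul_eq_of_cocycle m1 m2 m3 m4 m5 hpent hfp

end MulPentagon

/-! ### Endomorphisms raising the degree of a finite filtration -/

section Filtration

variable {K : Type*} [Field K] {V : Type*} [AddCommGroup V] [Module K V]

/-- The endomorphisms which raise the degree of a filtration. -/
def degreeRaising (F : ℕ → Submodule K V) : Submodule K (Module.End K V) where
  carrier := {φ | ∀ k, ∀ x ∈ F k, φ x ∈ F (k + 1)}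
  add_mem' := fun ha hb k x hx => add_mem (ha k x hx) (hb k x hx)
  zero_mem' := fun _ _ _ => zero_mem _
  smul_mem' := fun c _ hφ k x hx => Submodule.smul_mem _ c (hφ k x hx)

theorem apply_mem_of_mem_degreeRaising_pow {F : ℕ → Submodule K V} (j : ℕ) :
    ∀ φ ∈ degreeRaising F ^ j, ∀ k, ∀ x ∈ F k, φ x ∈ F (k + j) := by
  induction j with
  | zero =>
    intro φ hφ k x hx
    rw [pow_zero, Submodule.mem_one] at hφ
    obtain ⟨c, rfl⟩ := hφ
    exact Submodule.smul_mem _ c hx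
  | succ j ih =>
    intro φ hφ
    rw [pow_succ] at hφ
    refine Submodule.mul_induction_on hφ ?_ ?_
    · intro a ha b hb k x hx
      have := ih a ha _ _ (hb k x hx)
      rwa [add_right_comm, add_assoc] at this
    · intro a b ha hb k x hx
      exact add_mem (ha k x hx) (hb k x hx)

/-- The nilpotent algebra of endomorphisms which raise the degree of a finite filtration. -/
def filtrationNil (F : ℕ → Submodule K V) (hF0 : F 0 = ⊤) (hF : ∀ k, F (k + 1) ≤ F k) {n : ℕ}
    (hFn : F (n + 1) = ⊥) : NilSub K (Module.End K V) n where
  J := degreeRaising F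
  mul_le := by
    rw [Submodule.mul_le]
    intro a ha b hb k x hx
    exact hF _ (ha _ _ (hb k x hx))
  pow_eq := by
    rw [eq_bot_iff]
    intro φ hφ
    rw [Submodule.mem_bot]
    ext x
    have := apply_mem_of_mem_degreeRaising_pow (n + 1) φ hφ 0 x (by rw [hF0]; trivial)
    rwa [zero_add, hFn, Submodule.mem_bot] at this

end Filtration

/-! ### A braid group representation faithful modulo a power of the augmentation ideal -/

section BraidModule

open PureBraid4 Braid4

variable (K : Type*) [Field K]

/-- The filtration of the group algebra by the powers of the augmentation ideal. -/
noncomputable def augFiltration : ℕ → Submodule K (MonoidAlgebra K PureBraid4)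
  -- The zeroth power of the augmentation ideal, as a subspace, would consist of the scalars only;
  -- the filtration has to start with the whole algebra.
  | 0 => ⊤
  | k + 1 => augIdeal K * augFiltration k

theorem augFiltration_succ_le (k : ℕ) : augFiltration K (k + 1) ≤ augFiltration K k := by
  induction k with
  | zero => exact le_top
  | succ k ih => exact mul_le_mul' le_rfl ih

theorem augFiltration_le_pow (k : ℕ) : augFiltration K (k + 1) ≤ augIdeal K ^ (k + 1) := by
  induction k with
  | zero =>
    rw [zero_add, pow_one, augFiltration, Submodule.mul_le]
    intro a ha b _
    rw [augIdeal, LinearMap.mem_ker] at ha ⊢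
    change MonoidAlgebra.lift K K PureBraid4 (1 : PureBraid4 →* K) a = 0 at ha
    change MonoidAlgebra.lift K K PureBraid4 (1 : PureBraid4 →* K) (a * b) = 0
    rw [map_mul, ha, zero_mul]
  | succ k ih =>
    rw [pow_succ', augFiltration]
    exact mul_le_mul' le_rfl ih

theorem of_mul_mem_augFiltration (β : PureBraid4) {k : ℕ} {r : MonoidAlgebra K PureBraid4}
    (hr : r ∈ augFiltration K k) :
    MonoidAlgebra.of K PureBraid4 β * r - r ∈ augFiltration K (k + 1) := by
  have := Submodule.mul_mem_mul (of_sub_one_mem_augIdeal (K := K) β) hr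
  rwa [sub_mul, one_mul] at this

open Classical in
/-- The restriction of an element of the group algebra of the braid group to the pure braids. -/
noncomputable def restrictPure : MonoidAlgebra K Braid4 →ₗ[K] MonoidAlgebra K PureBraid4 :=
  (Finsupp.linearCombination K fun b : Braid4 =>
    if h : b ∈ toPerm.ker then MonoidAlgebra.of K PureBraid4 ⟨b, h⟩ else 0) ∘ₗ
    (MonoidAlgebra.coeffLinearEquiv K).toLinearMap

theorem restrictPure_of (b : Braid4) (h : b ∈ toPerm.ker) :
    restrictPure K (MonoidAlgebra.of K Braid4 b) = MonoidAlgebra.of K PureBraid4 ⟨b, h⟩ := by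
  simp only [restrictPure, LinearMap.comp_apply]
  refine (Finsupp.linearCombination_single K _ _).trans ?_
  rw [dif_pos h, one_smul]

theorem restrictPure_of_notMem (b : Braid4) (h : b ∉ toPerm.ker) :
    restrictPure K (MonoidAlgebra.of K Braid4 b) = 0 := by
  simp only [restrictPure, LinearMap.comp_apply]
  refine (Finsupp.linearCombination_single K _ _).trans ?_
  rw [dif_neg h, smul_zero]

theorem restrictPure_of_mul (β : PureBraid4) (r : MonoidAlgebra K Braid4) :
    restrictPure K (MonoidAlgebra.of K Braid4 β * r) =
      MonoidAlgebra.of K PureBraid4 β * restrictPure K r := by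
  induction r using MonoidAlgebra.induction_on with
  | of b =>
    rw [← map_mul]
    by_cases h : b ∈ toPerm.ker
    · rw [restrictPure_of K b h, restrictPure_of K _ (mul_mem β.2 h), ← map_mul]
      rfl
    · rw [restrictPure_of_notMem K b h, restrictPure_of_notMem K _
        fun h' => h ((Subgroup.mul_mem_cancel_left _ β.2).1 h'), mul_zero]
  | add a b ha hb => rw [mul_add, map_add, ha, hb, map_add, mul_add]
  | smul c a ha => rw [mul_smul_comm, map_smul, ha, map_smul, mul_smul_comm]

/-- The inclusion of the group algebra of the pure braid group. -/
noncomputable def pureToBraid : MonoidAlgebra K PureBraid4 →ₐ[K] MonoidAlgebra K Braid4 :=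
  MonoidAlgebra.lift K _ PureBraid4 ((MonoidAlgebra.of K Braid4).comp toPerm.ker.subtype)

theorem pureToBraid_of (β : PureBraid4) :
    pureToBraid K (MonoidAlgebra.of K PureBraid4 β) = MonoidAlgebra.of K Braid4 β :=
  MonoidAlgebra.lift_of _ _

theorem restrictPure_pureToBraid (r : MonoidAlgebra K PureBraid4) :
    restrictPure K (pureToBraid K r) = r := by
  induction r using MonoidAlgebra.induction_on with
  | of β => rw [pureToBraid_of, restrictPure_of K _ β.2]
  | add a b ha hb => rw [map_add, map_add, ha, hb]
  | smul c a ha => rw [map_smul, map_smul, ha]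

/-- The filtration of the group algebra of the braid group induced from the powers of the
augmentation ideal of the pure braid group. -/
noncomputable def braidFiltration (k : ℕ) : Submodule K (MonoidAlgebra K Braid4) :=
  ⨅ b : Braid4, (augFiltration K k).comap
    (restrictPure K ∘ₗ LinearMap.mulLeft K (MonoidAlgebra.of K Braid4 b))

variable {K} in
theorem mem_braidFiltration {k : ℕ} {r : MonoidAlgebra K Braid4} : r ∈ braidFiltration K k ↔
    ∀ b, restrictPure K (MonoidAlgebra.of K Braid4 b * r) ∈ augFiltration K k := by
  simp [braidFiltration]

theorem of_mul_mem_braidFiltration (b : Braid4) {k : ℕ} {r : MonoidAlgebra K Braid4}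
    (hr : r ∈ braidFiltration K k) : MonoidAlgebra.of K Braid4 b * r ∈ braidFiltration K k := by
  rw [mem_braidFiltration] at hr ⊢
  intro c
  rw [← mul_assoc, ← map_mul]
  exact hr _

/-- Pure braids form a normal subgroup: left multiplication by `c` turns `β` into the pure braid `c
β c⁻¹`, which can be pulled out of the restriction and raises the degree there. -/
theorem of_mul_sub_mem_braidFiltration (β : PureBraid4) {k : ℕ} {r : MonoidAlgebra K Braid4}
    (hr : r ∈ braidFiltration K k) :
    MonoidAlgebra.of K Braid4 β * r - r ∈ braidFiltration K (k + 1) := by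
  rw [mem_braidFiltration] at hr ⊢
  intro c
  have e : MonoidAlgebra.of K Braid4 c * (MonoidAlgebra.of K Braid4 β * r - r) =
      MonoidAlgebra.of K Braid4 (c * β * c⁻¹) * (MonoidAlgebra.of K Braid4 c * r) -
        MonoidAlgebra.of K Braid4 c * r := by
    rw [mul_sub, ← mul_assoc, ← mul_assoc, ← map_mul, ← map_mul, inv_mul_cancel_right]
  have h := restrictPure_of_mul K
    ⟨c * β * c⁻¹, (MonoidHom.normal_ker toPerm).conj_mem _ β.2 c⟩ (MonoidAlgebra.of K Braid4 c * r)
  rw [e, map_sub, h]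
  exact of_mul_mem_augFiltration K _ (hr c)

/-- The action of the braid group on a quotient of its group algebra. -/
noncomputable def braidAction (n : ℕ) :
    Braid4 →* Module.End K (MonoidAlgebra K Braid4 ⧸ braidFiltration K (n + 1)) where
  toFun b := Submodule.mapQ _ _ (LinearMap.mulLeft K (MonoidAlgebra.of K Braid4 b))
    fun _ hr => of_mul_mem_braidFiltration K b hr
  map_one' := by
    ext x
    simp
  map_mul' b c := by
    refine LinearMap.ext fun x => ?_
    obtain ⟨x, rfl⟩ := Submodule.Quotient.mk_surjective _ x
    change Submodule.Quotient.mk (MonoidAlgebra.of K Braid4 (b * c) * x) = Submodule.Quotient.mk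
      (MonoidAlgebra.of K Braid4 b * (MonoidAlgebra.of K Braid4 c * x))
    rw [map_mul, mul_assoc]

/-- The induced filtration of the quotient. -/
noncomputable def quotFiltration (n k : ℕ) :
    Submodule K (MonoidAlgebra K Braid4 ⧸ braidFiltration K (n + 1)) :=
  (braidFiltration K k).map (Submodule.mkQ _)

/-- The nilpotent algebra of endomorphisms raising the degree of the quotient. -/
noncomputable def braidNil (n : ℕ) :
    NilSub K (Module.End K (MonoidAlgebra K Braid4 ⧸ braidFiltration K (n + 1))) n :=
  filtrationNil (quotFiltration K n)
    (by
      have : braidFiltration K 0 = ⊤ := by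
        rw [eq_top_iff]
        intro r _
        rw [mem_braidFiltration]
        intro b
        trivial
      rw [quotFiltration, this, Submodule.map_top, Submodule.range_mkQ])
    (fun k => Submodule.map_mono fun r hr => by
      rw [mem_braidFiltration] at hr ⊢
      exact fun b => augFiltration_succ_le K k (hr b))
    (by rw [quotFiltration, ← LinearMap.le_ker_iff_map, Submodule.ker_mkQ])

theorem braidAction_mem_quotFiltration {n k : ℕ} (b : Braid4)
    {x : MonoidAlgebra K Braid4 ⧸ braidFiltration K (n + 1)} (hx : x ∈ quotFiltration K n k) :
    braidAction K n b x ∈ quotFiltration K n k := by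
  obtain ⟨r, hr, rfl⟩ := hx
  exact ⟨_, of_mul_mem_braidFiltration K b hr, rfl⟩

/-- The action of the braid group by units. -/
noncomputable def braidUnits (n : ℕ) :
    Braid4 →* (Module.End K (MonoidAlgebra K Braid4 ⧸ braidFiltration K (n + 1)))ˣ :=
  (braidAction K n).toHomUnits

variable [CharZero K]

theorem braidUnits_conj_mem (n : ℕ) (b : Braid4) :
    ∀ u ∈ (braidNil K n).U, braidUnits K n b * u * (braidUnits K n b)⁻¹ ∈ (braidNil K n).U := by
  intro u hu
  have e : ((braidUnits K n b * u * (braidUnits K n b)⁻¹ : Units _) : Module.End K _) - 1 =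
      braidAction K n b * ((u : Module.End K _) - 1) * braidAction K n b⁻¹ := by
    have h : braidAction K n b * braidAction K n b⁻¹ = 1 := by
      rw [← map_mul, mul_inv_cancel, map_one]
    rw [← map_inv, Units.val_mul, Units.val_mul, mul_sub, sub_mul, mul_one, h]
    rfl
  rw [NilSub.mem_U, e]
  intro k x hx
  exact braidAction_mem_quotFiltration K b (hu k _ (braidAction_mem_quotFiltration K b⁻¹ hx))

theorem braidUnits_mem (n : ℕ) (β : PureBraid4) : braidUnits K n β ∈ (braidNil K n).U := by
  rw [NilSub.mem_U]
  rintro k _ ⟨r, hr, rfl⟩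
  exact ⟨_, of_mul_sub_mem_braidFiltration K β hr, rfl⟩

theorem groupAlgebraHom_braidUnits (n : ℕ) (r : MonoidAlgebra K PureBraid4)
    (x : MonoidAlgebra K Braid4) :
    groupAlgebraHom (K := K) ((braidUnits K n).comp toPerm.ker.subtype) r
        (Submodule.Quotient.mk x) = Submodule.Quotient.mk (pureToBraid K r * x) := by
  induction r using MonoidAlgebra.induction_on with
  | of β => rw [groupAlgebraHom_of, pureToBraid_of]; rfl
  | add a b ha hb => rw [map_add, LinearMap.add_apply, ha, hb, map_add, add_mul]; rfl
  | smul c a ha => rw [map_smul, LinearMap.smul_apply, ha, map_smul, smul_mul_assoc]; rfl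

/-- An operator that vanishes kills the class of `1`, which it sends to the class of `r` itself;
restriction to pure braids then recovers `r`. -/
theorem mem_pow_of_groupAlgebraHom_braidUnits_eq_zero (n : ℕ) (r : MonoidAlgebra K PureBraid4)
    (h : groupAlgebraHom (K := K) ((braidUnits K n).comp toPerm.ker.subtype) r = 0) :
    r ∈ augIdeal K ^ (n + 1) := by
  have h1 := groupAlgebraHom_braidUnits K n r 1
  rw [h, LinearMap.zero_apply, eq_comm, Submodule.Quotient.mk_eq_zero, mem_braidFiltration] at h1
  have h2 := h1 1
  rw [map_one, one_mul, mul_one, restrictPure_pureToBraid] at h2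
  exact augFiltration_le_pow K n h2

end BraidModule

namespace GTPair

open PureBraid4 Braid4

variable {K : Type*} [Field K] [CharZero K]

theorem IsGT.mul {f g : GTPair K} (hf : IsGT f) (hg : IsGT g) : IsGT (mul f g) where
  lam_ne_zero := mul_ne_zero hf.lam_ne_zero hg.lam_ne_zero
  groupLike := mul_isGroupLike hf hg
  duality := mul_duality hf hg
  hexagon := mul_hexagon hf hg
  pentagon := completedEq_pentagon (mul_isGroupLike hf hg).1 fun n =>
    ⟨_, _, _, braidNil K n, (braidUnits K n).comp toPerm.ker.subtype, braidUnits_mem K n,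
      unitPentagon_mul (braidNil K n) (braidUnits_conj_mem K n) (braidUnits_mem K n) hf hg,
      mem_pow_of_groupAlgebraHom_braidUnits_eq_zero K n⟩

theorem one_mul (g : GTPair K) : mul ⟨1, 1⟩ g = g := by
  rw [mul, subst_one]
  simp

/-- Only the powers `p ^ n > 0` enter the tangent vector, so closure under products is enough and
inverses play no role. -/
theorem IsGT.pow {g : GTPair K} (hg : IsGT g) {k : ℕ} (hk : 0 < k) : IsGT (pow g k) := by
  obtain ⟨k, rfl⟩ := Nat.exists_eq_succ_of_ne_zero hk.ne'
  induction k with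
  | zero => rwa [GTPair.pow, GTPair.pow, one_mul]
  | succ k ih => exact (ih k.succ_pos).mul hg

end GTPair

/-! ### Linearisation of the defining equations along a sequence -/

section Tangent

variable {K : Type*} [NontriviallyNormedField K]

/-- A notion of limits of sequences compatible with the algebra operations. -/
structure LimitNotion (K R : Type*) [NontriviallyNormedField K] [Ring R] [Algebra K R] where
  /-- Convergence of a sequence. -/
  Conv : (ℕ → R) → R → Prop
  add : ∀ {F G f g}, Conv F f → Conv G g → Conv (fun n => F n + G n) (f + g)
  mul : ∀ {F G f g}, Conv F f → Conv G g → Conv (fun n => F n * G n) (f * g)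
  smul : ∀ {c : ℕ → K} {c₀ F f}, Tendsto c atTop (𝓝 c₀) → Conv F f →
    Conv (fun n => c n • F n) (c₀ • f)

/-- `f` is the tangent vector `lim (F n - 1) / ε n`. -/
def LimitNotion.Tangent {R : Type*} [Ring R] [Algebra K R] (L : LimitNotion K R) (ε : ℕ → K)
    (F : ℕ → R) (f : R) : Prop :=
  L.Conv (fun n => (ε n)⁻¹ • (F n - 1)) f

/-- In `F G - 1 = (F - 1) + (G - 1) + (F - 1) (G - 1)` the last term is of second order in `ε`. -/
theorem LimitNotion.Tangent.mul {R : Type*} [Ring R] [Algebra K R] {L : LimitNotion K R}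
    {ε : ℕ → K} (hε : Tendsto ε atTop (𝓝 0)) (hε0 : ∀ n, ε n ≠ 0) {F G : ℕ → R} {f g : R}
    (hF : L.Tangent ε F f) (hG : L.Tangent ε G g) :
    L.Tangent ε (fun n => F n * G n) (f + g) := by
  have h := L.add (L.add hF hG) (L.smul hε (L.mul hF hG))
  rw [zero_smul, add_zero] at h
  have e : (fun n => (ε n)⁻¹ • (F n - 1) + (ε n)⁻¹ • (G n - 1) +
      ε n • ((ε n)⁻¹ • (F n - 1) * (ε n)⁻¹ • (G n - 1))) =
      fun n => (ε n)⁻¹ • (F n * G n - 1) := by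
    funext n
    rw [smul_mul_smul_comm, smul_smul, mul_inv_cancel_left₀ (hε0 n), ← smul_add, ← smul_add]
    congr 1
    noncomm_ring
  rw [LimitNotion.Tangent, ← e]
  exact h

/-- Coefficientwise convergence of series. -/
def seriesLimit (K : Type*) [NontriviallyNormedField K] : LimitNotion K (NCSeries K) where
  Conv F f := ∀ w, Tendsto (fun n => F n w) atTop (𝓝 (f w))
  add hF hG w := (hF w).add (hG w)
  mul hF hG _ := tendsto_finsetSum _ fun _ _ => (hF _).mul (hG _)
  smul hc hF w := hc.mul (hF w)

/-- Convergence of sequences which lie in a finite-dimensional subspace. -/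
inductive FinConv {R : Type*} [Ring R] [Algebra K R] : (ℕ → R) → R → Prop
  | smul {c : ℕ → K} {c₀ : K} (r : R) : Tendsto c atTop (𝓝 c₀) →
      FinConv (fun n => c n • r) (c₀ • r)
  | add {F G : ℕ → R} {f g : R} : FinConv F f → FinConv G g →
      FinConv (fun n => F n + G n) (f + g)

theorem FinConv.sum {R : Type*} [Ring R] [Algebra K R] {ι : Type*} (s : Finset ι)
    {c : ι → ℕ → K} {c₀ : ι → K} (h : ∀ i, Tendsto (c i) atTop (𝓝 (c₀ i))) (r : ι → R) :
    FinConv (K := K) (fun n => ∑ i ∈ s, c i n • r i) (∑ i ∈ s, c₀ i • r i) := by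
  classical
  induction s using Finset.induction_on with
  | empty =>
    have := FinConv.smul (K := K) (0 : R) (tendsto_const_nhds (x := (0 : K)))
    simpa using this
  | insert i s hi ih =>
    simp only [Finset.sum_insert hi]
    exact (FinConv.smul _ (h i)).add ih

/-- Convergence of sequences in finite-dimensional subspaces as a notion of limit. -/
def finLimit (K R : Type*) [NontriviallyNormedField K] [Ring R] [Algebra K R] :
    LimitNotion K R where
  Conv := FinConv (K := K)
  add := FinConv.add
  smul {c c₀ F f} hc hF := by
    induction hF with
    | smul r h => simpa only [smul_smul] using FinConv.smul r (hc.mul h)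
    | add _ _ h₁ h₂ => simpa only [smul_add] using h₁.add h₂
  mul {F G f g} hF hG := by
    induction hF with
    | smul r h =>
      induction hG with
      | smul r' h' => simpa only [smul_mul_smul_comm] using FinConv.smul (r * r') (h.mul h')
      | add _ _ h₁ h₂ => simpa only [mul_add] using h₁.add h₂
    | add _ _ h₁ h₂ => simpa only [add_mul] using h₁.add h₂

theorem FinConv.tendsto {R : Type*} [Ring R] [Algebra K R] {F : ℕ → R} {f : R}
    (h : FinConv (K := K) F f) (l : R →ₗ[K] K) :
    Tendsto (fun n => l (F n)) atTop (𝓝 (l f)) := by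
  induction h with
  | smul r h => simpa only [map_smul, smul_eq_mul] using h.mul_const (l r)
  | add _ _ h₁ h₂ => simpa only [map_add] using h₁.add h₂

/-- Every subspace is closed under this convergence, because a vector outside it is detected by a
linear form vanishing on it. Thus congruences modulo powers of the augmentation ideal pass to the
limit without a topology on the group algebra. -/
theorem sub_mem_of_finConv {R : Type*} [Ring R] [Algebra K R] {F G : ℕ → R} {f g : R}
    (hF : FinConv (K := K) F f) (hG : FinConv (K := K) G g) (S : Submodule K R)
    (h : ∀ n, F n - G n ∈ S) : f - g ∈ S := by
  by_contra hn
  obtain ⟨l, hl, hS⟩ := Submodule.exists_le_ker_of_notMem hn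
  refine hl ?_
  rw [map_sub, sub_eq_zero]
  refine tendsto_nhds_unique (hF.tendsto l) ?_
  refine (hG.tendsto l).congr fun n => ?_
  have := hS (h n)
  rw [LinearMap.mem_ker, map_sub, sub_eq_zero] at this
  exact this.symm

variable {ε : ℕ → K}

theorem tangent_subst {F : ℕ → NCSeries K} {f : NCSeries K}
    (hF : (seriesLimit K).Tangent ε F f) (a b : NCSeries K) :
    (seriesLimit K).Tangent ε (fun n => subst (F n) a b) (subst f a b) := by
  intro w
  have e : ∀ n, ((ε n)⁻¹ • (subst (F n) a b - 1)) = subst ((ε n)⁻¹ • (F n - 1)) a b := by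
    intro n
    rw [subst_smul, subst_sub, subst_one]
  simp only [e]
  change Tendsto (fun n => evalTrunc w.length ((ε n)⁻¹ • (F n - 1)) a b w) atTop
    (𝓝 (evalTrunc w.length f a b w))
  simp only [evalTrunc_eq_sum, NCSeries.sum_apply, NCSeries.smul_apply]
  exact tendsto_finsetSum _ fun v _ => (hF v).mul_const _

theorem finConv_evalTrunc {R : Type*} [Ring R] [Algebra K R] {F : ℕ → NCSeries K} {f : NCSeries K}
    (hF : (seriesLimit K).Conv F f) (n : ℕ) (a b : R) :
    FinConv (K := K) (fun k => evalTrunc n (F k) a b) (evalTrunc n f a b) := by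
  simp only [evalTrunc_eq_sum]
  exact FinConv.sum _ hF _

theorem tangent_evalTrunc {R : Type*} [Ring R] [Algebra K R] {F : ℕ → NCSeries K} {f : NCSeries K}
    (hF : (seriesLimit K).Tangent ε F f) (n : ℕ) (a b : R) :
    (finLimit K R).Tangent ε (fun k => evalTrunc n (F k) a b) (evalTrunc n f a b) := by
  have := finConv_evalTrunc hF n a b
  simp only [evalTrunc_smul, evalTrunc_sub, evalTrunc_one] at this
  exact this

theorem tangent_exp {c : ℕ → K} {c₀ : K} (hε : Tendsto ε atTop (𝓝 0)) (hε0 : ∀ n, ε n ≠ 0)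
    (hc : Tendsto (fun n => c n / ε n) atTop (𝓝 c₀)) {a : NCSeries K} (ha : a [] = 0) :
    (seriesLimit K).Tangent ε (fun n => NCSeries.exp (c n • a)) (c₀ • a) := by
  have hc0 : Tendsto c atTop (𝓝 0) := by
    have := hc.mul hε
    rw [mul_zero] at this
    exact this.congr fun n => div_mul_cancel₀ _ (hε0 n)
  intro w
  have e : ∀ n, ((ε n)⁻¹ • (NCSeries.exp (c n • a) - 1)) w =
      ∑ k ∈ Finset.range w.length, (c n / ε n) * c n ^ k * (((k + 1).factorial : K)⁻¹ *
        (a ^ (k + 1) : NCSeries K) w) := by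
    intro n
    change (ε n)⁻¹ * (∑ k ∈ Finset.range (w.length + 1), _ - (1 : NCSeries K) w) = _
    rw [Finset.sum_range_succ']
    simp only [smul_pow, NCSeries.smul_apply, pow_zero, Nat.factorial_zero, Nat.cast_one, inv_one,
      one_mul, add_sub_cancel_right, Finset.mul_sum]
    refine Finset.sum_congr rfl fun k _ => ?_
    rw [pow_succ' (c n), div_eq_mul_inv]
    ring
  have e' : (c₀ • a) w = ∑ k ∈ Finset.range w.length, c₀ * 0 ^ k * (((k + 1).factorial : K)⁻¹ *
        (a ^ (k + 1) : NCSeries K) w) := by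
    rcases h : w.length with _ | m
    · rw [List.length_eq_zero_iff.1 h, NCSeries.smul_apply, ha]
      simp
    · rw [Finset.sum_range_succ']
      simp [NCSeries.smul_apply]
  simp only [e, e']
  exact tendsto_finsetSum _ fun k _ => (hc.mul (hc0.pow k)).mul_const _

theorem isLieSeries_of_tangent [CharZero K] {F : ℕ → NCSeries K} {f : NCSeries K}
    (hε : Tendsto ε atTop (𝓝 0)) (hε0 : ∀ n, ε n ≠ 0) (hF : (seriesLimit K).Tangent ε F f)
    (hG : ∀ n, IsGroupLike (F n)) : IsLieSeries f := by
  have hone : ∀ (u v : List (Fin 2)), u ≠ [] → v ≠ [] → coproduct (1 : NCSeries K) u v = 0 := by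
    intro u v hu hv
    have h1 : tl 0 (1 : NCSeries K) = 0 := rfl
    have h2 : tl 1 (1 : NCSeries K) = 0 := rfl
    have h3 : ∀ a, tl a (1 : NCSeries K) = 0 := fun a => by fin_cases a; exacts [h1, h2]
    have h4 : ∀ u v, coproduct (0 : NCSeries K) u v = 0 := fun u v =>
      List.sum_eq_zero fun x hx => by
        obtain ⟨w, _, rfl⟩ := List.mem_map.1 hx
        rfl
    obtain ⟨a, u, rfl⟩ := List.exists_cons_of_ne_nil hu
    obtain ⟨b, v, rfl⟩ := List.exists_cons_of_ne_nil hv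
    rw [coproduct_cons_cons, h3, h3, h4, h4, add_zero]
  refine isLieSeries_of_primitive f ?_ fun u v hu hv => ?_
  · refine tendsto_nhds_unique (hF []) (tendsto_const_nhds.congr fun n => ?_)
    change (0 : K) = (ε n)⁻¹ * (F n [] - (1 : NCSeries K) [])
    rw [(hG n).1, one_apply, if_pos rfl, sub_self, mul_zero]
  · have hlin : ∀ (l : List (List (Fin 2))) (G : ℕ → List (Fin 2) → K) (g : List (Fin 2) → K),
        (∀ w, Tendsto (fun n => G n w) atTop (𝓝 (g w))) →
        Tendsto (fun n => (l.map (G n)).sum) atTop (𝓝 (l.map g).sum) := by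
      intro l G g hG
      induction l with
      | nil => exact tendsto_const_nhds
      | cons w l ih => simpa only [List.map_cons, List.sum_cons] using (hG w).add ih
    have h1 : Tendsto (fun n => coproduct ((ε n)⁻¹ • (F n - 1)) u v) atTop (𝓝 (coproduct f u v)) :=
      hlin _ _ _ hF
    -- For non-empty words, group-likeness makes the coproduct coefficient of `(F n - 1) / ε n`
    -- equal to `ε n` times a product of two convergent coefficients.
    have h2 := hε.mul ((hF u).mul (hF v))
    rw [zero_mul] at h2
    refine tendsto_nhds_unique h1 (h2.congr fun n => ?_)
    have hlin' : ∀ (l : List (List (Fin 2))) (c : K) (f g : List (Fin 2) → K),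
        (l.map fun w => c * (f w - g w)).sum = c * ((l.map f).sum - (l.map g).sum) := by
      intro l c f g
      induction l with
      | nil => exact (by ring : (0 : K) = c * (0 - 0))
      | cons w l ih => simp only [List.map_cons, List.sum_cons, ih]; ring
    have hl : coproduct ((ε n)⁻¹ • (F n - 1)) u v =
        (ε n)⁻¹ * (coproduct (F n) u v - coproduct (1 : NCSeries K) u v) := hlin' _ _ _ _
    have hval : ∀ w : List (Fin 2), w ≠ [] →
        ((ε n)⁻¹ • (F n - 1)) w = (ε n)⁻¹ * F n w := by
      intro w hw
      change (ε n)⁻¹ * (F n w - (1 : NCSeries K) w) = _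
      rw [one_apply, if_neg hw, sub_zero]
    change ε n * (((ε n)⁻¹ • (F n - 1)) u * ((ε n)⁻¹ • (F n - 1)) v) = _
    rw [hl, hone u v hu hv, sub_zero, (hG n).2, hval u hu, hval v hv]
    have := hε0 n
    field_simp

/-- Each equation equates products of factors tending to `1`, whose tangent vectors add up;
uniqueness of limits then gives the linear equation. -/
theorem GTPair.isGTLie_of_tangent [CharZero K] {G : ℕ → GTPair K} {s : K} {f : NCSeries K}
    (hε : Tendsto ε atTop (𝓝 0)) (hε0 : ∀ n, ε n ≠ 0) (hG : ∀ n, GTPair.IsGT (G n))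
    (hs : Tendsto (fun n => ((G n).lam - 1) / ε n) atTop (𝓝 s))
    (hf : (seriesLimit K).Tangent ε (fun n => (G n).ser) f) : GTPair.IsGTLie s f := by
  have huniq : ∀ {F : ℕ → NCSeries K} {g : NCSeries K}, (∀ n, F n = 1) →
      (seriesLimit K).Tangent ε F g → g = 0 := by
    intro F g h1 hF
    funext w
    refine tendsto_nhds_unique (hF w) (tendsto_const_nhds.congr fun n => ?_)
    change (0 : K) = (ε n)⁻¹ * (F n w - (1 : NCSeries K) w)
    rw [h1 n, sub_self, mul_zero]
  have hs2 : Tendsto (fun n => (((G n).lam - 1) / 2) / ε n) atTop (𝓝 (s / 2)) :=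
    (hs.div_const 2).congr fun n => by ring
  refine ⟨isLieSeries_of_tangent hε hε0 hf fun n => (hG n).groupLike, ?_, ?_, ?_⟩
  · have := huniq (fun n => (hG n).duality) (hf.mul hε hε0 (tangent_subst hf Y X))
    exact eq_neg_of_add_eq_zero_left this
  · have h := (((((tangent_subst hf Z X).mul hε hε0 (tangent_exp hε hε0 hs2 Z_nil)).mul hε hε0
      (tangent_subst hf Y Z)).mul hε hε0 (tangent_exp hε hε0 hs2 Y_nil)).mul hε hε0 hf).mul hε hε0
      (tangent_exp hε hε0 hs2 X_nil)
    rw [← huniq (fun n => (hG n).hexagon) h, smul_add, smul_add]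
    abel
  · intro n
    have t := fun β γ => tangent_evalTrunc hf n
      (logTrunc K n (MonoidAlgebra.of K PureBraid4 β))
      (logTrunc K n (MonoidAlgebra.of K PureBraid4 γ))
    refine sub_mem_of_finConv ((t _ _).mul hε hε0 (t _ _))
      (((t _ _).mul hε hε0 (t _ _)).mul hε hε0 (t _ _)) _ fun k => ?_
    rw [← smul_sub, sub_sub_sub_cancel_right]
    exact Submodule.smul_mem _ _ ((hG k).pentagon n)

end Tangent

/-! ### Exponential and logarithm of non-commutative series -/

namespace NCSeries

variable {K : Type*} [Field K] [CharZero K]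

theorem toShift_exp (n : ℕ) {p : NCSeries K} (hp : p [] = 0) :
    toShift K n (NCSeries.exp p) = expTrunc (K := K) n (toShift K n p) :=
  (shiftNil K n).evalTrunc_exp (shiftLeft_mem n 0) (shiftLeft_mem n 1) hp

theorem toShift_log (n : ℕ) {p : NCSeries K} (hp : p [] = 1) :
    toShift K n (NCSeries.log p) = logTrunc K n (toShift K n p) :=
  (shiftNil K n).evalTrunc_log (shiftLeft_mem n 0) (shiftLeft_mem n 1) hp

theorem toShift_sub_one_mem (n : ℕ) {p : NCSeries K} (hp : p [] = 1) :
    toShift K n p - 1 ∈ (shiftNil K n).J := by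
  rw [← map_one (toShift K n), ← map_sub]
  refine toShift_mem ?_ n
  change p [] - 1 = 0
  rw [hp, sub_self]

theorem subst_exp {p a b : NCSeries K} (hp : p [] = 0) (ha : a [] = 0) (hb : b [] = 0) :
    subst (NCSeries.exp p) a b = NCSeries.exp (subst p a b) :=
  NCSeries.ext_toShift fun n => by
    rw [toShift_subst _ _ ha hb, (shiftNil K n).evalTrunc_exp (toShift_mem ha n)
      (toShift_mem hb n) hp, toShift_exp n (by rw [subst_nil, hp]), toShift_subst _ _ ha hb]

theorem subst_log {p a b : NCSeries K} (hp : p [] = 1) (ha : a [] = 0) (hb : b [] = 0) :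
    subst (NCSeries.log p) a b = NCSeries.log (subst p a b) :=
  NCSeries.ext_toShift fun n => by
    rw [toShift_subst _ _ ha hb, (shiftNil K n).evalTrunc_log (toShift_mem ha n)
      (toShift_mem hb n) hp, toShift_log n (by rw [subst_nil, hp]), toShift_subst _ _ ha hb]

theorem exp_log {p : NCSeries K} (hp : p [] = 1) : NCSeries.exp (NCSeries.log p) = p :=
  NCSeries.ext_toShift fun n => by
    rw [toShift_exp n (log_nil p), toShift_log n hp,
      (shiftNil K n).expTrunc_logTrunc (toShift_sub_one_mem n hp)]

theorem log_exp {p : NCSeries K} (hp : p [] = 0) : NCSeries.log (NCSeries.exp p) = p :=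
  NCSeries.ext_toShift fun n => by
    rw [toShift_log n (exp_nil p), toShift_exp n hp,
      (shiftNil K n).logTrunc_expTrunc (toShift_mem hp n)]

theorem exp_add_smul {p : NCSeries K} (hp : p [] = 0) (s t : K) :
    NCSeries.exp ((s + t) • p) = NCSeries.exp (s • p) * NCSeries.exp (t • p) :=
  NCSeries.ext_toShift fun n => by
    rw [map_mul, toShift_exp n (NCSeries.smul_nil hp _), toShift_exp n (NCSeries.smul_nil hp _),
      toShift_exp n (NCSeries.smul_nil hp _), add_smul, map_add, (shiftNil K n).expTrunc_add
      (toShift_mem (NCSeries.smul_nil hp _) n) (toShift_mem (NCSeries.smul_nil hp _) n)]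
    rw [map_smul, map_smul]
    exact ((Commute.refl _).smul_left s).smul_right t

theorem exp_zero : NCSeries.exp (0 : NCSeries K) = 1 :=
  NCSeries.ext_toShift fun n => by
    rw [toShift_exp n rfl, map_zero, expTrunc_zero, map_one]

theorem exp_nat_mul_smul {p : NCSeries K} (hp : p [] = 0) (m : ℕ) (t : K) :
    NCSeries.exp (((m : K) * t) • p) = NCSeries.exp (t • p) ^ m := by
  induction m with
  | zero => rw [Nat.cast_zero, zero_mul, zero_smul, exp_zero, pow_zero]
  | succ m ih => rw [Nat.cast_succ, add_mul, one_mul, exp_add_smul hp, ih, pow_succ]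

theorem exp_conj {f f' p : NCSeries K} (h : f * f' = 1) (h' : f' * f = 1) (hp : p [] = 0) :
    NCSeries.exp (f * p * f') = f * NCSeries.exp p * f' :=
  NCSeries.ext_toShift fun n => by
    have hp' : (f * p * f') [] = 0 := by rw [mul_nil, mul_nil, hp, mul_zero, zero_mul]
    have hsemi : SemiconjBy (toShift K n f) (toShift K n p) (toShift K n (f * p * f')) := by
      rw [SemiconjBy, ← map_mul, ← map_mul, mul_assoc (f * p), h', mul_one]
    have := (SemiconjBy.expTrunc (K := K) hsemi n).eq
    rw [map_mul, map_mul, toShift_exp n hp, toShift_exp n hp', this,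
      mul_assoc (expTrunc n _), ← map_mul (toShift K n) f f', h,
      map_one, mul_one]

end NCSeries

/-- `‖F w‖ * r ^ |w| ≤ c` for all words `w`. -/
def GaussBound {K : Type*} [Norm K] (r c : ℝ) (F : NCSeries K) : Prop :=
  ∀ w : List (Fin 2), ‖F w‖ * r ^ w.length ≤ c

/-! ### Gauss norms of series over an ultrametric field -/

namespace GaussBound

variable {K : Type*} [NontriviallyNormedField K] [IsUltrametricDist K] {r c d : ℝ}
  {F G : NCSeries K}

theorem nonneg (hF : GaussBound r c F) : 0 ≤ c := by
  have := hF []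
  rw [List.length_nil, pow_zero, mul_one] at this
  exact (norm_nonneg _).trans this

theorem mono (hF : GaussBound r c F) (h : c ≤ d) : GaussBound r d F := fun w => (hF w).trans h

theorem zero (hc : 0 ≤ c) : GaussBound r c (0 : NCSeries K) := fun w => by
  change ‖(0 : K)‖ * _ ≤ c
  simpa using hc

theorem add (hr : 0 ≤ r) (hF : GaussBound r c F) (hG : GaussBound r c G) :
    GaussBound r c (F + G) := fun w => by
  change ‖F w + G w‖ * _ ≤ c
  have h := IsUltrametricDist.norm_add_le_max (F w) (G w)
  calc _ ≤ max ‖F w‖ ‖G w‖ * r ^ w.length := by gcongr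
    _ ≤ c := by
      rcases max_choice ‖F w‖ ‖G w‖ with h | h <;> rw [h]
      exacts [hF w, hG w]

theorem smul (hF : GaussBound r c F) (a : K) : GaussBound r (‖a‖ * c) (a • F) := fun w => by
  change ‖a * F w‖ * _ ≤ _
  rw [norm_mul, mul_assoc]
  exact mul_le_mul_of_nonneg_left (hF w) (norm_nonneg a)

theorem neg (hF : GaussBound r c F) : GaussBound r c (-F) := fun w => by
  change ‖-F w‖ * _ ≤ _
  rw [norm_neg]
  exact hF w

theorem sub (hr : 0 ≤ r) (hF : GaussBound r c F) (hG : GaussBound r c G) :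
    GaussBound r c (F - G) := by
  rw [sub_eq_add_neg]
  exact add hr hF hG.neg

theorem sum (hr : 0 ≤ r) (hc : 0 ≤ c) {ι : Type*} (s : Finset ι) {H : ι → NCSeries K}
    (h : ∀ i ∈ s, GaussBound r c (H i)) : GaussBound r c (∑ i ∈ s, H i) :=
  Finset.sum_induction H (GaussBound r c) (fun _ _ => add hr) (zero hc) h

theorem mul (hr : 0 ≤ r) (hF : GaussBound r c F) (hG : GaussBound r d G) :
    GaussBound r (c * d) (F * G) := fun w => by
  have hcd : 0 ≤ c * d := mul_nonneg hF.nonneg hG.nonneg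
  rw [mul_apply]
  have h := IsUltrametricDist.exists_norm_finsetSum_le (Finset.range (w.length + 1))
    (fun i => F (w.take i) * G (w.drop i))
  obtain ⟨i, hi, h⟩ := h
  have hi' : i < w.length + 1 := Finset.mem_range.1 (hi ⟨0, by simp⟩)
  have e : r ^ w.length = r ^ (w.take i).length * r ^ (w.drop i).length := by
    rw [← pow_add, ← List.length_append, List.take_append_drop]
  calc _ ≤ ‖F (w.take i) * G (w.drop i)‖ * r ^ w.length := by gcongr
    _ = (‖F (w.take i)‖ * r ^ (w.take i).length) * (‖G (w.drop i)‖ * r ^ (w.drop i).length) := by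
      rw [norm_mul, e]; ring
    _ ≤ c * d := mul_le_mul (hF _) (hG _) (by positivity) hF.nonneg

theorem one (r : ℝ) : GaussBound r 1 (1 : NCSeries K) := fun w => by
  rw [one_apply]
  split_ifs with h
  · rw [h]; simp
  · simp

theorem pow (hr : 0 ≤ r) (hF : GaussBound r c F) (k : ℕ) : GaussBound r (c ^ k) (F ^ k) := by
  induction k with
  | zero => simpa using one r
  | succ k ih => rw [pow_succ, pow_succ]; exact ih.mul hr hF

theorem of_letter (hr : 0 ≤ r) (a : Fin 2) :
    GaussBound r r (fun w => if w = [a] then (1 : K) else 0 : NCSeries K) := fun w => by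
  by_cases h : w = [a]
  · simp [h]
  · simp [h, hr]

theorem X (hr : 0 ≤ r) : GaussBound r r (NCSeries.X : NCSeries K) := of_letter hr 0

theorem Y (hr : 0 ≤ r) : GaussBound r r (NCSeries.Y : NCSeries K) := of_letter hr 1

theorem of_integral {k : ℕ} (hr : 0 ≤ r) (hr1 : r ≤ 1) (hF : GaussBound 1 1 F)
    (h : ∀ w : List (Fin 2), w.length < k → F w = 0) : GaussBound r (r ^ k) F := fun w => by
  by_cases hw : w.length < k
  · rw [h w hw]; simp; positivity
  · have h1 := hF w
    rw [one_pow, mul_one] at h1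
    calc _ ≤ 1 * r ^ k := mul_le_mul h1 (pow_le_pow_of_le_one hr hr1 (not_lt.1 hw))
          (by positivity) zero_le_one
      _ = _ := one_mul _

theorem wordProd {a b : NCSeries K} (hr : 0 ≤ r) (ha : GaussBound r r a) (hb : GaussBound r r b)
    (w : List (Fin 2)) : GaussBound r (r ^ w.length) (NCSeries.wordProd a b w) := by
  induction w with
  | nil => simpa [wordProd_nil] using one r
  | cons i w ih =>
    rw [wordProd_cons, List.length_cons, pow_succ']
    refine GaussBound.mul hr ?_ ih
    fin_cases i
    exacts [ha, hb]

/-- Letters are exchanged one at a time, and the ultrametric inequality prevents the errors from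
accumulating. Consequently a substitution close to the identity changes any series by a relatively
small amount. -/
theorem wordProd_sub {a b : NCSeries K} (hr : 0 ≤ r) (ha : GaussBound r r a)
    (hb : GaussBound r r b) {q : ℝ} (ha' : GaussBound r (q * r) (a - NCSeries.X))
    (hb' : GaussBound r (q * r) (b - NCSeries.Y)) (hq : 0 ≤ q) (w : List (Fin 2)) :
    GaussBound r (q * r ^ w.length) (NCSeries.wordProd a b w -
      NCSeries.wordProd NCSeries.X NCSeries.Y w) := by
  induction w with
  | nil =>
    rw [wordProd_nil, wordProd_nil, sub_self]
    exact zero (by simpa using hq)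
  | cons i w ih =>
    have key : ∀ {u v : NCSeries K}, GaussBound r r u → GaussBound r (q * r) (u - v) →
        GaussBound r (q * r ^ (i :: w).length) (u * NCSeries.wordProd a b w -
          v * NCSeries.wordProd NCSeries.X NCSeries.Y w) := by
      intro u v hu huv
      have e : u * NCSeries.wordProd a b w - v * NCSeries.wordProd NCSeries.X NCSeries.Y w =
          u * (NCSeries.wordProd a b w - NCSeries.wordProd NCSeries.X NCSeries.Y w) +
          (u - v) * NCSeries.wordProd NCSeries.X NCSeries.Y w := by noncomm_ring
      rw [e, List.length_cons, pow_succ']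
      refine GaussBound.add hr ((hu.mul hr ih).mono (by linarith)) ?_
      exact (huv.mul hr (wordProd hr (X hr) (Y hr) w)).mono (by linarith)
    rw [wordProd_cons, wordProd_cons]
    fin_cases i
    exacts [key ha ha', key hb hb']

theorem subst {a b : NCSeries K} (hr : 0 ≤ r) (ha : GaussBound r r a) (hb : GaussBound r r b)
    (hF : GaussBound r c F) : GaussBound r c (NCSeries.subst F a b) := fun w => by
  have h : GaussBound r c (evalTrunc w.length F a b) := by
    rw [evalTrunc_eq_sum]
    refine sum hr hF.nonneg _ fun v _ => ?_
    refine ((wordProd hr ha hb v).smul (F v)).mono (hF v)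
  exact h w

theorem subst_sub {a b : NCSeries K} (hr : 0 ≤ r) (ha : GaussBound r r a)
    (hb : GaussBound r r b) {q : ℝ} (ha' : GaussBound r (q * r) (a - NCSeries.X))
    (hb' : GaussBound r (q * r) (b - NCSeries.Y)) (hq : 0 ≤ q) (hF : GaussBound r c F) :
    GaussBound r (q * c) (NCSeries.subst F a b - F) := fun w => by
  have h : GaussBound r (q * c) (evalTrunc w.length F a b -
      evalTrunc w.length F NCSeries.X NCSeries.Y) := by
    rw [evalTrunc_eq_sum, evalTrunc_eq_sum, ← Finset.sum_sub_distrib]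
    refine sum hr (mul_nonneg hq hF.nonneg) _ fun v _ => ?_
    rw [← smul_sub]
    refine ((wordProd_sub hr ha hb ha' hb' hq v).smul (F v)).mono ?_
    calc _ = q * (‖F v‖ * r ^ v.length) := by ring
      _ ≤ q * c := mul_le_mul_of_nonneg_left (hF v) hq
  have h2 := h w
  have e : NCSeries.subst F NCSeries.X NCSeries.Y w =
    evalTrunc w.length F NCSeries.X NCSeries.Y w := rfl
  rw [subst_X_Y] at e
  change ‖evalTrunc w.length F a b w - F w‖ * _ ≤ _
  rw [e]
  exact h2

end GaussBound

/-! ### Right translation as a linear operator in the coordinates `x̂`, `ŷ` -/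

section HatCoordinates

variable {K : Type*} [Field K]

/-- The series `F(e ^ x - 1, e ^ y - 1)`. -/
noncomputable def hatSeries (F : NCSeries K) : NCSeries K :=
  subst F (NCSeries.exp X - 1) (NCSeries.exp Y - 1)

/-- The power `(1 + P) ^ t`. -/
noncomputable def onePlusPow (t : K) (P : NCSeries K) : NCSeries K :=
  NCSeries.exp (t • NCSeries.log (1 + P))

variable [CharZero K]

theorem sub_one_nil {F : NCSeries K} (hF : F [] = 1) : (F - 1) [] = 0 := by
  change F [] - 1 = 0
  rw [hF, sub_self]

theorem one_add_nil {P : NCSeries K} (hP : P [] = 0) : (1 + P) [] = 1 := by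
  change 1 + P [] = 1
  rw [hP, add_zero]

theorem onePlusPow_nil (t : K) (P : NCSeries K) : onePlusPow t P [] = 1 := exp_nil _

theorem onePlusPow_one {P : NCSeries K} (hP : P [] = 0) : onePlusPow 1 P = 1 + P := by
  rw [onePlusPow, one_smul, exp_log (one_add_nil hP)]

theorem onePlusPow_add (s t : K) (P : NCSeries K) :
    onePlusPow (s + t) P = onePlusPow s P * onePlusPow t P :=
  exp_add_smul (log_nil _) s t

theorem onePlusPow_nat_mul (m : ℕ) (t : K) (P : NCSeries K) :
    onePlusPow (m * t) P = onePlusPow t P ^ m :=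
  exp_nat_mul_smul (log_nil _) m t

theorem hatSeries_mul (F G : NCSeries K) : hatSeries (F * G) = hatSeries F * hatSeries G :=
  subst_mul (sub_one_nil (exp_nil X)) (sub_one_nil (exp_nil Y)) F G

theorem subst_onePlusPow {P a b : NCSeries K} (hP : P [] = 0) (ha : a [] = 0) (hb : b [] = 0)
    (t : K) : subst (onePlusPow t P) a b = onePlusPow t (subst P a b) := by
  rw [onePlusPow, subst_exp (NCSeries.smul_nil (log_nil _) t) ha hb, subst_smul,
    subst_log (one_add_nil hP) ha hb, subst_add, subst_one, onePlusPow]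

theorem onePlusPow_exp_sub_one {P : NCSeries K} (hP : P [] = 0) (t : K) :
    onePlusPow t (NCSeries.exp P - 1) = NCSeries.exp (t • P) := by
  rw [onePlusPow, add_sub_cancel, log_exp hP]

theorem hatSeries_onePlusPow_X (t : K) : hatSeries (onePlusPow t X) = NCSeries.exp (t • X) := by
  rw [hatSeries, subst_onePlusPow X_nil (sub_one_nil (exp_nil X)) (sub_one_nil (exp_nil Y)),
    subst_X (sub_one_nil (exp_nil X)) (sub_one_nil (exp_nil Y)), onePlusPow_exp_sub_one X_nil]

theorem hatSeries_onePlusPow_Y (t : K) : hatSeries (onePlusPow t Y) = NCSeries.exp (t • Y) := by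
  rw [hatSeries, subst_onePlusPow Y_nil (sub_one_nil (exp_nil X)) (sub_one_nil (exp_nil Y)),
    subst_Y (sub_one_nil (exp_nil X)) (sub_one_nil (exp_nil Y)), onePlusPow_exp_sub_one Y_nil]

theorem subst_hatSeries (F : NCSeries K) {a b : NCSeries K} (ha : a [] = 0) (hb : b [] = 0) :
    subst (hatSeries F) a b = subst F (NCSeries.exp a - 1) (NCSeries.exp b - 1) := by
  rw [hatSeries, subst_subst (sub_one_nil (exp_nil X)) (sub_one_nil (exp_nil Y)) ha hb, subst_sub,
    subst_sub, subst_one, subst_exp X_nil ha hb, subst_exp Y_nil ha hb, subst_X ha hb,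
    subst_Y ha hb]

/-- The image of `x̂` under the endomorphism given by `(t, F)`. -/
noncomputable def hatTwistX (t : K) (F : NCSeries K) : NCSeries K :=
  F * (onePlusPow t X - 1) * subst F Y X

theorem hatTwistX_nil (t : K) (F : NCSeries K) : hatTwistX t F [] = 0 := by
  rw [hatTwistX, mul_nil, mul_nil, sub_one_nil (onePlusPow_nil t X), mul_zero, zero_mul]

/-- Right translation in the coordinates `x̂`, `ŷ`. -/
noncomputable def hatTranslation (t : K) (F : NCSeries K) : NCSeries K →ₗ[K] NCSeries K where
  toFun H := subst H (hatTwistX t F) (onePlusPow t Y - 1) * F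
  map_add' G H := by rw [subst_add, add_mul]
  map_smul' c H := by rw [subst_smul, smul_mul_assoc, RingHom.id_apply]

theorem hatTranslation_apply (t : K) (F H : NCSeries K) :
    hatTranslation t F H = subst H (hatTwistX t F) (onePlusPow t Y - 1) * F := rfl

theorem hatTranslation_sub_one_apply (t : K) (F H : NCSeries K) : (hatTranslation t F - 1) H =
    subst H (hatTwistX t F) (onePlusPow t Y - 1) * F - H := rfl

/-- The exponential commutes with conjugation, so `e ^ (λ f x f⁻¹) - 1` equals `f (e ^ (λ x) - 1)
f⁻¹`, and duality rewrites `f⁻¹` as `f(y, x)`. In these coordinates the substitution involves only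
integral series when `λ` and `F` are integral. -/
theorem GTPair.mul_ser_hatSeries {g h : GTPair K} (hg : GTPair.IsGT g) {F H : NCSeries K}
    (hF : g.ser = hatSeries F) (hH : h.ser = hatSeries H) :
    (GTPair.mul h g).ser = hatSeries (hatTranslation g.lam F H) := by
  have hx := sub_one_nil (exp_nil (X : NCSeries K))
  have hy := sub_one_nil (exp_nil (Y : NCSeries K))
  have hinv : Ring.inverse g.ser = hatSeries (subst F Y X) := by
    rw [hg.inverse_ser, hF, subst_hatSeries F Y_nil X_nil, hatSeries,
      subst_subst Y_nil X_nil hx hy, subst_X hx hy, subst_Y hx hy]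
  have h1 : g.ser * Ring.inverse g.ser = 1 := Ring.mul_inverse_cancel _ hg.isUnit_ser
  have h2 : Ring.inverse g.ser * g.ser = 1 := Ring.inverse_mul_cancel _ hg.isUnit_ser
  have htw : NCSeries.exp g.twistX - 1 = hatSeries (hatTwistX g.lam F) := by
    have e : g.twistX = g.ser * (g.lam • X) * Ring.inverse g.ser := by
      rw [GTPair.twistX, mul_smul_comm, smul_mul_assoc]
    rw [e, exp_conj h1 h2 (NCSeries.smul_nil X_nil _), hatTwistX, hatSeries_mul, hatSeries_mul,
      ← hinv, ← hF]
    have : hatSeries (onePlusPow g.lam X - 1) = NCSeries.exp (g.lam • X) - 1 := by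
      rw [← hatSeries_onePlusPow_X, hatSeries, subst_sub, subst_one, hatSeries]
    rw [this, mul_sub, sub_mul, mul_one, h1]
  have hty : NCSeries.exp (g.lam • Y) - 1 = hatSeries (onePlusPow g.lam Y - 1) := by
    rw [← hatSeries_onePlusPow_Y, hatSeries, hatSeries, subst_sub, subst_one]
  rw [GTPair.mul_ser, hH, subst_hatSeries H g.twistX_nil (NCSeries.smul_nil Y_nil _), htw, hty,
    hatTranslation_apply, hatSeries_mul, ← hF, hatSeries, hatSeries, hatSeries,
    subst_subst (hatTwistX_nil _ _) (sub_one_nil (onePlusPow_nil _ _)) hx hy]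

theorem GTPair.pow_ser_hatSeries {g : GTPair K} (hg : GTPair.IsGT g) {F : NCSeries K}
    (hF : g.ser = hatSeries F) (m : ℕ) :
    (GTPair.pow g m).ser = hatSeries ((hatTranslation g.lam F ^ m) 1) := by
  induction m with
  | zero =>
    rw [pow_zero, Module.End.one_apply, hatSeries, subst_one]
    rfl
  | succ m ih =>
    rw [GTPair.pow, GTPair.mul_ser_hatSeries hg hF ih, pow_succ', Module.End.mul_apply]

theorem GTPair.pow_lam (g : GTPair K) (m : ℕ) : (GTPair.pow g m).lam = g.lam ^ m := by
  induction m with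
  | zero => rw [pow_zero]; rfl
  | succ m ih =>
    rw [pow_succ, ← ih]
    rfl

end HatCoordinates

/-! ### Integrality of `p`-adic powers -/

section PadicBounds

variable {p : ℕ} [Fact p.Prime]

/-- For natural exponents this is clear. Each coefficient is polynomial, hence continuous, in the
exponent, and the natural numbers are dense in `ℤ_p`. -/
theorem gaussBound_one_onePlusPow {P : NCSeries ℚ_[p]} (hP : P [] = 0) (hP1 : GaussBound 1 1 P)
    (u : ℤ_[p]) : GaussBound 1 1 (onePlusPow (u : ℚ_[p]) P) := by
  intro w
  rw [one_pow, mul_one]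
  have hcont : Continuous fun u : ℤ_[p] => ‖onePlusPow (u : ℚ_[p]) P w‖ := by
    have e : (fun u : ℤ_[p] => ‖onePlusPow (u : ℚ_[p]) P w‖) = fun u : ℤ_[p] =>
        ‖∑ k ∈ Finset.range (w.length + 1), (k.factorial : ℚ_[p])⁻¹ *
          ((u : ℚ_[p]) ^ k * (NCSeries.log (1 + P) ^ k : NCSeries ℚ_[p]) w)‖ := by
      funext u
      congr 1
      change ∑ k ∈ Finset.range (w.length + 1), ((k.factorial : ℚ_[p])⁻¹ •
        ((u : ℚ_[p]) • NCSeries.log (1 + P)) ^ k : NCSeries ℚ_[p]) w = _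
      refine Finset.sum_congr rfl fun k _ => ?_
      rw [smul_pow]
      rfl
    rw [e]
    have : Continuous fun u : ℤ_[p] => (u : ℚ_[p]) := continuous_subtype_val
    fun_prop
  have hcl : IsClosed {u : ℤ_[p] | ‖onePlusPow (u : ℚ_[p]) P w‖ ≤ 1} :=
    isClosed_le hcont continuous_const
  have hnat : Set.range (Nat.cast : ℕ → ℤ_[p]) ⊆ {u | ‖onePlusPow (u : ℚ_[p]) P w‖ ≤ 1} := by
    rintro _ ⟨m, rfl⟩
    rw [Set.mem_ofPred_eq]
    have h := onePlusPow_nat_mul m (1 : ℚ_[p]) P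
    rw [mul_one, onePlusPow_one hP] at h
    have hb := (((GaussBound.one (K := ℚ_[p]) 1).add zero_le_one hP1).pow zero_le_one m) w
    rw [← h] at hb
    simpa using hb
  exact hcl.closure_subset_iff.2 hnat (PadicInt.denseRange_natCast u)

end PadicBounds

/-! ### The logarithm as a limit of binomial sums -/

section PadicLimits

variable {p : ℕ} [Fact p.Prime]

theorem Padic.norm_natCast_inv_le {k : ℕ} (hk : k ≠ 0) :
    ∃ v : ℕ, ‖(k : ℚ_[p])‖ = ((p : ℝ) ^ v)⁻¹ ∧ p ^ v ≤ k := by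
  refine ⟨padicValNat p k, ?_, Nat.le_of_dvd (Nat.pos_of_ne_zero hk) pow_padicValNat_dvd⟩
  rw [Padic.norm_eq_zpow_neg_valuation (by exact_mod_cast hk), Padic.valuation_natCast, zpow_neg,
    zpow_natCast]

theorem choose_div_eq (n k : ℕ) : ((p ^ n).choose (k + 1) : ℚ_[p]) / (p : ℚ_[p]) ^ n =
    ((p ^ n - 1).choose k : ℚ_[p]) / ((k : ℚ_[p]) + 1) := by
  have hp : 0 < p ^ n := pow_pos (Fact.out : p.Prime).pos n
  have h := Nat.add_one_mul_choose_eq (p ^ n - 1) k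
  rw [Nat.sub_add_cancel hp] at h
  have h' : (p : ℚ_[p]) ^ n * ((p ^ n - 1).choose k : ℚ_[p]) =
      ((p ^ n).choose (k + 1) : ℚ_[p]) * ((k : ℚ_[p]) + 1) := by exact_mod_cast h
  have h1 : (p : ℚ_[p]) ^ n ≠ 0 := by exact_mod_cast hp.ne'
  have h2 : (k : ℚ_[p]) + 1 ≠ 0 := by exact_mod_cast k.succ_ne_zero
  rw [div_eq_div_iff h1 h2, ← h']
  ring

theorem norm_choose_div_le (n k : ℕ) :
    ‖((p ^ n).choose (k + 1) : ℚ_[p]) / (p : ℚ_[p]) ^ n‖ ≤ ‖(k : ℚ_[p]) + 1‖⁻¹ := by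
  rw [choose_div_eq, norm_div, div_eq_mul_inv]
  refine mul_le_of_le_one_left (by positivity) ?_
  exact_mod_cast Padic.norm_int_le_one (((p ^ n - 1).choose k : ℕ) : ℤ)

/-- The factors `(p ^ n - 1 - i) / (i + 1)` tend to `-1`. With `choose_div_eq` this produces the
coefficients of the logarithm. -/
theorem tendsto_choose (k : ℕ) :
    Tendsto (fun n : ℕ => ((p ^ n - 1).choose k : ℚ_[p])) atTop (𝓝 ((-1) ^ k)) := by
  induction k with
  | zero => simp
  | succ k ih =>
    have hpow : Tendsto (fun n : ℕ => (p : ℚ_[p]) ^ n) atTop (𝓝 0) :=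
      tendsto_pow_atTop_nhds_zero_of_norm_lt_one Padic.norm_p_lt_one
    have h2 : (k : ℚ_[p]) + 1 ≠ 0 := by exact_mod_cast k.succ_ne_zero
    have h := ih.mul (((hpow.sub_const 1).sub_const (k : ℚ_[p])).div_const ((k : ℚ_[p]) + 1))
    have e : (-1 : ℚ_[p]) ^ k * ((0 - 1 - k) / (k + 1)) = (-1) ^ (k + 1) := by
      field_simp
      ring
    rw [e] at h
    refine h.congr fun n => ?_
    have hp : 0 < p ^ n := pow_pos (Fact.out : p.Prime).pos n
    have hN : ((p ^ n - 1 : ℕ) : ℚ_[p]) = (p : ℚ_[p]) ^ n - 1 := by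
      rw [Nat.cast_sub hp]; simp
    have hc := Nat.choose_succ_right_eq (p ^ n - 1) k
    have hc' : ((p ^ n - 1).choose (k + 1) : ℚ_[p]) * (k + 1) =
        ((p ^ n - 1).choose k : ℚ_[p]) * ((p : ℚ_[p]) ^ n - 1 - k) := by
      rcases le_or_gt k (p ^ n - 1) with hk | hk
      · rw [← hN, ← Nat.cast_sub hk]
        exact_mod_cast hc
      · rw [Nat.choose_eq_zero_of_lt hk, Nat.choose_eq_zero_of_lt (hk.trans k.lt_succ_self)]
        simp
    rw [mul_div_assoc', ← hc', mul_div_assoc, div_self h2, mul_one]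

/-- The sum `∑_{k ≥ 1} (-1) ^ (k + 1) / k * a k`. -/
noncomputable def logSum (a : ℕ → ℚ_[p]) : ℚ_[p] :=
  ∑' k : ℕ, (-1) ^ k / ((k : ℚ_[p]) + 1) * a (k + 1)

theorem binomial_sum_eq (a : ℕ → ℚ_[p]) (n : ℕ) :
    (∑ k ∈ Finset.range (p ^ n + 1), ((p ^ n).choose k : ℚ_[p]) * a k - a 0) / (p : ℚ_[p]) ^ n =
      ∑ k ∈ Finset.range (p ^ n),
        ((p ^ n).choose (k + 1) : ℚ_[p]) / (p : ℚ_[p]) ^ n * a (k + 1) := by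
  rw [Finset.sum_range_succ', Nat.choose_zero_right, Nat.cast_one, one_mul, add_sub_cancel_right,
    Finset.sum_div]
  exact Finset.sum_congr rfl fun k _ => by ring

/-- Dominated convergence: uniformly in `n` the `k`-th term is at most `(k + 1) C p ^ (-(k + 1))`,
since `1 / ‖k + 1‖ ≤ k + 1`. -/
theorem tendsto_logSum {a : ℕ → ℚ_[p]} {C : ℝ} (ha : ∀ k, ‖a k‖ ≤ C * ((p : ℝ)⁻¹) ^ k) :
    Tendsto (fun n : ℕ => (∑ k ∈ Finset.range (p ^ n + 1),
      ((p ^ n).choose k : ℚ_[p]) * a k - a 0) / (p : ℚ_[p]) ^ n) atTop (𝓝 (logSum a)) := by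
  have hp1 : 1 < p := (Fact.out : p.Prime).one_lt
  have hp : (1 : ℝ) < p := by exact_mod_cast hp1
  have hq : ‖(p : ℝ)⁻¹‖ < 1 := by
    rw [norm_inv, Real.norm_of_nonneg (by positivity)]
    exact inv_lt_one_of_one_lt₀ hp
  have hsum : Summable fun k : ℕ => C * (((k + 1 : ℕ) : ℝ) ^ 1 * ((p : ℝ)⁻¹) ^ (k + 1)) :=
    ((summable_nat_add_iff (f := fun k : ℕ => (k : ℝ) ^ 1 * ((p : ℝ)⁻¹) ^ k) 1).2
      (summable_pow_mul_geometric_of_norm_lt_one 1 hq)).mul_left C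
  have key := tendsto_tsum_of_dominated_convergence (𝓕 := atTop) hsum
    (f := fun n k : ℕ => ((p ^ n).choose (k + 1) : ℚ_[p]) / (p : ℚ_[p]) ^ n * a (k + 1))
    (g := fun k : ℕ => (-1) ^ k / ((k : ℚ_[p]) + 1) * a (k + 1)) (fun k => by
      refine Tendsto.mul_const _ ?_
      refine ((tendsto_choose k).div_const ((k : ℚ_[p]) + 1)).congr fun n => ?_
      rw [choose_div_eq])
    (Eventually.of_forall fun n k => by
      have h1 := norm_choose_div_le (p := p) n k
      have h2 : ‖(k : ℚ_[p]) + 1‖⁻¹ ≤ ((k + 1 : ℕ) : ℝ) := by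
        obtain ⟨v, hv, hle⟩ := Padic.norm_natCast_inv_le (p := p) k.succ_ne_zero
        rw [Nat.cast_succ] at hv
        rw [hv, inv_inv]
        exact_mod_cast hle
      rw [norm_mul]
      calc _ ≤ ((k + 1 : ℕ) : ℝ) * (C * ((p : ℝ)⁻¹) ^ (k + 1)) :=
            mul_le_mul (h1.trans h2) (ha _) (norm_nonneg _) (by positivity)
        _ = _ := by ring)
  refine key.congr fun n => ?_
  rw [binomial_sum_eq]
  refine tsum_eq_sum fun k hk => ?_
  rw [Finset.mem_range, not_lt] at hk
  rw [Nat.choose_eq_zero_of_lt (Nat.lt_succ_of_le hk), Nat.cast_zero, zero_div, zero_mul]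

theorem norm_binomial_sum_le {a : ℕ → ℚ_[p]} {B : ℝ} (hB : 0 ≤ B) {n : ℕ} {s : Finset ℕ}
    (h : ∀ k ∈ s, ‖a (k + 1)‖ ≤ B * ‖(k : ℚ_[p]) + 1‖) :
    ‖∑ k ∈ s, ((p ^ n).choose (k + 1) : ℚ_[p]) / (p : ℚ_[p]) ^ n * a (k + 1)‖ ≤ B := by
  refine IsUltrametricDist.norm_sum_le_of_forall_le_of_nonneg hB fun k hk => ?_
  have h2 : (k : ℚ_[p]) + 1 ≠ 0 := by exact_mod_cast k.succ_ne_zero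
  rw [norm_mul]
  calc _ ≤ ‖(k : ℚ_[p]) + 1‖⁻¹ * (B * ‖(k : ℚ_[p]) + 1‖) :=
        mul_le_mul (norm_choose_div_le n k) (h k hk) (norm_nonneg _) (by positivity)
    _ = B := by
      have := norm_ne_zero_iff.2 h2
      field_simp

theorem norm_logSum_le {a : ℕ → ℚ_[p]} {C B : ℝ} (ha : ∀ k, ‖a k‖ ≤ C * ((p : ℝ)⁻¹) ^ k)
    (hB : 0 ≤ B) (h : ∀ k, ‖a (k + 1)‖ ≤ B * ‖(k : ℚ_[p]) + 1‖) : ‖logSum a‖ ≤ B := by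
  refine le_of_tendsto' (tendsto_logSum ha).norm fun n => ?_
  rw [binomial_sum_eq]
  exact norm_binomial_sum_le hB fun k _ => h k

/-- The term `a - 1` dominates strictly: all later terms have norm at most `p ^ (-2)`. This is where
`p > 2` matters, as `(a - 1) ^ 2 / 2` shows. -/
theorem norm_padicLog (hp : 2 < p) {a : ℚ_[p]} (ha : ‖a - 1‖ = (p : ℝ)⁻¹) :
    ‖padicLog p a‖ = (p : ℝ)⁻¹ := by
  have hp0 : (1 : ℝ) < p := by exact_mod_cast (Fact.out : p.Prime).one_lt
  have hlim := (tendsto_logSum (p := p) (a := fun k => (a - 1) ^ k) (C := 1) fun k => by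
    rw [norm_pow, ha, one_mul]).norm
  refine tendsto_nhds_unique hlim (tendsto_const_nhds.congr fun n => ?_)
  rw [binomial_sum_eq]
  have h1 : ‖∑ k ∈ Finset.Ico 1 (p ^ n), ((p ^ n).choose (k + 1) : ℚ_[p]) / (p : ℚ_[p]) ^ n *
      (a - 1) ^ (k + 1)‖ ≤ ((p : ℝ)⁻¹) ^ 2 := by
    refine norm_binomial_sum_le (a := fun k => (a - 1) ^ k) (by positivity) fun k hk => ?_
    obtain ⟨v, hv, hle⟩ := Padic.norm_natCast_inv_le (p := p) k.succ_ne_zero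
    rw [Nat.cast_succ] at hv
    rw [norm_pow, ha, hv, ← inv_pow, ← pow_add]
    refine pow_le_pow_of_le_one (by positivity) (inv_le_one_of_one_le₀ hp0.le) ?_
    have hk1 : 1 ≤ k := (Finset.mem_Ico.1 hk).1
    -- Together with `k ≥ 1` this forces `v + 2 ≤ k + 1`, which is the needed comparison of
    -- exponents.
    have h3 : 3 ^ v ≤ k + 1 := (Nat.pow_le_pow_left hp v).trans hle
    rcases v with _ | v
    · omega
    · have h4 : v < 3 ^ v := Nat.lt_pow_self (by norm_num)
      rw [pow_succ] at h3
      omega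
  rw [Finset.range_eq_Ico, ← Finset.sum_Ico_consecutive _ zero_le_one
    (Nat.one_le_pow n p (Fact.out : p.Prime).pos)]
  have h0 : ∑ k ∈ Finset.Ico 0 1, ((p ^ n).choose (k + 1) : ℚ_[p]) / (p : ℚ_[p]) ^ n *
      (a - 1) ^ (k + 1) = a - 1 := by
    have : (p : ℚ_[p]) ^ n ≠ 0 := pow_ne_zero _ (by exact_mod_cast (Fact.out : p.Prime).ne_zero)
    simp [this]
  rw [h0]
  have hlt : ((p : ℝ)⁻¹) ^ 2 < (p : ℝ)⁻¹ := by
    rw [pow_two]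
    exact mul_lt_of_lt_one_left (by positivity) (inv_lt_one_of_one_lt₀ hp0)
  rw [Padic.add_eq_max_of_ne (by rw [ha]; exact (h1.trans_lt hlt).ne'), ha,
    max_eq_left (h1.trans hlt.le)]

end PadicLimits

/-! ### Contraction by the translation operator and size of its logarithm -/

section TranslationBounds

variable {p : ℕ} [Fact p.Prime]

theorem gaussBound_of_nil {r : ℝ} (hr : 0 ≤ r) (hr1 : r ≤ 1) {F : NCSeries ℚ_[p]} (h0 : F [] = 0)
    (hF : GaussBound 1 1 F) : GaussBound r r F := by
  have := hF.of_integral (k := 1) hr hr1 fun w hw => by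
    rw [List.length_eq_zero_iff.1 (Nat.lt_one_iff.1 hw), h0]
  rwa [pow_one] at this

/-- The middle binomial coefficients are divisible by `p`, and the last term is bounded by `r ^ p =
r ^ (p - 1) r = r / p`: the radius is chosen to make both contributions equal. -/
theorem gaussBound_one_add_pow_sub_one {r : ℝ} (hr : 0 ≤ r) (hr1 : r ≤ 1)
    (hrp : r ^ (p - 1) = (p : ℝ)⁻¹) {b : NCSeries ℚ_[p]} (hb : GaussBound r r b) :
    GaussBound r ((p : ℝ)⁻¹ * r) ((b + 1) ^ p - 1) := by
  have e : (b + 1) ^ p - 1 = ∑ k ∈ Finset.range p, (p.choose (k + 1) : ℚ_[p]) • b ^ (k + 1) := by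
    rw [(Commute.one_right b).add_pow, Finset.sum_range_succ']
    simp only [one_pow, mul_one, pow_zero, Nat.choose_zero_right, Nat.cast_one,
      add_sub_cancel_right]
    refine Finset.sum_congr rfl fun k _ => ?_
    rw [← map_natCast (algebraMap ℚ_[p] (NCSeries ℚ_[p])), ← Algebra.commutes, ← Algebra.smul_def]
  rw [e]
  refine GaussBound.sum hr (by positivity) _ fun k hk => ?_
  have hk' : k < p := Finset.mem_range.1 hk
  refine ((hb.pow hr (k + 1)).smul _).mono ?_
  rcases Nat.lt_or_ge (k + 1) p with hlt | hge
  · have hd : p ∣ p.choose (k + 1) :=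
      (Fact.out : p.Prime).dvd_choose_self k.succ_ne_zero hlt
    obtain ⟨m, hm⟩ := hd
    have hn : ‖(p.choose (k + 1) : ℚ_[p])‖ ≤ (p : ℝ)⁻¹ := by
      rw [hm, Nat.cast_mul, norm_mul, Padic.norm_p]
      refine mul_le_of_le_one_right (by positivity) ?_
      exact_mod_cast Padic.norm_int_le_one (m : ℤ)
    refine mul_le_mul hn ?_ (by positivity) (by positivity)
    calc r ^ (k + 1) ≤ r ^ 1 := pow_le_pow_of_le_one hr hr1 (by omega)
      _ = r := pow_one r
  · have hkp : k + 1 = p := by omega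
    rw [hkp, Nat.choose_self, Nat.cast_one, norm_one, one_mul]
    have : r ^ p = r ^ (p - 1) * r := by
      rw [← pow_succ, Nat.sub_add_cancel (Fact.out : p.Prime).one_le]
    rw [this, hrp]

/-- The difference is `(1 + P) (B ^ p - 1)` with `B = (1 + P) ^ u` integral of constant term `1`, so
the estimate for `p`-th powers applies. -/
theorem gaussBound_onePlusPow_sub {r : ℝ} (hr : 0 ≤ r) (hr1 : r ≤ 1)
    (hrp : r ^ (p - 1) = (p : ℝ)⁻¹) {P : NCSeries ℚ_[p]} (hP : P [] = 0) (hP1 : GaussBound 1 1 P)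
    (u : ℤ_[p]) :
    GaussBound r ((p : ℝ)⁻¹ * r) (onePlusPow (1 + (p : ℚ_[p]) * (u : ℚ_[p])) P - 1 - P) := by
  have hB := gaussBound_one_onePlusPow hP hP1 u
  set B := onePlusPow (u : ℚ_[p]) P with hBd
  have hb : GaussBound r r (B - 1) := gaussBound_of_nil hr hr1 (sub_one_nil (onePlusPow_nil _ _))
    (hB.sub zero_le_one (GaussBound.one 1))
  have h1 : GaussBound r 1 (1 + P) :=
    (GaussBound.one r).add hr ((gaussBound_of_nil hr hr1 hP hP1).mono hr1)
  have e : onePlusPow (1 + (p : ℚ_[p]) * (u : ℚ_[p])) P - 1 - P =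
      (1 + P) * ((B - 1 + 1) ^ p - 1) := by
    rw [onePlusPow_add, onePlusPow_nat_mul, onePlusPow_one hP, sub_add_cancel, ← hBd]
    noncomm_ring
  rw [e]
  exact (h1.mul hr (gaussBound_one_add_pow_sub_one hr hr1 hrp hb)).mono (one_mul _).le

theorem gaussBound_one_onePlusPow_sub_one {P : NCSeries ℚ_[p]} (hP : P [] = 0)
    (hP1 : GaussBound 1 1 P) (u : ℤ_[p]) : GaussBound 1 1 (onePlusPow (u : ℚ_[p]) P - 1) :=
  (gaussBound_one_onePlusPow hP hP1 u).sub zero_le_one (GaussBound.one 1)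

variable {r : ℝ} {F : NCSeries ℚ_[p]} {t : ℚ_[p]} {u : ℤ_[p]}

theorem gaussBound_hatTwistX_sub (hr : 0 ≤ r) (hr1 : r ≤ 1) (hrp : r ^ (p - 1) = (p : ℝ)⁻¹)
    (ht : t = 1 + (p : ℚ_[p]) * (u : ℚ_[p])) (hF : GaussBound r (p : ℝ)⁻¹ (F - 1)) :
    GaussBound r ((p : ℝ)⁻¹ * r) (hatTwistX t F - X) := by
  have hp1 : (p : ℝ)⁻¹ ≤ 1 :=
    inv_le_one_of_one_le₀ (by exact_mod_cast (Fact.out : p.Prime).one_le)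
  have hM := gaussBound_onePlusPow_sub hr hr1 hrp X_nil (GaussBound.X zero_le_one) u
  rw [← ht] at hM
  set L := onePlusPow t X - 1 with hLd
  have hL : GaussBound r r L := by
    have := (hM.mono (mul_le_of_le_one_left hr hp1)).add hr (GaussBound.X hr)
    rwa [sub_add_cancel] at this
  have hF' : GaussBound r (p : ℝ)⁻¹ (subst F Y X - 1) := by
    have := GaussBound.subst hr (GaussBound.Y hr) (GaussBound.X hr) hF
    rwa [subst_sub, subst_one] at this
  have hF'1 : GaussBound r 1 (subst F Y X) := by
    have := (hF'.mono hp1).add hr (GaussBound.one r)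
    rwa [sub_add_cancel] at this
  have e : hatTwistX t F - X =
      (F - 1) * L * subst F Y X + L * (subst F Y X - 1) + (L - X) := by
    rw [hatTwistX, ← hLd]
    noncomm_ring
  rw [e]
  refine GaussBound.add hr (GaussBound.add hr ?_ ?_) hM
  · exact ((hF.mul hr hL).mul hr hF'1).mono (by rw [mul_one])
  · exact (hL.mul hr hF').mono (by rw [mul_comm])

/-- The decisive contraction. Both substituted series are within relative distance `1 / p` of the
variables, and `F` is within `1 / p` of the unit series. -/
theorem gaussBound_hatTranslation_sub (hr : 0 ≤ r) (hr1 : r ≤ 1)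
    (hrp : r ^ (p - 1) = (p : ℝ)⁻¹) (ht : t = 1 + (p : ℚ_[p]) * (u : ℚ_[p]))
    (hF : GaussBound r (p : ℝ)⁻¹ (F - 1)) {c : ℝ} {H : NCSeries ℚ_[p]} (hH : GaussBound r c H) :
    GaussBound r ((p : ℝ)⁻¹ * c) ((hatTranslation t F - 1) H) := by
  have hp1 : (p : ℝ)⁻¹ ≤ 1 :=
    inv_le_one_of_one_le₀ (by exact_mod_cast (Fact.out : p.Prime).one_le)
  have hx := gaussBound_hatTwistX_sub hr hr1 hrp ht hF
  have hy := gaussBound_onePlusPow_sub hr hr1 hrp Y_nil (GaussBound.Y zero_le_one) u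
  rw [← ht] at hy
  have hx' : GaussBound r r (hatTwistX t F) := by
    have := (hx.mono (mul_le_of_le_one_left hr hp1)).add hr (GaussBound.X hr)
    rwa [sub_add_cancel] at this
  have hy' : GaussBound r r (onePlusPow t Y - 1) := by
    have := (hy.mono (mul_le_of_le_one_left hr hp1)).add hr (GaussBound.Y hr)
    rwa [sub_add_cancel] at this
  have hF1 : GaussBound r 1 F := by
    have := (hF.mono hp1).add hr (GaussBound.one r)
    rwa [sub_add_cancel] at this
  have e : (hatTranslation t F - 1) H =
      (subst H (hatTwistX t F) (onePlusPow t Y - 1) - H) * F + H * (F - 1) := by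
    rw [hatTranslation_sub_one_apply]
    noncomm_ring
  rw [e]
  refine GaussBound.add hr ?_ ((hH.mul hr hF).mono (by rw [mul_comm]))
  exact ((GaussBound.subst_sub hr hx' hy' hx hy (by positivity) hH).mul hr hF1).mono
    (by rw [mul_one])

theorem gaussBound_one_hatTranslation_sub (ht : t = 1 + (p : ℚ_[p]) * (u : ℚ_[p]))
    (hF : GaussBound 1 1 F) {H : NCSeries ℚ_[p]} (hH : GaussBound 1 1 H) :
    GaussBound 1 1 ((hatTranslation t F - 1) H) := by
  have ht' : t = ((1 + (p : ℤ_[p]) * u : ℤ_[p]) : ℚ_[p]) := by rw [ht]; push_cast; rfl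
  have hx := gaussBound_one_onePlusPow_sub_one X_nil (GaussBound.X zero_le_one)
    (1 + (p : ℤ_[p]) * u)
  have hy := gaussBound_one_onePlusPow_sub_one Y_nil (GaussBound.Y zero_le_one)
    (1 + (p : ℤ_[p]) * u)
  rw [← ht'] at hx hy
  have hF' := GaussBound.subst zero_le_one (GaussBound.Y zero_le_one) (GaussBound.X zero_le_one) hF
  have hx' : GaussBound 1 1 (hatTwistX t F) :=
    ((hF.mul zero_le_one hx).mul zero_le_one hF').mono (by norm_num)
  rw [hatTranslation_sub_one_apply]
  exact (((GaussBound.subst zero_le_one hx' hy hH).mul zero_le_one hF).mono (by norm_num)).sub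
    zero_le_one hH

theorem gaussBound_hatTranslation_sub_pow (hr : 0 ≤ r) (hr1 : r ≤ 1)
    (hrp : r ^ (p - 1) = (p : ℝ)⁻¹) (ht : t = 1 + (p : ℚ_[p]) * (u : ℚ_[p]))
    (hF : GaussBound r (p : ℝ)⁻¹ (F - 1)) (k : ℕ) :
    GaussBound r ((p : ℝ)⁻¹ ^ k) (((hatTranslation t F - 1) ^ k) 1) := by
  induction k with
  | zero => simpa using GaussBound.one r
  | succ k ih =>
    rw [pow_succ', pow_succ', Module.End.mul_apply]
    exact gaussBound_hatTranslation_sub hr hr1 hrp ht hF ih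

theorem gaussBound_one_hatTranslation_sub_pow (ht : t = 1 + (p : ℚ_[p]) * (u : ℚ_[p]))
    (hF : GaussBound 1 1 F) (k : ℕ) : GaussBound 1 1 (((hatTranslation t F - 1) ^ k) 1) := by
  induction k with
  | zero => simpa using GaussBound.one (1 : ℝ)
  | succ k ih =>
    rw [pow_succ', Module.End.mul_apply]
    exact gaussBound_one_hatTranslation_sub ht hF ih

theorem hatTranslation_pow_apply (m : ℕ) (w : List (Fin 2)) :
    ((hatTranslation t F ^ m) 1 : NCSeries ℚ_[p]) w = ∑ k ∈ Finset.range (m + 1),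
      (m.choose k : ℚ_[p]) * (((hatTranslation t F - 1) ^ k) 1 : NCSeries ℚ_[p]) w := by
  have h := (Commute.one_right (hatTranslation t F - 1)).add_pow m
  rw [sub_add_cancel] at h
  rw [h, LinearMap.sum_apply, NCSeries.sum_apply]
  refine Finset.sum_congr rfl fun k _ => ?_
  rw [one_pow, mul_one, Module.End.mul_apply, Module.End.natCast_apply, map_nsmul,
    ← Nat.cast_smul_eq_nsmul ℚ_[p]]
  rfl

/-- The logarithm of the translation, applied to the unit series. -/
noncomputable def translationLog (t : ℚ_[p]) (F : NCSeries ℚ_[p]) : NCSeries ℚ_[p] := fun w =>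
  logSum fun k => (((hatTranslation t F - 1) ^ k) 1 : NCSeries ℚ_[p]) w

/-- Monotonicity of `v ↦ p ^ v - v`, written without subtraction. -/
theorem pow_add_le_pow_add {p j v : ℕ} (hp : 2 ≤ p) (h : j ≤ v) : p ^ j + v ≤ p ^ v + j := by
  induction v, h using Nat.le_induction with
  | base => exact le_rfl
  | succ v _ ih =>
    have : p ^ v + 1 ≤ p ^ (v + 1) := Nat.pow_lt_pow_right hp v.lt_succ_self
    omega

theorem norm_hatTranslation_sub_pow_le (hr : 0 < r) (hr1 : r < 1)
    (hrp : r ^ (p - 1) = (p : ℝ)⁻¹) (ht : t = 1 + (p : ℚ_[p]) * (u : ℚ_[p]))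
    (hF : GaussBound r (p : ℝ)⁻¹ (F - 1)) (w : List (Fin 2)) (k : ℕ) :
    ‖(((hatTranslation t F - 1) ^ k) 1 : NCSeries ℚ_[p]) w‖ ≤
      (r ^ w.length)⁻¹ * ((p : ℝ)⁻¹) ^ k := by
  have h := gaussBound_hatTranslation_sub_pow hr.le hr1.le hrp ht hF k w
  rwa [← le_div_iff₀ (by positivity), div_eq_inv_mul] at h

theorem tangent_hatTranslation_pow (hr : 0 < r) (hr1 : r < 1)
    (hrp : r ^ (p - 1) = (p : ℝ)⁻¹) (ht : t = 1 + (p : ℚ_[p]) * (u : ℚ_[p]))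
    (hF : GaussBound r (p : ℝ)⁻¹ (F - 1)) :
    (seriesLimit ℚ_[p]).Tangent (fun n => (p : ℚ_[p]) ^ n)
      (fun n => (hatTranslation t F ^ p ^ n) 1) (translationLog t F) := by
  intro w
  refine (tendsto_logSum (norm_hatTranslation_sub_pow_le hr hr1 hrp ht hF w)).congr fun n => ?_
  change _ = ((p : ℚ_[p]) ^ n)⁻¹ * (((hatTranslation t F ^ p ^ n) 1 : NCSeries ℚ_[p]) w -
    (1 : NCSeries ℚ_[p]) w)
  rw [hatTranslation_pow_apply, div_eq_inv_mul]
  rfl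

/-- Let `v` be the valuation of the denominator `k + 1`. For `v < j` integrality of the numerator
suffices. For `v ≥ j` the contraction wins, because `k + 1 ≥ p ^ v` and `p ^ v - v ≥ p ^ j - j`. -/
theorem norm_translationLog_le (hr : 0 < r) (hr1 : r < 1)
    (hrp : r ^ (p - 1) = (p : ℝ)⁻¹) (ht : t = 1 + (p : ℚ_[p]) * (u : ℚ_[p]))
    (hF : GaussBound r (p : ℝ)⁻¹ (F - 1)) (hF1 : GaussBound 1 1 F) {w : List (Fin 2)} {j : ℕ}
    (hw : w.length < p ^ j * (p - 1)) :
    ‖translationLog t F w‖ ≤ (p : ℝ) ^ j * (p : ℝ)⁻¹ := by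
  have hp1 : 1 < p := (Fact.out : p.Prime).one_lt
  have hp0 : (1 : ℝ) < p := by exact_mod_cast hp1
  have hp00 : (p : ℝ) ≠ 0 := by positivity
  refine norm_logSum_le (norm_hatTranslation_sub_pow_le hr hr1 hrp ht hF w) (by positivity)
    fun k => ?_
  obtain ⟨v, hv, hle⟩ := Padic.norm_natCast_inv_le (p := p) k.succ_ne_zero
  rw [Nat.cast_succ] at hv
  rw [hv]
  have h1 := gaussBound_one_hatTranslation_sub_pow ht hF1 (k + 1) w
  rw [one_pow, mul_one] at h1
  have h2 := gaussBound_hatTranslation_sub_pow hr.le hr1.le hrp ht hF (k + 1) w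
  set a := (((hatTranslation t F - 1) ^ (k + 1)) 1 : NCSeries ℚ_[p]) w
  rcases Nat.lt_or_ge v j with hvj | hvj
  · refine h1.trans ?_
    rw [mul_assoc, ← mul_inv, ← pow_succ', ← div_eq_mul_inv, one_le_div (by positivity)]
    exact pow_le_pow_right₀ hp0.le hvj
  -- The strict bound on the degree of `w` gives a strict inequality. Norms are powers of `p`, so it
  -- gains one further factor `p`, exactly what is missing.
  · have hlt : ‖a‖ < (p : ℝ) ^ ((j : ℤ) - 1 - v + 1) := by
      have h3 : ‖a‖ * ((p : ℝ) ^ p ^ j)⁻¹ < (p : ℝ) ^ ((j : ℤ) - 1 - v + 1) *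
          ((p : ℝ) ^ p ^ j)⁻¹ := by
        have h4 : ((p : ℝ)⁻¹) ^ (k + 1) ≤ (p : ℝ) ^ ((j : ℤ) - 1 - v + 1) *
            ((p : ℝ) ^ p ^ j)⁻¹ := by
          rw [inv_pow, ← zpow_natCast, ← zpow_neg, ← zpow_natCast (p : ℝ) (p ^ j), ← zpow_neg,
            ← zpow_add₀ hp00]
          refine zpow_le_zpow_right₀ hp0.le ?_
          have h5 := pow_add_le_pow_add hp1 hvj
          have h6 : p ^ j + v ≤ k + 1 + j := by omega
          have h7 : ((p ^ j : ℕ) : ℤ) + v ≤ k + 1 + j := by exact_mod_cast h6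
          omega
        by_cases ha : ‖a‖ = 0
        · rw [ha, zero_mul]; positivity
        · have hlt : ((p : ℝ) ^ p ^ j)⁻¹ < r ^ w.length := by
            rw [← inv_pow, ← hrp, ← pow_mul, mul_comm (p - 1)]
            exact pow_lt_pow_right_of_lt_one₀ hr hr1 hw
          refine lt_of_lt_of_le ?_ (h2.trans h4)
          exact mul_lt_mul_of_pos_left hlt (lt_of_le_of_ne (norm_nonneg _) (Ne.symm ha))
      exact lt_of_mul_lt_mul_right h3 (by positivity)
    refine ((Padic.norm_le_pow_iff_norm_lt_pow_add_one a _).2 hlt).trans (le_of_eq ?_)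
    rw [zpow_sub₀ hp00, zpow_sub₀ hp00, zpow_natCast, zpow_natCast, zpow_one]
    field_simp

end TranslationBounds

/-! ### From coefficient bounds to the denominators of the statement -/

section LogDenominators

variable {p : ℕ} [Fact p.Prime]

theorem exists_integral_of_mem_hatIntegral {k : ℕ} {f : NCSeries ℚ_[p]} (hf : f ∈ hatIntegral p k) :
    ∃ F : NCSeries ℚ_[p], GaussBound 1 1 F ∧ (∀ w : List (Fin 2), w.length < k → F w = 0) ∧
      f = hatSeries F := by
  obtain ⟨F, hF, rfl⟩ := hf
  refine ⟨fun w => (F w : ℚ_[p]), fun w => ?_, fun w hw => ?_, rfl⟩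
  · rw [one_pow, mul_one]
    exact PadicInt.norm_le_one _
  · change ((F w : ℤ_[p]) : ℚ_[p]) = 0
    rw [hF w hw, PadicInt.coe_zero]

theorem hatSeries_mem_hatIntegral {k : ℕ} {F : NCSeries ℚ_[p]}
    (hF : ∀ w : List (Fin 2), ‖F w‖ ≤ 1) (hk : ∀ w : List (Fin 2), w.length < k → F w = 0) :
    hatSeries F ∈ hatIntegral p k :=
  ⟨fun w => ⟨F w, hF w⟩, fun w hw => PadicInt.ext (hk w hw), rfl⟩

/-- The part of a series in degrees less than `n`. -/
def cutDegree {R : Type*} [Zero R] (n : ℕ) (F : NCSeries R) : NCSeries R :=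
  fun w => if w.length < n then F w else 0

theorem hatSeries_sub {K : Type*} [Field K] [CharZero K] (F G : NCSeries K) :
    hatSeries (F - G) = hatSeries F - hatSeries G :=
  subst_sub F G _ _

theorem hatSeries_congr {K : Type*} [Field K] [CharZero K] {F G : NCSeries K} {w : List (Fin 2)}
    (h : ∀ v : List (Fin 2), v.length ≤ w.length → F v = G v) : hatSeries F w = hatSeries G w :=
  subst_congr (sub_one_nil (exp_nil X)) (sub_one_nil (exp_nil Y)) h le_rfl

/-- The series is cut at the degrees `p ^ s (p - 1)`. The lowest piece is integral, the slice from
stage `s` to stage `s + 1` becomes integral after multiplication by `p ^ (s + 1)`, and the slices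
telescope. -/
theorem hasLogDenominators_hatSeries (hp : 2 < p) {G : NCSeries ℚ_[p]}
    (hG : ∀ (j : ℕ) (w : List (Fin 2)), w.length < p ^ j * (p - 1) → ‖G w‖ ≤ (p : ℝ) ^ j) :
    HasLogDenominators p (hatSeries G) := by
  have hp0 : (p : ℚ_[p]) ≠ 0 := by exact_mod_cast (Fact.out : p.Prime).ne_zero
  have hpR : (0 : ℝ) < p := by exact_mod_cast (Fact.out : p.Prime).pos
  have hd : ∀ s, p ^ s * (p - 1) ≤ p ^ (s + 1) * (p - 1) := fun s =>
    Nat.mul_le_mul_right _ (Nat.pow_le_pow_right (by omega) s.le_succ)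
  have hlt : ∀ s, s < p ^ s * (p - 1) := fun s =>
    (Nat.lt_pow_self (by omega)).trans_le (Nat.le_mul_of_pos_right _ (by omega))
  set c : ℕ → NCSeries ℚ_[p] := fun s => cutDegree (p ^ s * (p - 1)) G with hc
  have hcs : ∀ s (w : List (Fin 2)), ‖(c s : NCSeries ℚ_[p]) w‖ ≤ (p : ℝ) ^ s := by
    intro s w
    change ‖if w.length < _ then G w else 0‖ ≤ _
    split_ifs with h
    · exact hG s w h
    · rw [norm_zero]; positivity
  refine ⟨hatSeries (c 0), hatSeries_mem_hatIntegral (fun w => by simpa using hcs 0 w)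
    (fun w hw => absurd hw (Nat.not_lt_zero _)),
    fun s => hatSeries ((p : ℚ_[p]) ^ (s + 1) • (c (s + 1) - c s)),
    fun s => hatSeries_mem_hatIntegral (fun w => ?_) (fun w hw => ?_), fun w => ?_⟩
  · change ‖(p : ℚ_[p]) ^ (s + 1) * (c (s + 1) w - c s w)‖ ≤ 1
    have h : ‖c (s + 1) w - c s w‖ ≤ (p : ℝ) ^ (s + 1) := by
      rw [sub_eq_add_neg]
      refine (IsUltrametricDist.norm_add_le_max _ _).trans (max_le (hcs _ w) ?_)
      rw [norm_neg]
      exact (hcs s w).trans (pow_le_pow_right₀ (by exact_mod_cast (by omega : 1 ≤ p)) s.le_succ)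
    rw [norm_mul, norm_pow, Padic.norm_p, inv_pow]
    exact (mul_le_mul_of_nonneg_left h (by positivity)).trans
      (inv_mul_cancel₀ (by positivity)).le
  · change (p : ℚ_[p]) ^ (s + 1) * ((if w.length < _ then G w else 0) -
      (if w.length < _ then G w else 0)) = 0
    rw [if_pos hw, if_pos (hw.trans_le (hd s)), sub_self, mul_zero]
  · have hterm : ∀ s, ((p : ℚ_[p]) ^ (s + 1))⁻¹ *
        hatSeries ((p : ℚ_[p]) ^ (s + 1) • (c (s + 1) - c s)) w =
        hatSeries (c (s + 1)) w - hatSeries (c s) w := by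
      intro s
      have e : hatSeries ((p : ℚ_[p]) ^ (s + 1) • (c (s + 1) - c s)) =
          (p : ℚ_[p]) ^ (s + 1) • (hatSeries (c (s + 1)) - hatSeries (c s)) := by
        rw [← hatSeries_sub]
        exact subst_smul _ _ _ _
      rw [e]
      change _ * ((p : ℚ_[p]) ^ (s + 1) * (hatSeries (c (s + 1)) w - hatSeries (c s) w)) = _
      rw [inv_mul_cancel_left₀ (pow_ne_zero _ hp0)]
    have hcut : ∀ s, w.length ≤ s → hatSeries (c s) w = hatSeries G w := fun s hs =>
      hatSeries_congr fun v hv => if_pos ((hv.trans hs).trans_lt (hlt s))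
    simp only [hterm]
    have h := hasSum_sum_of_ne_finset_zero (L := .unconditional ℕ) (s := Finset.range w.length)
      (f := fun s => hatSeries (c (s + 1)) w - hatSeries (c s) w) fun s hs => by
        have hs' : w.length ≤ s := by simpa using hs
        rw [hcut s hs', hcut (s + 1) (hs'.trans s.le_succ), sub_self]
    rwa [Finset.sum_range_sub (fun s => hatSeries (c s) w), hcut _ le_rfl] at h

theorem tendsto_pow_sub_one_div {a : ℚ_[p]} (ha : ‖a - 1‖ = (p : ℝ)⁻¹) :
    Tendsto (fun n : ℕ => (a ^ p ^ n - 1) / (p : ℚ_[p]) ^ n) atTop (𝓝 (padicLog p a)) := by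
  refine (tendsto_logSum (p := p) (a := fun k => (a - 1) ^ k) (C := 1) fun k => by
    rw [norm_pow, ha, one_mul]).congr fun n => ?_
  have h := add_pow (a - 1) 1 (p ^ n)
  rw [sub_add_cancel] at h
  simp only [one_pow, mul_one] at h
  simp only [h, pow_zero, mul_comm ((a - 1) ^ _)]

theorem exists_radius (hp : 2 < p) : ∃ r : ℝ, 0 < r ∧ r < 1 ∧ r ^ (p - 1) = (p : ℝ)⁻¹ := by
  have hp1 : (1 : ℝ) < p := by exact_mod_cast (Fact.out : p.Prime).one_lt
  have h0 : (0 : ℝ) ≤ (p : ℝ)⁻¹ := by positivity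
  have hr : (((p : ℝ)⁻¹) ^ (((p - 1 : ℕ) : ℝ)⁻¹)) ^ (p - 1) = (p : ℝ)⁻¹ :=
    Real.rpow_inv_natCast_pow h0 (by omega)
  refine ⟨_, Real.rpow_pos_of_pos (by positivity) _, Real.rpow_lt_one h0 (inv_lt_one_of_one_lt₀ hp1)
    (inv_pos.2 ?_), hr⟩
  exact_mod_cast (by omega : 0 < p - 1)

end LogDenominators

theorem propositionA1 (p : ℕ) [Fact p.Prime] (hp : 2 < p) (g : GTPair ℚ_[p])
    (hg : GTPair.IsGTp p g)
    (hlam : ∃ u : ℤ_[p]ˣ, g.lam = 1 + (p : ℚ_[p]) * ((u : ℤ_[p]) : ℚ_[p]))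
    (hser : ∃ a ∈ hatIntegral p 1, ∃ b ∈ hatIntegral p (p - 1),
      g.ser = 1 + (p : ℚ_[p]) • a + b) :
    padicLog p g.lam ≠ 0 ∧
    ∃ ψ : NCSeries ℚ_[p],
      GTPair.IsLog p g (padicLog p g.lam) (padicLog p g.lam • ψ) ∧
      GTPair.IsGTLie 1 ψ ∧
      HasLogDenominators p ψ := by
  obtain ⟨u, hu⟩ := hlam
  obtain ⟨a, ha, b, hb, hab⟩ := hser
  obtain ⟨A, hA, -, rfl⟩ := exists_integral_of_mem_hatIntegral ha
  obtain ⟨B, hB, hB0, rfl⟩ := exists_integral_of_mem_hatIntegral hb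
  obtain ⟨r, hr, hr1, hrp⟩ := exists_radius hp
  have hp0 : (p : ℚ_[p]) ≠ 0 := by exact_mod_cast (Fact.out : p.Prime).ne_zero
  have hpR : (0 : ℝ) < p := by exact_mod_cast (Fact.out : p.Prime).pos
  have hp1 : (p : ℝ)⁻¹ ≤ 1 :=
    inv_le_one_of_one_le₀ (by exact_mod_cast (Fact.out : p.Prime).one_le)
  set F : NCSeries ℚ_[p] := 1 + ((p : ℚ_[p]) • A + B) with hFd
  have hF : g.ser = hatSeries F := by
    rw [hab, hFd, hatSeries, hatSeries, hatSeries, subst_add, subst_add, subst_one, subst_smul,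
      add_assoc]
  -- The factor `p` makes the first summand small; for the second, the lowest degree `p - 1` does,
  -- by the choice of `r`.
  have hFr : GaussBound r (p : ℝ)⁻¹ (F - 1) := by
    rw [hFd, add_sub_cancel_left]
    refine GaussBound.add hr.le ?_ (hrp ▸ hB.of_integral hr.le hr1.le hB0)
    have hA' : GaussBound r 1 A := by
      simpa using hA.of_integral (k := 0) hr.le hr1.le fun w hw => absurd hw (Nat.not_lt_zero _)
    have := hA'.smul (p : ℚ_[p])
    rwa [Padic.norm_p, mul_one] at this
  have hF1 : GaussBound 1 1 F :=
    (GaussBound.one 1).add zero_le_one (((hA.smul (p : ℚ_[p])).mono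
      (by rwa [Padic.norm_p, mul_one])).add zero_le_one hB)
  have hnorm : ‖g.lam - 1‖ = (p : ℝ)⁻¹ := by
    rw [hu, add_sub_cancel_left, norm_mul, Padic.norm_p, PadicInt.padic_norm_e_of_padicInt,
      PadicInt.norm_units, mul_one]
  have hL := norm_padicLog hp hnorm
  set L := padicLog p g.lam with hLd
  have hL0 : L ≠ 0 := norm_ne_zero_iff.1 (by rw [hL]; positivity)
  have hlamlim := tendsto_pow_sub_one_div hnorm
  have hT : (seriesLimit ℚ_[p]).Tangent (fun n => (p : ℚ_[p]) ^ n)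
      (fun n => (GTPair.pow g (p ^ n)).ser) (hatSeries (translationLog g.lam F)) := by
    have := tangent_subst (tangent_hatTranslation_pow hr hr1 hrp hu hFr)
      (NCSeries.exp X - 1) (NCSeries.exp Y - 1)
    simp only [GTPair.pow_ser_hatSeries hg.isGT hF]
    exact this
  have hψ : hatSeries (L⁻¹ • translationLog g.lam F) = L⁻¹ • hatSeries (translationLog g.lam F) :=
    subst_smul _ _ _ _
  -- Including `L = ln λ'` in the scale `p ^ n L` normalises the scalar part of the tangent vector
  -- to `1`.
  have hε : Tendsto (fun n : ℕ => (p : ℚ_[p]) ^ n * L) atTop (𝓝 0) := by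
    have := (tendsto_pow_atTop_nhds_zero_of_norm_lt_one (x := (p : ℚ_[p]))
      Padic.norm_p_lt_one).mul_const L
    rwa [zero_mul] at this
  refine ⟨hL0, hatSeries (L⁻¹ • translationLog g.lam F), ⟨?_, fun w => ?_⟩, ?_, ?_⟩
  · simp only [GTPair.pow_lam]
    exact hlamlim
  · rw [hψ, smul_smul, mul_inv_cancel₀ hL0, one_smul]
    refine (hT w).congr fun n => ?_
    rw [div_eq_inv_mul]
    rfl
  · refine GTPair.isGTLie_of_tangent hε (fun n => mul_ne_zero (pow_ne_zero _ hp0) hL0)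
      (fun n => hg.isGT.pow (pow_pos (Fact.out : p.Prime).pos n)) ?_ (fun w => ?_)
    · have := hlamlim.div_const L
      rw [← hLd, div_self hL0] at this
      simpa only [GTPair.pow_lam, div_div] using this
    · rw [hψ]
      refine ((hT w).const_mul L⁻¹).congr fun n => ?_
      change L⁻¹ * (((p : ℚ_[p]) ^ n)⁻¹ * _) = ((p : ℚ_[p]) ^ n * L)⁻¹ * _
      rw [mul_inv, ← mul_assoc, mul_comm L⁻¹]
  · refine hasLogDenominators_hatSeries hp fun j w hw => ?_
    change ‖L⁻¹ * translationLog g.lam F w‖ ≤ _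
    -- Division by `L`, of norm `1 / p`, costs exactly the factor `p` that `norm_translationLog_le`
    -- left to spare.
    rw [norm_mul, norm_inv, hL, inv_inv]
    calc _ ≤ (p : ℝ) * ((p : ℝ) ^ j * (p : ℝ)⁻¹) :=
          mul_le_mul_of_nonneg_left (norm_translationLog_le hr hr1 hrp hu hFr hF1 hw) hpR.le
      _ = _ := by field_simp
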